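/- **Notation.** Let $\alpha\in(0,1)$. For a mesh $0=t_0<t_1<\dots<t_M=T$ ($M\ge1$) put $\tau_j=t_j-t_{j-1}$ and $\rho_j=\tau_j/\tau_{j-1}$ ($2\le j\le M$). For real numbers $\{U^j\}_{j=0}^M$ and $1\le m\le M$ let $$\delta_t^\alpha U^m:=\frac1{\Gamma(1-\alpha)}\int_0^{t_m}(t_m-s)^{-\alpha}\,\frac{d}{ds}(\Pi^mU)(s)\,ds,$$ where $\Pi^mU$ is, on $(t_{j-1},t_j)$, the Lagrange interpolant of $U$ of degree 1 at $t_0,t_1$ if $m=1$; of degree 2 at $t_{j-1},t_j,t_{j+1}$ if $1\le j<m$; of degree 2 at $t_{m-2},t_{m-1},t_m$ if $j=m>1$. **Mesh conditions.** A2$^*(\sigma)$, for $\sigma\in(0,1)$: $1\le\rho_{j+1}\le\rho_j\le \frac{2}{1-\sigma}-1$ for all $j\ge2$ (each inequality being required for those ratios that exist on the mesh). A3, for $\gamma\in\mathbb R$, an exponent $r$ and a constant $c$: $1\le r$, and $r\le(3-\alpha)/\alpha$ if $\gamma>\alpha-1$; and $\tau_1\simeq M^{-r}$, $\tau_j\simeq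 t_j/j$, $t_j\simeq\tau_1j^r$ for $1\le j\le M$, where $a\simeq b$ means $a\le cb$ and $b\le ca$. Call $\sigma\in(0,1)$ *admissible* for $\alpha$ if on every mesh (with any $T>0$ and $M$) satisfying A2$^*(\sigma)$ the operator $\delta_t^\alpha$ is inverse-monotone, i.e. $U^0\le0$ and $\delta_t^\alpha U^m\le0$ for $1\le m\le M$ imply $U^m\le0$ for $0\le m\le M$. **Theorem (Stability of $\delta_t^\alpha-\lambda$).** Let $\alpha\in(0,1)$. An admissible $\sigma$ exists. Moreover, for every admissible $\sigma$, all real $\gamma$, $r$, $c$, $C_0$, all $T>0$ and $\lambda\ge0$, there is a constant $C$, depending only on these quantities and $\alpha$ (in particular not on $M$ or on the mesh), such that the following holds. If a mesh $\{t_j\}_{j=0}^M$ of $[0,T]$ satisfies A2$^*(\sigma)$, A3 (with $\gamma,r,c$) and $\lambda\tau_j^\alpha<1/\Gamma(2-\alpha)$ for $1\le j\le M$, and if $U^0=0$ and $$(\delta_t^\alpha-\lambda)U^j\le C_0\,(\tau_1/t_j)^{\gamma+1}\qquad\text{for } 1\le j\le M,$$ then $$U^j\le C\,\ell_\gamma\,\tau_1\,t_j^{\alpha-1}(\tau_1/t_j)^{\min\{0,\gamma\}}\qquad\text{for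 } 1\le j\le M,$$ where $\ell_\gamma=1+\ln(T/\tau_1)$ for $\gamma=0$ and $\ell_\gamma=1$ otherwise. -/

import Mathlib

namespace L2Subdiffusion

noncomputable section

/-- The Caputo derivative of order `α ∈ (0,1)`:
`∂_t^α u (t) = 1/Γ(1-α) ∫_0^t (t-s)^{-α} u'(s) ds`. -/
def caputo (α : ℝ) (u : ℝ → ℝ) (t : ℝ) : ℝ :=
  (Real.Gamma (1 - α))⁻¹ * ∫ s in (0 : ℝ)..t, (t - s) ^ (-α) * deriv u s

/-- `0 = t_0 < t_1 < ... < t_M = T`. Only the values `t 0, ..., t M` matter. -/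
def IsMesh (T : ℝ) (M : ℕ) (t : ℕ → ℝ) : Prop :=
  t 0 = 0 ∧ t M = T ∧ ∀ j, j < M → t j < t (j + 1)

/-- The step `τ_j = t_j - t_{j-1}`, used for `j ≥ 1`. -/
def tau (t : ℕ → ℝ) (j : ℕ) : ℝ := t j - t (j - 1)

/-- The step ratio `ρ_j = τ_j / τ_{j-1}`, used for `j ≥ 2`. -/
def rho (t : ℕ → ℝ) (j : ℕ) : ℝ := tau t j / tau t (j - 1)

/-- Indices of the interpolation points of `Π^m` on `(t_{j-1}, t_j)`, for `1 ≤ j ≤ m`: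
linear interpolation if `m = 1`, quadratic interpolation at `t_{j-1}, t_j, t_{j+1}` if `j < m`,
and at `t_{m-2}, t_{m-1}, t_m` if `j = m > 1`. -/
def nodes (m j : ℕ) : Finset ℕ :=
  if m = 1 then {0, 1} else if j < m then {j - 1, j, j + 1} else {j - 2, j - 1, j}

/-- The piecewise polynomial interpolant `Π^m U`, equal on `(t_{j-1}, t_j]`, `1 ≤ j ≤ m`, to the
Lagrange interpolation polynomial at the points with indices `nodes m j`. -/
def interp (t U : ℕ → ℝ) (m : ℕ) (s : ℝ) : ℝ :=
  ∑ j ∈ Finset.Icc 1 m,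
    Set.indicator (Set.Ioc (t (j - 1)) (t j))
      (fun x => (Lagrange.interpolate (nodes m j) t U).eval x) s

/-- The L2-type discrete fractional derivative `δ_t^α U^m = ∂_t^α (Π^m U) (t_m)`, `m ≥ 1`. -/
def delta (α : ℝ) (t U : ℕ → ℝ) (m : ℕ) : ℝ :=
  caputo α (interp t U m) (t m)

/-- `1 ≤ ρ_{j+1} ≤ ρ_j ≤ 2/(1-σ) - 1` for all `j ≥ K + 1`, each inequality being required
whenever the ratios in it exist on the mesh (`ρ_j` exists for `2 ≤ j ≤ M`). -/
def MeshA2 (σ : ℝ) (K M : ℕ) (t : ℕ → ℝ) : Prop :=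
  ∀ j, K + 1 ≤ j → j ≤ M →
    1 ≤ rho t j ∧ rho t j ≤ 2 / (1 - σ) - 1 ∧ (j + 1 ≤ M → rho t (j + 1) ≤ rho t j)

/-- The previous condition from the first ratio on, i.e. with `K = 1`. -/
def MeshA2Star (σ : ℝ) (M : ℕ) (t : ℕ → ℝ) : Prop := MeshA2 σ 1 M t

/-- Two-sided comparability `a ≃ b` with constant `c`. -/
def Comparable (c a b : ℝ) : Prop := a ≤ c * b ∧ b ≤ c * a

/-- Quasi-graded mesh with grading exponent `r` and comparability constant `c`:
`τ_1 ≃ M^{-r}`, `τ_j ≃ t_j / j`, `t_j ≃ τ_1 j^r`, where `1 ≤ r`, and moreover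
`r ≤ (3-α)/α` if `γ > α - 1`. -/
def MeshA3 (α γ r c : ℝ) (M : ℕ) (t : ℕ → ℝ) : Prop :=
  1 ≤ r ∧ (α - 1 < γ → r ≤ (3 - α) / α) ∧
  Comparable c (tau t 1) ((M : ℝ) ^ (-r)) ∧
  ∀ j, 1 ≤ j → j ≤ M →
    Comparable c (tau t j) (t j / (j : ℝ)) ∧
    Comparable c (t j) (tau t 1 * (j : ℝ) ^ r)

/-- The lower-triangular matrix of `δ_t^α` on the mesh (with first row `U ↦ U^0`) is
inverse-monotone: `U^0 ≤ 0` and `δ_t^α U^m ≤ 0` for all `m ≥ 1` imply `U ≤ 0`. -/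
def InverseMonotone (α : ℝ) (M : ℕ) (t : ℕ → ℝ) : Prop :=
  ∀ U : ℕ → ℝ, U 0 ≤ 0 → (∀ m, 1 ≤ m → m ≤ M → delta α t U m ≤ 0) → ∀ m, m ≤ M → U m ≤ 0

/-- `σ ∈ (0,1)` is an admissible value of the threshold `σ̄*(α)`: the step-ratio condition
`MeshA2Star σ` suffices for the inverse-monotonicity of `δ_t^α`. -/
def IsThreshold (α σ : ℝ) : Prop :=
  0 < σ ∧ σ < 1 ∧
    ∀ (T : ℝ) (M : ℕ) (t : ℕ → ℝ), 0 < T → IsMesh T M t → MeshA2Star σ M t →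
      InverseMonotone α M t

/-- `ℓ_γ = 1 + ln(T/τ_1)` for `γ = 0` and `ℓ_γ = 1` otherwise. -/
def ell (γ T τ₁ : ℝ) : ℝ := if γ = 0 then 1 + Real.log (T / τ₁) else 1

/-- `𝒰^j(τ_1; γ) = ℓ_γ τ_1 t_j^{α-1} (τ_1/t_j)^{min{0,γ}}`. -/
def stabBound (α γ T : ℝ) (t : ℕ → ℝ) (j : ℕ) : ℝ :=
  ell γ T (tau t 1) * tau t 1 * t j ^ (α - 1) * (tau t 1 / t j) ^ (min 0 γ)

end

end L2Subdiffusion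

/-! There are two independent parts: inverse-monotonicity for step ratios close to one, and, granted
it, the stability bound by comparison with an explicit discrete supersolution.

Admissibility. Up to the factor Γ(1-α), δU^m is a weighted sum of the differences U^{i+1}-U^i. Away
from the last two cells the weights are nonnegative and nondecreasing (`weight_mono`), so summation
by parts handles those cells. The parabola shared by the last two cells spoils the monotonicity, and
the matrix is in general not an M-matrix. The remedy is to propagate the stronger statement U^j ≤
βU^{j-1}, β = 1-2^{-α}, in addition to U ≤ 0 (`last_step`). It needs only that the weights before
the last two be dominated, which is the positivity of one function `ratioDefect` of two step ratios.
This is checked for equal steps by Bernoulli's inequality and persists for nearby ratios by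
continuity (`exists_threshold`).

Stability. The step restriction puts λ below the diagonal entry of δ, so inverse-monotonicity on the
truncated meshes extends to δ-λ (`comparison`). It remains to construct B ≥ 0 with (δ-λ)B ≥
(τ_1/t_j)^{γ+1} and B bounded by a multiple of the stability bound (`exists_barrier`). Three kinds
of barrier are combined.

(a) For γ ≤ α-1 an increasing profile like s^{α-1-γ}e^{Ks} works: its derivative varies slowly over
three consecutive nodes, so δ keeps at least half of the exact fractional derivative, and K large
beats λ (`increasing_barrier`).

(b) For α-1 < γ < α and λ = 0 one uses s(s+a)^{α-2}, whose Caputo derivative is explicit and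
positive although the function eventually decays. The truncation error is at most half of it for all
a ≥ κτ_1; here r ≤ (3-α)/α enters (`exists_decay_bound`). Summing over dyadic a with weights a^{-γ}
gives the required data from the scale a ≈ t_j, and the sum is bounded by a geometric series, a
count of the scales (whence the logarithm at γ = 0) or a telescoping sum, according to the sign of γ
(`exists_decaying_barrier`).

(c) On meshes with a fixed number of cells the powers R^j work (`exists_geometric_barrier`); this
covers the finitely many M that are too small for (a).

The term λB of a barrier (b) with exponent γ < 0 is data of the same type with exponent γ-α,
multiplied by τ_1^α; for γ ≥ 0 its exponent is -α. Adding a barrier for it costs only a constant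
factor (`HasBarrier.absorb_power`), and after finitely many shifts by α the range of (a) is reached,
where λ is already included. -/

namespace L2Subdiffusion

noncomputable section

open MeasureTheory intervalIntegral

/-! ### The discrete operator in terms of divided differences -/

/-- The first divided difference `U[t_i, t_{i+1}]`. -/
def slope (t U : ℕ → ℝ) (i : ℕ) : ℝ := (U (i + 1) - U i) / (t (i + 1) - t i)

/-- The second divided difference `U[t_i, t_{i+1}, t_{i+2}]`. -/
def curv (t U : ℕ → ℝ) (i : ℕ) : ℝ := (slope t U (i + 1) - slope t U i) / (t (i + 2) - t i)

/-- The derivative of `Π^{n+2} U` on the cell `(t_i, t_{i+1})`, `i ≤ n + 1`. -/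
def gradInterp (t U : ℕ → ℝ) (n i : ℕ) (s : ℝ) : ℝ :=
  slope t U i + curv t U (min i n) * (2 * s - t i - t (i + 1))

/-- The singular kernel `(x - s)^{-α}`. -/
def ker (α x s : ℝ) : ℝ := (x - s) ^ (-α)

/-- `Γ(1-α) δ_t^α U^{n+2}`. -/
def opL (α : ℝ) (t U : ℕ → ℝ) (n : ℕ) : ℝ :=
  ∑ i ∈ Finset.range (n + 2), ∫ s in t i..t (i + 1), ker α (t (n + 2)) s * gradInterp t U n i s

theorem ker_intervalIntegrable {α : ℝ} (hα : α < 1) (x a b : ℝ) :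
    IntervalIntegrable (ker α x) volume a b := by
  have h := (intervalIntegrable_rpow' (a := x - a) (b := x - b) (r := -α)
    (by linarith)).comp_sub_left x
  simp only [sub_sub_cancel] at h
  exact h

theorem ker_mul_intervalIntegrable {α : ℝ} (hα : α < 1) (x a b : ℝ) {f : ℝ → ℝ}
    (hf : ContinuousOn f (Set.uIcc a b)) :
    IntervalIntegrable (fun s => ker α x s * f s) volume a b :=
  (ker_intervalIntegrable hα x a b).mul_continuousOn hf

theorem continuous_gradInterp (t U : ℕ → ℝ) (n i : ℕ) : Continuous (gradInterp t U n i) := by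
  unfold gradInterp; fun_prop

theorem mesh_lt {t : ℕ → ℝ} {m : ℕ} (h : ∀ j, j < m → t j < t (j + 1)) {i j : ℕ}
    (hij : i < j) (hj : j ≤ m) : t i < t j := by
  induction j, hij using Nat.le_induction with
  | base => exact h i (by omega)
  | succ k hk ih => exact (ih (by omega)).trans (h k (by omega))

theorem mesh_le {t : ℕ → ℝ} {m : ℕ} (h : ∀ j, j < m → t j < t (j + 1)) {i j : ℕ}
    (hij : i ≤ j) (hj : j ≤ m) : t i ≤ t j := by
  rcases hij.eq_or_lt with rfl | hlt
  · rfl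
  · exact (mesh_lt h hlt hj).le

theorem interp_eq_eval {t : ℕ → ℝ} {m : ℕ} (h : ∀ j, j < m → t j < t (j + 1)) (U : ℕ → ℝ) {i : ℕ}
    (hi : i < m) {s : ℝ} (hs : s ∈ Set.Ioo (t i) (t (i + 1))) :
    interp t U m s = (Lagrange.interpolate (nodes m (i + 1)) t U).eval s := by
  unfold interp
  rw [Finset.sum_eq_single (i + 1)]
  · rw [Set.indicator_of_mem]
    exact ⟨by simpa using hs.1, hs.2.le⟩
  · intro j hj hne
    rw [Finset.mem_Icc] at hj
    apply Set.indicator_of_notMem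
    rintro ⟨h1, h2⟩
    rcases lt_or_gt_of_ne hne with hlt | hgt
    · have := mesh_le h (show j ≤ i by omega) (by omega)
      linarith [hs.1]
    · have := mesh_le h (show i + 1 ≤ j - 1 by omega) (by omega)
      linarith [hs.2]
  · intro hni
    exact absurd (Finset.mem_Icc.2 ⟨by omega, by omega⟩) hni

/-- Newton's form of a polynomial of degree at most two. -/
def newtonPoly (x₀ x₁ y d q : ℝ) : Polynomial ℝ :=
  Polynomial.C y + Polynomial.C d * (Polynomial.X - Polynomial.C x₀)
    + Polynomial.C q * ((Polynomial.X - Polynomial.C x₀) * (Polynomial.X - Polynomial.C x₁))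

theorem newtonPoly_eval (x₀ x₁ y d q s : ℝ) :
    (newtonPoly x₀ x₁ y d q).eval s = y + d * (s - x₀) + q * ((s - x₀) * (s - x₁)) := by
  simp [newtonPoly]

theorem newtonPoly_degree_lt (x₀ x₁ y d q : ℝ) : (newtonPoly x₀ x₁ y d q).degree < 3 := by
  unfold newtonPoly
  refine lt_of_le_of_lt (b := 2) ?_ (by norm_num)
  compute_degree

theorem newtonPoly_deriv (x₀ x₁ y d q s : ℝ) :
    (newtonPoly x₀ x₁ y d q).derivative.eval s = d + q * (2 * s - x₀ - x₁) := by
  simp [newtonPoly]; ring_nf; simp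

/-- Divided differences are symmetric in their nodes, so the parabola has a Newton form based at the
two ends of the cell itself. Only the second difference records the stencil, and the last cell
reuses that of its predecessor. -/
theorem interpolate_nodes {t : ℕ → ℝ} {n : ℕ} (h : ∀ j, j < n + 2 → t j < t (j + 1)) (U : ℕ → ℝ)
    {i : ℕ} (hi : i < n + 2) :
    Lagrange.interpolate (nodes (n + 2) (i + 1)) t U =
      newtonPoly (t i) (t (i + 1)) (U i) (slope t U i) (curv t U (min i n)) := by
  symm
  -- k is the first node of the stencil: i = k except on the last cell, where i = k + 1.
  have hk : ∃ k, k ≤ n ∧ min i n = k ∧ (i = k ∨ i = k + 1) ∧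
      nodes (n + 2) (i + 1) = {k, k + 1, k + 2} := by
    rcases lt_or_ge (i + 1) (n + 2) with hlt | hge
    · exact ⟨i, by omega, by omega, by omega, by simp [nodes, hlt]⟩
    · have : i = n + 1 := by omega
      subst this
      refine ⟨n, le_rfl, by omega, by omega, by simp [nodes]⟩
  obtain ⟨k, hkn, hmin, hik, hnodes⟩ := hk
  rw [hnodes, hmin]
  have h1 := h k (by omega)
  have h2 := h (k + 1) (by omega)
  have h1' : t (k + 1) - t k ≠ 0 := by linarith
  have h2' : t (k + 1 + 1) - t (k + 1) ≠ 0 := by linarith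
  have h3' : t (k + 1 + 1) - t k ≠ 0 := by linarith
  apply Lagrange.eq_interpolate_of_eval_eq
  · intro a ha b hb hab
    simp only [Finset.coe_insert, Finset.coe_singleton, Set.mem_insert_iff,
      Set.mem_singleton_iff] at ha hb
    rcases ha with rfl | rfl | rfl <;> rcases hb with rfl | rfl | rfl <;>
      first | rfl | (exfalso; linarith)
  · have hc : (({k, k + 1, k + 2} : Finset ℕ)).card = 3 := by
      rw [Finset.card_insert_of_notMem, Finset.card_insert_of_notMem, Finset.card_singleton]
      all_goals simp
    rw [hc]
    exact newtonPoly_degree_lt _ _ _ _ _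
  · intro a ha
    rw [newtonPoly_eval]
    simp only [Finset.mem_insert, Finset.mem_singleton] at ha
    unfold curv slope
    rcases hik with rfl | rfl <;> rcases ha with rfl | rfl | rfl
    · simp
    · field_simp; ring
    · field_simp; ring
    · field_simp; ring
    · simp
    · field_simp; ring

theorem interpolate_nodes_one {t : ℕ → ℝ} (h : t 0 < t 1) (U : ℕ → ℝ) :
    Lagrange.interpolate (nodes 1 1) t U = newtonPoly (t 0) (t 1) (U 0) (slope t U 0) 0 := by
  symm
  have hn : nodes 1 1 = {0, 1} := by simp [nodes]
  rw [hn]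
  apply Lagrange.eq_interpolate_of_eval_eq
  · intro a ha b hb hab
    simp only [Finset.coe_insert, Finset.coe_singleton, Set.mem_insert_iff,
      Set.mem_singleton_iff] at ha hb
    rcases ha with rfl | rfl <;> rcases hb with rfl | rfl <;>
      first | rfl | (exfalso; linarith)
  · have hc : (({0, 1} : Finset ℕ)).card = 2 := rfl
    rw [hc]
    refine lt_of_le_of_lt (b := 1) ?_ (by norm_num)
    unfold newtonPoly
    simp only [Polynomial.C_0, zero_mul, add_zero]
    compute_degree
  · intro a ha
    rw [newtonPoly_eval]
    simp only [Finset.mem_insert, Finset.mem_singleton] at ha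
    have : t 1 - t 0 ≠ 0 := by linarith
    rcases ha with rfl | rfl
    · simp
    · unfold slope; field_simp; ring

theorem deriv_interp {t : ℕ → ℝ} {m : ℕ} (h : ∀ j, j < m → t j < t (j + 1)) (U : ℕ → ℝ) {i : ℕ}
    (hi : i < m) {s y d q : ℝ} (hs : s ∈ Set.Ioo (t i) (t (i + 1)))
    (hp : Lagrange.interpolate (nodes m (i + 1)) t U = newtonPoly (t i) (t (i + 1)) y d q) :
    deriv (interp t U m) s = d + q * (2 * s - t i - t (i + 1)) := by
  have hev : interp t U m =ᶠ[nhds s] fun x => (newtonPoly (t i) (t (i + 1)) y d q).eval x := by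
    filter_upwards [isOpen_Ioo.mem_nhds hs] with x hx
    rw [interp_eq_eval h U hi hx, hp]
  rw [hev.deriv_eq, Polynomial.deriv, newtonPoly_deriv]

theorem delta_add_two {α : ℝ} (hα : α < 1) {t : ℕ → ℝ} {n : ℕ} (h0 : t 0 = 0)
    (h : ∀ j, j < n + 2 → t j < t (j + 1)) (U : ℕ → ℝ) :
    delta α t U (n + 2) = (Real.Gamma (1 - α))⁻¹ * opL α t U n := by
  unfold delta caputo opL
  congr 1
  -- Open cells suffice: the interpolant may have kinks at the mesh points, where `deriv` takes its
  -- default value.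
  have hcell : ∀ i, i < n + 2 → Set.EqOn
      (fun s => ker α (t (n + 2)) s * gradInterp t U n i s)
      (fun s => (t (n + 2) - s) ^ (-α) * deriv (interp t U (n + 2)) s)
      (Set.uIoo (t i) (t (i + 1))) := by
    intro i hi s hs
    rw [Set.uIoo_of_lt (h i hi)] at hs
    simp only
    rw [deriv_interp h U hi hs (interpolate_nodes h U hi)]
    rfl
  have hint : ∀ k < n + 2, IntervalIntegrable
      (fun s => (t (n + 2) - s) ^ (-α) * deriv (interp t U (n + 2)) s) volume (t k) (t (k + 1)) := by
    intro k hk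
    rw [← intervalIntegrable_congr_uIoo (hcell k hk)]
    exact ker_mul_intervalIntegrable hα _ _ _ (continuous_gradInterp t U n k).continuousOn
  have := sum_integral_adjacent_intervals hint
  rw [h0] at this
  rw [← this]
  apply Finset.sum_congr rfl
  intro i hi
  exact (integral_congr_uIoo (hcell i (Finset.mem_range.1 hi))).symm

theorem integral_ker {α : ℝ} (hα : α < 1) (x a b : ℝ) :
    ∫ s in a..b, ker α x s = ((x - a) ^ (1 - α) - (x - b) ^ (1 - α)) / (1 - α) := by
  unfold ker
  rw [integral_comp_sub_left (fun z => z ^ (-α)) x, integral_rpow (Or.inl (by linarith))]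
  rw [show -α + 1 = 1 - α by ring]

theorem delta_one {α : ℝ} (hα : α < 1) {t : ℕ → ℝ} (h0 : t 0 = 0)
    (h : t 0 < t 1) (U : ℕ → ℝ) :
    delta α t U 1 = (Real.Gamma (1 - α))⁻¹ * (slope t U 0 * (t 1 ^ (1 - α) / (1 - α))) := by
  unfold delta caputo
  congr 1
  have hcell : Set.EqOn (fun s => (t 1 - s) ^ (-α) * deriv (interp t U 1) s)
      (fun s => ker α (t 1) s * slope t U 0) (Set.uIoo 0 (t 1)) := by
    intro s hs
    rw [← h0, Set.uIoo_of_lt h] at hs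
    simp only
    rw [deriv_interp (i := 0) (by intro j hj; interval_cases j; exact h) U one_pos hs
      (interpolate_nodes_one h U)]
    simp [ker]
  rw [integral_congr_uIoo hcell, intervalIntegral.integral_mul_const, integral_ker hα]
  rw [sub_self, Real.zero_rpow (by linarith), sub_zero, sub_zero, mul_comm]

theorem ker_nonneg {x s : ℝ} (α : ℝ) (h : s ≤ x) : 0 ≤ ker α x s :=
  Real.rpow_nonneg (by linarith) _

theorem ker_mono {α x s s' : ℝ} (hα : 0 ≤ α) (h : s ≤ s') (h' : s' < x) :
    ker α x s ≤ ker α x s' :=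
  Real.rpow_le_rpow_of_nonpos (by linarith) (by linarith) (by linarith)

end

end L2Subdiffusion

namespace L2Subdiffusion

noncomputable section

open MeasureTheory intervalIntegral

/-! ### Moments of the kernel over a cell -/

/-- The derivative `α (x - s)^{-α-1}` of the kernel in `s`. -/
def kerDeriv (α x s : ℝ) : ℝ := α * (x - s) ^ (-α - 1)

theorem hasDerivAt_ker (α : ℝ) {x s : ℝ} (h : s < x) : HasDerivAt (ker α x) (kerDeriv α x s) s := by
  have h1 : HasDerivAt (fun s : ℝ => x - s) (-1) s := by
    simpa using (hasDerivAt_id s).const_sub x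
  have h2 := h1.rpow_const (p := -α) (Or.inl (by linarith))
  exact h2.congr_deriv (by unfold kerDeriv; ring)

theorem kerDeriv_nonneg {α x s : ℝ} (hα : 0 ≤ α) (h : s ≤ x) : 0 ≤ kerDeriv α x s :=
  mul_nonneg hα (Real.rpow_nonneg (by linarith) _)

theorem kerDeriv_mono {α x s s' : ℝ} (hα : 0 ≤ α) (h : s ≤ s') (h' : s' < x) :
    kerDeriv α x s ≤ kerDeriv α x s' :=
  mul_le_mul_of_nonneg_left
    (Real.rpow_le_rpow_of_nonpos (by linarith) (by linarith) (by linarith)) hα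

/-- Convexity of the kernel to the left of its singularity. -/
theorem ker_tangent_le {α x b s : ℝ} (hα : 0 ≤ α) (hbs : b ≤ s) (hs : s < x) :
    ker α x b + kerDeriv α x b * (s - b) ≤ ker α x s := by
  rcases hbs.eq_or_lt with rfl | hlt
  · simp
  obtain ⟨ξ, hξ, he⟩ := exists_hasDerivAt_eq_slope (ker α x) (kerDeriv α x) hlt
    (fun y hy => (hasDerivAt_ker α (hy.2.trans_lt hs)).continuousAt.continuousWithinAt)
    (fun y hy => hasDerivAt_ker α (hy.2.trans hs))
  have h1 := kerDeriv_mono (x := x) hα hξ.1.le (hξ.2.trans hs)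
  rw [he, le_div_iff₀ (by linarith)] at h1
  linarith

theorem ker_sub_le {α x b s : ℝ} (hα : 0 ≤ α) (hbs : b ≤ s) (hs : s < x) :
    ker α x s - ker α x b ≤ kerDeriv α x s * (s - b) := by
  rcases hbs.eq_or_lt with rfl | hlt
  · simp
  obtain ⟨ξ, hξ, he⟩ := exists_hasDerivAt_eq_slope (ker α x) (kerDeriv α x) hlt
    (fun y hy => (hasDerivAt_ker α (hy.2.trans_lt hs)).continuousAt.continuousWithinAt)
    (fun y hy => hasDerivAt_ker α (hy.2.trans hs))
  have h1 := kerDeriv_mono (x := x) hα hξ.2.le hs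
  rw [he, div_le_iff₀ (by linarith)] at h1
  linarith

/-- The first moment of the kernel about the midpoint of `(a, b)`. -/
def midMoment (α x a b : ℝ) : ℝ := ∫ s in a..b, ker α x s * (2 * s - a - b)

theorem continuousOn_kerDeriv {α x a b : ℝ} (hb : b < x) (hab : a ≤ b) :
    ContinuousOn (kerDeriv α x) (Set.uIcc a b) := by
  rw [Set.uIcc_of_le hab]
  unfold kerDeriv
  refine continuousOn_const.mul (ContinuousOn.rpow_const (by fun_prop) fun y hy => Or.inl ?_)
  linarith [hy.2]

/-- Integration by parts against the bubble (s-a)(b-s), which vanishes at both ends. It exhibits the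
moment as positive and of third order in the cell length. -/
theorem midMoment_eq {α x a b : ℝ} (hab : a ≤ b) (hb : b < x) :
    midMoment α x a b = ∫ s in a..b, kerDeriv α x s * ((s - a) * (b - s)) := by
  have hu : ∀ s ∈ Set.uIcc a b, HasDerivAt (ker α x) (kerDeriv α x s) s := by
    intro s hs
    rw [Set.uIcc_of_le hab] at hs
    exact hasDerivAt_ker α (hs.2.trans_lt hb)
  have hv : ∀ s ∈ Set.uIcc a b,
      HasDerivAt (fun s : ℝ => -((s - a) * (b - s))) (2 * s - a - b) s := by
    intro s _
    have h1 : HasDerivAt (fun s : ℝ => s - a) 1 s := (hasDerivAt_id s).sub_const a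
    have h2 : HasDerivAt (fun s : ℝ => b - s) (-1) s := by
      simpa using (hasDerivAt_id s).const_sub b
    exact (h1.mul h2).neg.congr_deriv (by ring)
  have := integral_mul_deriv_eq_deriv_mul hu hv
    (continuousOn_kerDeriv hb hab).intervalIntegrable
    (Continuous.intervalIntegrable (by fun_prop) _ _)
  unfold midMoment
  rw [this]
  simp

theorem integral_bubble (a b : ℝ) : ∫ s in a..b, (s - a) * (b - s) = (b - a) ^ 3 / 6 := by
  have h : ∀ s ∈ Set.uIcc a b,
      HasDerivAt (fun s : ℝ => (s - a) ^ 2 * (b - a) / 2 - (s - a) ^ 3 / 3)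
        ((s - a) * (b - s)) s := by
    intro s _
    have h1 : HasDerivAt (fun s : ℝ => s - a) 1 s := (hasDerivAt_id s).sub_const a
    exact ((((h1.pow 2).mul_const (b - a)).div_const 2).sub
      ((h1.pow 3).div_const 3)).congr_deriv (by push_cast; ring)
  rw [integral_eq_sub_of_hasDerivAt h (Continuous.intervalIntegrable (by fun_prop) _ _)]
  ring

theorem midMoment_bounds {α x a b : ℝ} (hα : 0 ≤ α) (hab : a ≤ b) (hb : b < x) :
    kerDeriv α x a * ((b - a) ^ 3 / 6) ≤ midMoment α x a b ∧
      midMoment α x a b ≤ kerDeriv α x b * ((b - a) ^ 3 / 6) := by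
  have hi : IntervalIntegrable (fun s => kerDeriv α x s * ((s - a) * (b - s))) volume a b :=
    ((continuousOn_kerDeriv hb hab).mul (by fun_prop)).intervalIntegrable
  have hc : ∀ c : ℝ, IntervalIntegrable (fun s => c * ((s - a) * (b - s))) volume a b :=
    fun c => Continuous.intervalIntegrable (by fun_prop) _ _
  rw [midMoment_eq hab hb, ← integral_bubble, ← intervalIntegral.integral_const_mul,
    ← intervalIntegral.integral_const_mul]
  constructor
  · refine integral_mono_on hab (hc _) hi fun s hs => ?_
    exact mul_le_mul_of_nonneg_right (kerDeriv_mono hα hs.1 (hs.2.trans_lt hb))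
      (mul_nonneg (by linarith [hs.1]) (by linarith [hs.2]))
  · refine integral_mono_on hab hi (hc _) fun s hs => ?_
    exact mul_le_mul_of_nonneg_right (kerDeriv_mono hα hs.2 hb)
      (mul_nonneg (by linarith [hs.1]) (by linarith [hs.2]))

/-- The kernel is singular at the right end of this cell, so the moment is computed exactly in
powers of x - s. -/
theorem midMoment_last {α x a : ℝ} (hα : α < 1) (hax : a < x) :
    midMoment α x a x = (x - a) ^ (2 - α) * (α / ((1 - α) * (2 - α))) := by
  unfold midMoment
  have h : ∀ s, ker α x s * (2 * s - a - x)
      = (fun z : ℝ => (x - a) * z ^ (-α) - 2 * (z ^ (-α) * z)) (x - s) := by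
    intro s; simp only [ker]; ring
  simp_rw [h]
  rw [integral_comp_sub_left (fun z : ℝ => (x - a) * z ^ (-α) - 2 * (z ^ (-α) * z)) x, sub_self]
  have h2 : Set.EqOn (fun z : ℝ => (x - a) * z ^ (-α) - 2 * (z ^ (-α) * z))
      (fun z : ℝ => (x - a) * z ^ (-α) - 2 * z ^ (1 - α)) (Set.uIoo 0 (x - a)) := by
    intro z hz
    rw [Set.uIoo_of_lt (by linarith)] at hz
    simp only
    rw [show 1 - α = -α + 1 by ring, Real.rpow_add_one hz.1.ne']
  rw [integral_congr_uIoo h2, intervalIntegral.integral_sub, intervalIntegral.integral_const_mul,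
    intervalIntegral.integral_const_mul, integral_rpow (Or.inl (by linarith)),
    integral_rpow (Or.inl (by linarith)), Real.zero_rpow (by linarith),
    Real.zero_rpow (by linarith)]
  · rw [show -α + 1 = 1 - α by ring, show 1 - α + 1 = (1 - α) + 1 by ring,
      Real.rpow_add_one (x := x - a) (by linarith), show 2 - α = (1 - α) + 1 by ring,
      Real.rpow_add_one (x := x - a) (by linarith)]
    have h1 : 1 - α ≠ 0 := by linarith
    have h3 : 1 - α + 1 ≠ 0 := by linarith
    field_simp
    ring
  · exact (intervalIntegrable_rpow' (by linarith)).const_mul _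
  · exact (intervalIntegrable_rpow' (by linarith)).const_mul _

/-- The integral of the kernel over `(a, b)`. -/
def cellMass (α x a b : ℝ) : ℝ := ∫ s in a..b, ker α x s

theorem cellMass_le {α x a b : ℝ} (hα : 0 ≤ α) (hα1 : α < 1) (hab : a ≤ b) (hb : b < x) :
    cellMass α x a b ≤ (b - a) * ker α x b := by
  have := integral_mono_on hab (ker_intervalIntegrable hα1 x a b)
    (_root_.intervalIntegrable_const (c := ker α x b)) fun s hs => ker_mono hα hs.2 hb
  simpa [cellMass] using this

theorem le_cellMass {α x a b : ℝ} (hα : 0 ≤ α) (hα1 : α < 1) (hab : a ≤ b) (hb : b < x) :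
    (b - a) * ker α x a + kerDeriv α x a * ((b - a) ^ 2 / 2) ≤ cellMass α x a b := by
  have h1 := integral_mono_on hab (f := fun s => ker α x a + kerDeriv α x a * (s - a))
    (Continuous.intervalIntegrable (by fun_prop) _ _) (ker_intervalIntegrable hα1 x a b)
    fun s hs => ker_tangent_le hα hs.1 (hs.2.trans_lt hb)
  have h2 : ∫ s in a..b, (ker α x a + kerDeriv α x a * (s - a))
      = (b - a) * ker α x a + kerDeriv α x a * ((b - a) ^ 2 / 2) := by
    have h : ∀ s ∈ Set.uIcc a b,
        HasDerivAt (fun s : ℝ => ker α x a * s + kerDeriv α x a * ((s - a) ^ 2 / 2))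
          (ker α x a + kerDeriv α x a * (s - a)) s := by
      intro s _
      have h1 : HasDerivAt (fun s : ℝ => s - a) 1 s := (hasDerivAt_id s).sub_const a
      exact (((hasDerivAt_id s).const_mul (ker α x a)).add
        (((h1.pow 2).div_const 2).const_mul (kerDeriv α x a))).congr_deriv (by push_cast; ring)
    rw [integral_eq_sub_of_hasDerivAt h (Continuous.intervalIntegrable (by fun_prop) _ _)]
    ring
  rw [h2] at h1
  exact h1

theorem ker_le_chord {α x a b s : ℝ} (hα : 0 ≤ α) (hab : a < b) (hb : b < x) (has : a ≤ s)
    (hsb : s ≤ b) : ker α x s ≤ ker α x a + (ker α x b - ker α x a) / (b - a) * (s - a) := by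
  have h1 := ker_tangent_le hα hsb hb
  have h2 := ker_sub_le hα has (hsb.trans_lt hb)
  rw [div_mul_eq_mul_div, ← sub_le_iff_le_add', le_div_iff₀ (by linarith)]
  nlinarith [mul_le_mul_of_nonneg_right h1 (show 0 ≤ s - a by linarith),
    mul_le_mul_of_nonneg_right h2 (show 0 ≤ b - s by linarith)]

/-- Convexity again, via the chord. The sharper bound matters for the weight just before the last
two: with the endpoint bound of `cellMass_le` the defect at equal steps would be negative for small
α. -/
theorem cellMass_le_trapezoid {α x a b : ℝ} (hα : 0 ≤ α) (hα1 : α < 1) (hab : a < b) (hb : b < x) :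
    cellMass α x a b ≤ (b - a) * ((ker α x a + ker α x b) / 2) := by
  have hba : b - a ≠ 0 := by linarith
  have h1 := integral_mono_on hab.le
    (g := fun s => ker α x a + (ker α x b - ker α x a) / (b - a) * (s - a))
    (ker_intervalIntegrable hα1 x a b) (Continuous.intervalIntegrable (by fun_prop) _ _)
    fun s hs => ker_le_chord hα hab hb hs.1 hs.2
  have h2 : ∫ s in a..b, (ker α x a + (ker α x b - ker α x a) / (b - a) * (s - a))
      = (b - a) * ((ker α x a + ker α x b) / 2) := by
    have h : ∀ s ∈ Set.uIcc a b, HasDerivAt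
        (fun s : ℝ => ker α x a * s + (ker α x b - ker α x a) / (b - a) * ((s - a) ^ 2 / 2))
          (ker α x a + (ker α x b - ker α x a) / (b - a) * (s - a)) s := by
      intro s _
      have h1 : HasDerivAt (fun s : ℝ => s - a) 1 s := (hasDerivAt_id s).sub_const a
      exact (((hasDerivAt_id s).const_mul (ker α x a)).add
        (((h1.pow 2).div_const 2).const_mul ((ker α x b - ker α x a) / (b - a)))).congr_deriv
        (by push_cast; ring)
    rw [integral_eq_sub_of_hasDerivAt h (Continuous.intervalIntegrable (by fun_prop) _ _)]
    field_simp; ring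
  rw [h2] at h1
  exact h1

theorem cellMass_last {α x a : ℝ} (hα1 : α < 1) :
    cellMass α x a x = (x - a) ^ (1 - α) / (1 - α) := by
  unfold cellMass
  rw [integral_ker hα1, sub_self, Real.zero_rpow (by linarith), sub_zero]

theorem opL_eq_sum {α : ℝ} (hα : α < 1) (t U : ℕ → ℝ) (n : ℕ) :
    opL α t U n = ∑ i ∈ Finset.range (n + 2),
      (slope t U i * cellMass α (t (n + 2)) (t i) (t (i + 1))
        + curv t U (min i n) * midMoment α (t (n + 2)) (t i) (t (i + 1))) := by
  unfold opL cellMass midMoment gradInterp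
  refine Finset.sum_congr rfl fun i _ => ?_
  rw [← intervalIntegral.integral_const_mul, ← intervalIntegral.integral_const_mul,
    ← intervalIntegral.integral_add]
  · congr 1; ext s; ring
  · exact (ker_intervalIntegrable hα _ _ _).const_mul _
  · exact (ker_mul_intervalIntegrable hα _ _ _ (by fun_prop)).const_mul _

end

end L2Subdiffusion

namespace L2Subdiffusion

noncomputable section

open MeasureTheory intervalIntegral

/-! ### The coefficients of the operator and inverse-monotonicity -/

/-- The weight of the correction `curv` in cell `i`, relative to `slope (i+1) - slope i`. -/
def corr (α : ℝ) (t : ℕ → ℝ) (x : ℝ) (i : ℕ) : ℝ :=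
  midMoment α x (t i) (t (i + 1)) / (t (i + 2) - t i)

/-- The weight shifted by one cell, with value zero at the initial cell. -/
def corrPrev (α : ℝ) (t : ℕ → ℝ) (x : ℝ) : ℕ → ℝ
  | 0 => 0
  | i + 1 => corr α t x i

/-- The total correction of the last two cells. -/
def corrLast (α : ℝ) (t : ℕ → ℝ) (n : ℕ) : ℝ :=
  corr α t (t (n + 2)) n + midMoment α (t (n + 2)) (t (n + 1)) (t (n + 2)) / (t (n + 2) - t n)

/-- A second difference is a difference of neighbouring slopes, so each correction is taken from
slope i and given to slope i + 1; collecting by slopes leaves one term at the upper end. -/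
theorem sum_slope_corr (α : ℝ) (t U : ℕ → ℝ) (x : ℝ) (n : ℕ) :
    ∑ i ∈ Finset.range n, (slope t U i * cellMass α x (t i) (t (i + 1))
        + curv t U i * midMoment α x (t i) (t (i + 1)))
      = ∑ i ∈ Finset.range n, slope t U i *
          (cellMass α x (t i) (t (i + 1)) - corr α t x i + corrPrev α t x i)
        + slope t U n * corrPrev α t x n := by
  induction n with
  | zero => simp [corrPrev]
  | succ n ih =>
    rw [Finset.sum_range_succ, ih, Finset.sum_range_succ]
    simp only [corrPrev, corr, curv]
    ring

/-- The last two cells share their parabola, so both their corrections go from slope n to slope n +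
1, which is why they appear only through `corrLast`. -/
theorem opL_eq_slopes {α : ℝ} (hα : α < 1) (t U : ℕ → ℝ) (n : ℕ) :
    opL α t U n = ∑ i ∈ Finset.range n, slope t U i *
          (cellMass α (t (n + 2)) (t i) (t (i + 1)) - corr α t (t (n + 2)) i
            + corrPrev α t (t (n + 2)) i)
        + slope t U n * (cellMass α (t (n + 2)) (t n) (t (n + 1)) - corrLast α t n
            + corrPrev α t (t (n + 2)) n)
        + slope t U (n + 1) * (cellMass α (t (n + 2)) (t (n + 1)) (t (n + 2)) + corrLast α t n) := by
  rw [opL_eq_sum hα, Finset.sum_range_succ, Finset.sum_range_succ]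
  have h : ∑ i ∈ Finset.range n,
      (slope t U i * cellMass α (t (n + 2)) (t i) (t (i + 1))
        + curv t U (min i n) * midMoment α (t (n + 2)) (t i) (t (i + 1)))
      = ∑ i ∈ Finset.range n,
      (slope t U i * cellMass α (t (n + 2)) (t i) (t (i + 1))
        + curv t U i * midMoment α (t (n + 2)) (t i) (t (i + 1))) := by
    refine Finset.sum_congr rfl fun i hi => ?_
    rw [min_eq_left (Finset.mem_range.1 hi).le]
  rw [h, sum_slope_corr, min_self, min_eq_right (Nat.le_succ n)]
  simp only [corrLast, corr, curv]
  ring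

/-- Summation by parts against a nondecreasing nonnegative sequence of weights. -/
theorem le_sum_weights_mul_sub (k U : ℕ → ℝ) (n : ℕ) (hU : ∀ i, i ≤ n + 1 → U i ≤ 0)
    (h0 : 0 ≤ k 0) (hk : ∀ i, i < n → k i ≤ k (i + 1)) :
    k n * U (n + 1) ≤ ∑ i ∈ Finset.range (n + 1), k i * (U (i + 1) - U i) := by
  induction n with
  | zero => simp; nlinarith [hU 0 (by omega)]
  | succ n ih =>
    rw [Finset.sum_range_succ]
    have h1 := ih (fun i hi => hU i (by omega)) fun i hi => hk i (by omega)
    have h2 := hk n (by omega)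
    nlinarith [hU (n + 1) (by omega)]

/-- Compares kernels at two ends of a cell. The factor 3/2 is available when at least two cells of
no smaller length lie between that cell and the singularity. -/
theorem rpow_ratio_le {y z p : ℝ} {k : ℕ} (hy : 0 < y) (hz : 0 < z) (hyz : z ≤ 3 / 2 * y)
    (hp : 0 ≤ p) (hpk : p ≤ k) : y ^ (-p) ≤ (3 / 2) ^ k * z ^ (-p) := by
  rw [Real.rpow_neg hy.le, Real.rpow_neg hz.le]
  have h1 : z ^ p ≤ (3 / 2 * y) ^ p := Real.rpow_le_rpow hz.le hyz hp
  rw [Real.mul_rpow (by norm_num) hy.le] at h1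
  have h2 : (3 / 2 : ℝ) ^ p ≤ (3 / 2) ^ (k : ℝ) :=
    Real.rpow_le_rpow_of_exponent_le (by norm_num) hpk
  rw [Real.rpow_natCast] at h2
  have hyp := Real.rpow_pos_of_pos hy p
  have hzp := Real.rpow_pos_of_pos hz p
  rw [← div_eq_mul_inv, le_div_iff₀ hzp, inv_mul_le_iff₀ hyp]
  nlinarith [mul_le_mul_of_nonneg_right h2 hyp.le]

/-! ### Positivity and monotonicity of the weights away from the last two cells. -/

section weights

variable {α : ℝ} {t : ℕ → ℝ} {n : ℕ}

theorem corr_nonneg (hα : 0 ≤ α) (hm : ∀ j, j < n + 2 → t j < t (j + 1)) {i : ℕ} (hi : i ≤ n) :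
    0 ≤ corr α t (t (n + 2)) i := by
  have h1 := mesh_lt hm (show i < i + 1 by omega) (by omega)
  have h2 := mesh_lt hm (show i + 1 < i + 2 by omega) (by omega)
  have h3 := mesh_lt hm (show i + 1 < n + 2 by omega) (by omega)
  refine div_nonneg (le_trans ?_ (midMoment_bounds hα h1.le h3).1) (by linarith)
  have := kerDeriv_nonneg hα (h1.trans h3).le
  have : 0 ≤ t (i + 1) - t i := by linarith
  positivity

theorem corrPrev_nonneg (hα : 0 ≤ α) (hm : ∀ j, j < n + 2 → t j < t (j + 1)) {i : ℕ}
    (hi : i ≤ n + 1) : 0 ≤ corrPrev α t (t (n + 2)) i := by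
  cases i with
  | zero => exact le_rfl
  | succ i => exact corr_nonneg hα hm (by omega)

/-- The kernel derivative at the common node separates the two moments, which leaves p³(q+r) ≤
q³(p+q) for three consecutive steps p ≤ q and r. This is where the step ratios must be
nonincreasing, rp ≤ q². -/
theorem corr_mono (hα : 0 ≤ α) (hm : ∀ j, j < n + 2 → t j < t (j + 1)) {i : ℕ} (hi : i + 1 ≤ n)
    (h1 : t (i + 1) - t i ≤ t (i + 2) - t (i + 1))
    (h2 : (t (i + 3) - t (i + 2)) * (t (i + 1) - t i) ≤ (t (i + 2) - t (i + 1)) ^ 2) :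
    corr α t (t (n + 2)) i ≤ corr α t (t (n + 2)) (i + 1) := by
  have e1 := mesh_lt hm (show i < i + 1 by omega) (by omega)
  have e2 := mesh_lt hm (show i + 1 < i + 2 by omega) (by omega)
  have e3 := mesh_lt hm (show i + 2 < i + 3 by omega) (by omega)
  have e4 := mesh_lt hm (show i + 2 < n + 2 by omega) (by omega)
  have b1 := (midMoment_bounds hα e1.le (e2.trans e4)).2
  have b2 := (midMoment_bounds hα e2.le e4).1
  have hd := kerDeriv_nonneg (x := t (n + 2)) hα (e2.trans e4).le
  unfold corr
  set p := t (i + 1) - t i with hp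
  set q := t (i + 2) - t (i + 1) with hq
  set r := t (i + 3) - t (i + 2) with hr
  have hp0 : 0 < p := by linarith
  have hq0 : 0 < q := by linarith
  have hr0 : 0 < r := by linarith
  have s1 : t (i + 2) - t i = p + q := by rw [hp, hq]; ring
  have s2 : t (i + 1 + 2) - t (i + 1) = q + r := by rw [hq, hr]; ring
  rw [s1, s2, div_le_div_iff₀ (by linarith) (by linarith)]
  have hpoly : p ^ 3 * (q + r) ≤ q ^ 3 * (p + q) := by
    have a1 : p ^ 2 * (r * p) ≤ p ^ 2 * q ^ 2 := mul_le_mul_of_nonneg_left h2 (by positivity)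
    have a2 : p ^ 2 ≤ q ^ 2 := by nlinarith
    nlinarith [mul_le_mul_of_nonneg_right a2 (show 0 ≤ q ^ 2 by positivity),
      mul_le_mul_of_nonneg_right a2 (show 0 ≤ p * q by positivity)]
  calc midMoment α (t (n + 2)) (t i) (t (i + 1)) * (q + r)
      ≤ kerDeriv α (t (n + 2)) (t (i + 1)) * (p ^ 3 / 6) * (q + r) :=
        mul_le_mul_of_nonneg_right b1 (by linarith)
    _ = kerDeriv α (t (n + 2)) (t (i + 1)) / 6 * (p ^ 3 * (q + r)) := by ring
    _ ≤ kerDeriv α (t (n + 2)) (t (i + 1)) / 6 * (q ^ 3 * (p + q)) :=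
        mul_le_mul_of_nonneg_left hpoly (by linarith)
    _ = kerDeriv α (t (n + 2)) (t (i + 1)) * (q ^ 3 / 6) * (p + q) := by ring
    _ ≤ _ := mul_le_mul_of_nonneg_right b2 (by linarith)

/-- The weight of `U^{i+1} - U^i` in a cell away from the last two. -/
def weight (α : ℝ) (t : ℕ → ℝ) (x : ℝ) (i : ℕ) : ℝ :=
  (cellMass α x (t i) (t (i + 1)) - corr α t x i + corrPrev α t x i) / (t (i + 1) - t i)

/-- The factor 1/12 is the 1/6 of the bubble integral times 1/2, since the stencil is at least twice
as long as its first cell. -/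
theorem corr_le (hα : 0 ≤ α) (hm : ∀ j, j < n + 2 → t j < t (j + 1)) {i : ℕ} (hi : i ≤ n)
    (h1 : t (i + 1) - t i ≤ t (i + 2) - t (i + 1)) :
    corr α t (t (n + 2)) i ≤ kerDeriv α (t (n + 2)) (t (i + 1)) * (t (i + 1) - t i) ^ 2 / 12 := by
  have e1 := mesh_lt hm (show i < i + 1 by omega) (by omega)
  have e2 := mesh_lt hm (show i + 1 < i + 2 by omega) (by omega)
  have e3 := mesh_lt hm (show i + 1 < n + 2 by omega) (by omega)
  have b1 := (midMoment_bounds hα e1.le e3).2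
  have hd := kerDeriv_nonneg (x := t (n + 2)) hα e3.le
  unfold corr
  rw [div_le_iff₀ (by linarith)]
  refine b1.trans ?_
  have : 0 ≤ kerDeriv α (t (n + 2)) (t (i + 1)) * (t (i + 1) - t i) ^ 2 := by positivity
  nlinarith

theorem weight_zero_nonneg (hα : 0 ≤ α) (hα1 : α < 1) (hm : ∀ j, j < n + 2 → t j < t (j + 1))
    (hn : 1 ≤ n) (hτ : ∀ i, i ≤ n → t (i + 1) - t i ≤ t (i + 2) - t (i + 1)) :
    0 ≤ weight α t (t (n + 2)) 0 := by
  have e1 := mesh_lt hm (show 0 < 1 by omega) (by omega)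
  have e3 := mesh_le hm (show 3 ≤ n + 2 by omega) (by omega)
  have τ0 := hτ 0 (by omega)
  have τ1 := hτ 1 (by omega)
  simp only [zero_add, Nat.reduceAdd] at τ0 τ1
  have hx : t 1 < t (n + 2) := by linarith
  have hA := le_cellMass hα hα1 e1.le hx
  have hG := corr_le hα hm (Nat.zero_le n) τ0
  have hd := kerDeriv_nonneg (x := t (n + 2)) hα (e1.trans hx).le
  unfold weight
  refine div_nonneg ?_ (by simp; linarith)
  simp only [corrPrev, zero_add] at hG ⊢
  -- At least two further cells, each no shorter than the first, follow t 1: one factor x - t 1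
  -- absorbs the cell length with constant 1/2, and the kernel changes by at most 3/2.
  have hr : kerDeriv α (t (n + 2)) (t 1) * (t 1 - t 0) ≤ 3 / 4 * ker α (t (n + 2)) (t 0) := by
    have h1 := rpow_ratio_le (k := 1) (p := α) (y := t (n + 2) - t 1) (z := t (n + 2) - t 0)
      (by linarith) (by linarith) (by linarith) hα (by norm_num; linarith)
    have h2 : (t (n + 2) - t 1) ^ (-α - 1) * (t (n + 2) - t 1) = (t (n + 2) - t 1) ^ (-α) := by
      rw [← Real.rpow_add_one (by linarith)]; ring_nf
    have h3 : 0 ≤ (t (n + 2) - t 1) ^ (-α - 1) := Real.rpow_nonneg (by linarith) _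
    have h4 : 0 ≤ (t (n + 2) - t 0) ^ (-α) := Real.rpow_nonneg (by linarith) _
    unfold kerDeriv ker
    have h5 : (t (n + 2) - t 1) ^ (-α - 1) * (t 1 - t 0)
        ≤ 3 / 4 * (t (n + 2) - t 0) ^ (-α) := by
      nlinarith
    have h6 : 0 ≤ (t (n + 2) - t 1) ^ (-α - 1) * (t 1 - t 0) :=
      mul_nonneg h3 (by linarith)
    nlinarith
  have hk := ker_nonneg (x := t (n + 2)) α (e1.trans hx).le
  nlinarith [mul_nonneg hd (sq_nonneg (t 1 - t 0)),
    mul_le_mul_of_nonneg_right hr (show 0 ≤ t 1 - t 0 by linarith),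
    mul_nonneg hk (show 0 ≤ t 1 - t 0 by linarith)]

/-- Both weights are compared with the kernel at the common node. Convexity gives the right one a
surplus Pq/2, P being the kernel derivative there and q the right cell length; the corrections cost
at most (9/4)Pq/12 and Pq/12, so there is room to spare. The factor 9/4 = (3/2)² moves the kernel
derivative back by one cell. -/
theorem weight_mono (hα : 0 ≤ α) (hα1 : α < 1) (hm : ∀ j, j < n + 2 → t j < t (j + 1))
    (hτ : ∀ i, i ≤ n → t (i + 1) - t i ≤ t (i + 2) - t (i + 1)) {i : ℕ} (hi : i + 1 < n) :
    weight α t (t (n + 2)) i ≤ weight α t (t (n + 2)) (i + 1) := by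
  have e1 := mesh_lt hm (show i < i + 1 by omega) (by omega)
  have e2 := mesh_lt hm (show i + 1 < i + 2 by omega) (by omega)
  have e4 := mesh_le hm (show i + 4 ≤ n + 2 by omega) (by omega)
  have τ0 := hτ i (by omega)
  have τ1 := hτ (i + 1) (by omega)
  have τ2 := hτ (i + 2) (by omega)
  set x := t (n + 2) with hxdef
  have hx2 : t (i + 2) < x := by
    have := mesh_lt hm (show i + 2 < n + 2 by omega) (by omega); exact this
  set p := t (i + 1) - t i with hp
  set q := t (i + 2) - t (i + 1) with hq
  have hp0 : 0 < p := by linarith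
  have hq0 : 0 < q := by linarith
  set P := kerDeriv α x (t (i + 1)) with hP
  have hP0 : 0 ≤ P := kerDeriv_nonneg hα (e2.trans hx2).le
  have hA1 : q * ker α x (t (i + 1)) + P * (q ^ 2 / 2) ≤ cellMass α x (t (i + 1)) (t (i + 2)) :=
    le_cellMass hα hα1 e2.le hx2
  have hA0 : cellMass α x (t i) (t (i + 1)) ≤ p * ker α x (t (i + 1)) :=
    cellMass_le hα hα1 e1.le (e2.trans hx2)
  have hG1 : corr α t x (i + 1) ≤ 9 / 4 * P * q ^ 2 / 12 := by
    have h1 := corr_le hα hm (show i + 1 ≤ n by omega) τ1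
    have h2 : kerDeriv α x (t (i + 2)) ≤ 9 / 4 * P := by
      have h3 := rpow_ratio_le (k := 2) (p := α + 1) (y := x - t (i + 2)) (z := x - t (i + 1))
        (by linarith) (by linarith)
        (by
          simp only [show i + 1 + 1 = i + 2 by ring, show i + 1 + 2 = i + 3 by ring,
            show i + 2 + 2 = i + 4 by ring] at τ1 τ2
          linarith)
        (by linarith) (by push_cast; linarith)
      rw [neg_add, ← sub_eq_add_neg] at h3
      simp only [hP, kerDeriv]
      nlinarith
    refine h1.trans ?_
    have : (0 : ℝ) ≤ q ^ 2 := by positivity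
    have h4 : kerDeriv α x (t (i + 2)) * q ^ 2 ≤ 9 / 4 * P * q ^ 2 :=
      mul_le_mul_of_nonneg_right h2 this
    exact div_le_div_of_nonneg_right h4 (by norm_num)
  have hG0 : 0 ≤ corr α t x i := corr_nonneg hα hm (by omega)
  have hGp : corrPrev α t x i ≤ P * p ^ 2 / 12 := by
    cases i with
    | zero => simp only [corrPrev]; positivity
    | succ k =>
      simp only [corrPrev]
      have h1 := corr_le hα hm (show k ≤ n by omega) (hτ k (by omega))
      have h0 := mesh_lt hm (show k < k + 1 by omega) (by omega)
      refine h1.trans ?_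
      have h2 : kerDeriv α x (t (k + 1)) ≤ P := kerDeriv_mono hα e1.le (e2.trans hx2)
      have h3 : (t (k + 1) - t k) ^ 2 ≤ p ^ 2 := by
        have := hτ k (by omega)
        exact pow_le_pow_left₀ (by linarith) this 2
      have h4 : 0 ≤ (t (k + 1) - t k) ^ 2 := by positivity
      exact div_le_div_of_nonneg_right (mul_le_mul h2 h3 h4 hP0) (by norm_num)
  have c1 : weight α t x i ≤ ker α x (t (i + 1)) - corr α t x i / p + P * q / 12 := by
    unfold weight
    rw [← hp, div_le_iff₀ hp0]
    have : (ker α x (t (i + 1)) - corr α t x i / p + P * q / 12) * p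
        = p * ker α x (t (i + 1)) - corr α t x i + P * (q * p) / 12 := by
      field_simp
    rw [this]
    nlinarith [mul_le_mul_of_nonneg_left (show p * p ≤ q * p by nlinarith) hP0]
  have c2 : ker α x (t (i + 1)) + P * q / 2 - 9 / 4 * P * q / 12 ≤ weight α t x (i + 1) := by
    unfold weight
    rw [show t (i + 1 + 1) - t (i + 1) = q from rfl, le_div_iff₀ hq0]
    simp only [corrPrev]
    nlinarith
  have : 0 ≤ corr α t x i / p := by positivity
  nlinarith [mul_nonneg hP0 hq0.le]

end weights

end

end L2Subdiffusion

namespace L2Subdiffusion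

noncomputable section

open MeasureTheory intervalIntegral

/-! ### Meshes with step ratios close to one -/

/-- The scaled correction `(1-α) τ^{α-1} corrLast` is at most this for step ratio `1/y`. -/
def corrBound (α y : ℝ) : ℝ := (α / (2 - α) + (1 - α) * α * y ^ 3 / 6) / (1 + y)

/-- The defect of the last two weights against the trapezoid bound for the weight before them;
`y`, `z` are the two preceding steps relative to the last one. -/
def ratioDefect (α y z : ℝ) : ℝ :=
  2 ^ (-α) * (((1 + y) ^ (1 - α) - 1) / y - corrBound α y / y
      + (1 - 2 ^ (-α)) * (1 + corrBound α y))
    - (1 - α) / 2 * ((1 + y) ^ (-α) + (1 + y + z) ^ (-α))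

/-- With e = 2^{-α} and S = `corrBound α 1`, the defect at equal steps is e²(1 - S - (1-α)/2·(2^α +
(4/3)^α)). Bernoulli's inequality for both powers reduces its positivity to a rational inequality in
α. -/
theorem ratioDefect_one_pos {α : ℝ} (hα : 0 < α) (hα1 : α < 1) : 0 < ratioDefect α 1 1 := by
  unfold ratioDefect corrBound
  have e0 : (0 : ℝ) < 2 ^ (-α) := Real.rpow_pos_of_pos (by norm_num) _
  have e1 : (2 : ℝ) ^ (-α) * 2 ^ α = 1 := by
    rw [← Real.rpow_add (by norm_num)]; simp
  have e2 : (2 : ℝ) ^ (1 - α) = 2 * 2 ^ (-α) := by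
    rw [sub_eq_add_neg, Real.rpow_add (by norm_num), Real.rpow_one]
  have e3 : (3 : ℝ) ^ (-α) = 2 ^ (-α) * 2 ^ (-α) * (4 / 3) ^ α := by
    rw [← Real.mul_rpow (by norm_num) (by norm_num), Real.rpow_neg (by norm_num),
      Real.rpow_neg (by norm_num), Real.div_rpow (by norm_num) (by norm_num)]
    have : (0 : ℝ) < 4 ^ α := Real.rpow_pos_of_pos (by norm_num) _
    have h3 : (0 : ℝ) < 3 ^ α := Real.rpow_pos_of_pos (by norm_num) _
    norm_num
    field_simp
  have b1 : (2 : ℝ) ^ α ≤ 1 + α := by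
    have := rpow_one_add_le_one_add_mul_self (s := 1) (by norm_num) hα.le hα1.le
    norm_num at this; exact this
  have b2 : (4 / 3 : ℝ) ^ α ≤ 1 + α / 3 := by
    have := rpow_one_add_le_one_add_mul_self (s := 1 / 3) (by norm_num) hα.le hα1.le
    norm_num at this; linarith
  norm_num
  rw [e2, e3]
  set e := (2 : ℝ) ^ (-α)
  have h2 : e = e * e * 2 ^ α := by rw [mul_assoc, e1, mul_one]
  set S := (α / (2 - α) + (1 - α) * α / 6) / 2 with hS
  have key : (1 - α) / 2 * (2 ^ α + (4 / 3) ^ α) < 1 - S := by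
    have hl : (1 - α) / 2 * (2 ^ α + (4 / 3) ^ α) ≤ (1 - α) / 2 * ((1 + α) + (1 + α / 3)) :=
      mul_le_mul_of_nonneg_left (by linarith) (by linarith)
    refine hl.trans_lt ?_
    have h3 : α / (2 - α) < 2 * (α / 3 + 2 * α ^ 2 / 3 - α * (1 - α) / 12) := by
      rw [div_lt_iff₀ (by linarith)]
      have : 0 < α ^ 2 := by positivity
      nlinarith [mul_pos this (show 0 < 1 - α by linarith)]
    rw [hS]
    nlinarith
  have h5 : (1 - α) / 2 * (e + e * e * (4 / 3) ^ α)
      = e * e * ((1 - α) / 2 * (2 ^ α + (4 / 3) ^ α)) := by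
    linear_combination (1 - α) / 2 * h2
  rw [h5]
  have h6 : 0 < e * e := by positivity
  nlinarith [mul_lt_mul_of_pos_left key h6]

theorem exists_ratioDefect_pos {α : ℝ} (hα : 0 < α) (hα1 : α < 1) :
    ∃ η, 0 < η ∧ η < 1 ∧ ∀ y z, 1 - η < y → y ≤ 1 → 1 - η < z → z ≤ 1 → 0 < ratioDefect α y z := by
  have hc : ContinuousAt (fun p : ℝ × ℝ => ratioDefect α p.1 p.2) (1, 1) := by
    unfold ratioDefect corrBound
    have h1 : ContinuousAt (fun p : ℝ × ℝ => (1 + p.1) ^ (1 - α)) (1, 1) :=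
      ContinuousAt.rpow_const (by fun_prop) (Or.inl (by norm_num))
    have h2 : ContinuousAt (fun p : ℝ × ℝ => (1 + p.1) ^ (-α)) (1, 1) :=
      ContinuousAt.rpow_const (by fun_prop) (Or.inl (by norm_num))
    have h3 : ContinuousAt (fun p : ℝ × ℝ => (1 + p.1 + p.2) ^ (-α)) (1, 1) :=
      ContinuousAt.rpow_const (by fun_prop) (Or.inl (by norm_num))
    have h4 : ContinuousAt (fun p : ℝ × ℝ =>
        (α / (2 - α) + (1 - α) * α * p.1 ^ 3 / 6) / (1 + p.1)) (1, 1) :=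
      ContinuousAt.div (by fun_prop) (by fun_prop) (by norm_num)
    have h5 : ContinuousAt (fun p : ℝ × ℝ => p.1) (1, 1) := by fun_prop
    exact ((((h1.sub continuousAt_const).div h5 (by norm_num)).sub
      (h4.div h5 (by norm_num))).add (continuousAt_const.mul
        (continuousAt_const.add h4))).const_mul _ |>.sub ((h2.add h3).const_mul _)
  have hev := hc.eventually (lt_mem_nhds (ratioDefect_one_pos hα hα1))
  obtain ⟨ε, hε, hball⟩ := Metric.eventually_nhds_iff.1 hev
  refine ⟨min ε (1 / 2), by positivity, (min_le_right _ _).trans_lt (by norm_num), ?_⟩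
  intro y z hy hy1 hz hz1
  have he := min_le_left ε (1 / 2)
  refine hball (y := (y, z)) ?_
  rw [Prod.dist_eq, max_lt_iff, Real.dist_eq, Real.dist_eq, abs_lt, abs_lt]
  exact ⟨⟨by linarith, by linarith⟩, ⟨by linarith, by linarith⟩⟩

theorem one_sub_le_two_rpow_neg {α : ℝ} (hα : 0 ≤ α) (hα1 : α < 1) : 1 - α ≤ (2 : ℝ) ^ (-α) := by
  have := rpow_one_add_le_one_add_mul_self (s := 1) (by norm_num) hα hα1.le
  norm_num at this
  rw [Real.rpow_neg (by norm_num), le_inv_comm₀ (by linarith) (by positivity)]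
  refine this.trans ?_
  rw [← one_div, le_div_iff₀ (by linarith)]
  nlinarith

/-! ### The last two weights and the induction step for inverse-monotonicity. -/

section last

variable {α : ℝ} {t : ℕ → ℝ} {n : ℕ}

theorem corrLast_le (hα : 0 ≤ α) (hα1 : α < 1) (hm : ∀ j, j < n + 2 → t j < t (j + 1)) {h y : ℝ}
    (hh : h = t (n + 2) - t (n + 1)) (hy : y * h = t (n + 1) - t n) :
    (1 - α) * corrLast α t n ≤ h ^ (1 - α) * corrBound α y := by
  have e1 := hm n (by omega)
  have e2 := hm (n + 1) (by omega)
  have hh0 : 0 < h := by linarith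
  have hy0 : 0 < y := by
    by_contra hneg
    nlinarith
  have b1 := (midMoment_bounds hα e1.le e2).2
  have b2 := midMoment_last hα1 e2
  simp only [show n + 1 + 1 = n + 2 from rfl] at b1 b2 e2
  have hden : t (n + 2) - t n = h * (1 + y) := by linarith
  unfold corrLast corr corrBound
  rw [hden, b2, ← add_div, ← mul_div_assoc (1 - α), ← mul_div_assoc (h ^ (1 - α)),
    div_le_div_iff₀ (by positivity) (by positivity)]
  have hk : kerDeriv α (t (n + 2)) (t (n + 1)) = α * h ^ (-α - 1) := by rw [hh]; rfl
  rw [hk, ← hy] at b1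
  rw [← hh]
  have p1 : h ^ (-α - 1) * h ^ 3 = h ^ (1 - α) * h := by
    rw [← Real.rpow_natCast h 3, ← Real.rpow_add hh0, ← Real.rpow_add_one hh0.ne']
    congr 1; push_cast; ring
  have p2 : h ^ (2 - α) = h ^ (1 - α) * h := by
    rw [← Real.rpow_add_one hh0.ne']; congr 1; ring
  rw [p2]
  have h1 : 1 - α ≠ 0 := by linarith
  have h2 : 2 - α ≠ 0 := by linarith
  have hb : midMoment α (t (n + 2)) (t n) (t (n + 1)) ≤ α * (h ^ (1 - α) * h) * y ^ 3 / 6 := by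
    refine b1.trans (le_of_eq ?_)
    rw [← p1]; ring
  have hP : 0 < h ^ (1 - α) := Real.rpow_pos_of_pos hh0 _
  calc (1 - α) * (midMoment α (t (n + 2)) (t n) (t (n + 1)) +
          h ^ (1 - α) * h * (α / ((1 - α) * (2 - α)))) * (1 + y)
      ≤ (1 - α) * (α * (h ^ (1 - α) * h) * y ^ 3 / 6 +
          h ^ (1 - α) * h * (α / ((1 - α) * (2 - α)))) * (1 + y) := by
        refine mul_le_mul_of_nonneg_right (mul_le_mul_of_nonneg_left ?_ (by linarith))
          (by linarith)
        linarith
    _ = h ^ (1 - α) * (α / (2 - α) + (1 - α) * α * y ^ 3 / 6) * (h * (1 + y)) := by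
        field_simp
        ring

theorem corr_le_corrLast (hα : 0 ≤ α) (hα1 : α < 1) (hm : ∀ j, j < n + 2 → t j < t (j + 1)) :
    corr α t (t (n + 2)) n ≤ corrLast α t n := by
  have e1 := hm n (by omega)
  have e2 := hm (n + 1) (by omega)
  unfold corrLast
  rw [midMoment_last hα1 e2]
  have : 0 ≤ (t (n + 2) - t (n + 1)) ^ (2 - α) := Real.rpow_nonneg (by linarith) _
  have h1 : 0 ≤ α / ((1 - α) * (2 - α)) :=
    div_nonneg hα (mul_nonneg (by linarith) (by linarith))
  have h2 : 0 ≤ t (n + 2) - t n := by linarith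
  linarith [div_nonneg (mul_nonneg this h1) h2]

theorem corrPrev_le_corr (hα : 0 ≤ α) (hm : ∀ j, j < n + 2 → t j < t (j + 1))
    (hτ : ∀ i, i ≤ n → t (i + 1) - t i ≤ t (i + 2) - t (i + 1))
    (hρ : ∀ i, i + 1 ≤ n →
      (t (i + 3) - t (i + 2)) * (t (i + 1) - t i) ≤ (t (i + 2) - t (i + 1)) ^ 2)
    {i : ℕ} (hi : i ≤ n) : corrPrev α t (t (n + 2)) i ≤ corr α t (t (n + 2)) i := by
  cases i with
  | zero => exact corr_nonneg hα hm hi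
  | succ i => exact corr_mono hα hm hi (hτ i (by omega)) (hρ i hi)

/-- The weight of `U^{n+1} - U^n` at level `n + 2`. -/
def penultWeight (α : ℝ) (t : ℕ → ℝ) (n : ℕ) : ℝ :=
  (cellMass α (t (n + 2)) (t n) (t (n + 1)) - corrLast α t n + corrPrev α t (t (n + 2)) n)
    / (t (n + 1) - t n)

/-- The weight of `U^{n+2} - U^{n+1}` at level `n + 2`. -/
def lastWeight (α : ℝ) (t : ℕ → ℝ) (n : ℕ) : ℝ :=
  (cellMass α (t (n + 2)) (t (n + 1)) (t (n + 2)) + corrLast α t n) / (t (n + 2) - t (n + 1))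

theorem lastWeight_eq (hα1 : α < 1) {h : ℝ} (hh : h = t (n + 2) - t (n + 1)) (hh0 : 0 < h) :
    (1 - α) * lastWeight α t n = h ^ (-α) + (1 - α) * corrLast α t n / h := by
  have h1α : 0 < 1 - α := by linarith
  unfold lastWeight
  rw [cellMass_last hα1, ← hh, show (1 : ℝ) - α = -α + 1 by ring, Real.rpow_add_one hh0.ne']
  have : -α + 1 ≠ 0 := by linarith
  field_simp

theorem corrLast_nonneg (hα : 0 ≤ α) (hα1 : α < 1) (hm : ∀ j, j < n + 2 → t j < t (j + 1)) :
    0 ≤ corrLast α t n :=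
  (corr_nonneg hα hm le_rfl).trans (corr_le_corrLast hα hα1 hm)

theorem le_lastWeight (hα : 0 ≤ α) (hα1 : α < 1) (hm : ∀ j, j < n + 2 → t j < t (j + 1)) {h : ℝ}
    (hh : h = t (n + 2) - t (n + 1)) : h ^ (-α) ≤ (1 - α) * lastWeight α t n := by
  have e2 : t (n + 1) < t (n + 2) := hm (n + 1) (by omega)
  have hh0 : 0 < h := by linarith
  rw [lastWeight_eq hα1 hh hh0]
  have : 0 ≤ (1 - α) * corrLast α t n / h :=
    div_nonneg (mul_nonneg (by linarith) (corrLast_nonneg hα hα1 hm)) hh0.le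
  linarith

/-- With h the last step, the second-to-last weight is at most h^{-α}, because its correction is a
net loss, while (1-α) times the last weight is at least h^{-α}; finally 1-α ≤ 2^{-α}. -/
theorem penultWeight_le (hα : 0 ≤ α) (hα1 : α < 1) (hm : ∀ j, j < n + 2 → t j < t (j + 1))
    (hG : corrPrev α t (t (n + 2)) n ≤ corrLast α t n) :
    penultWeight α t n ≤ 2 ^ (-α) * lastWeight α t n := by
  have e1 := hm n (by omega)
  have e2 : t (n + 1) < t (n + 2) := hm (n + 1) (by omega)
  set w := (t (n + 2) - t (n + 1)) ^ (-α) with hw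
  have hw0 : 0 < w := Real.rpow_pos_of_pos (by linarith) _
  have h1 : penultWeight α t n ≤ w := by
    unfold penultWeight
    rw [div_le_iff₀ (by linarith)]
    have := cellMass_le hα hα1 e1.le e2
    have hk : ker α (t (n + 2)) (t (n + 1)) = w := rfl
    rw [hk] at this
    linarith
  have h2 := one_sub_le_two_rpow_neg hα hα1
  have h3 := le_lastWeight hα hα1 hm rfl
  have hl : 0 < lastWeight α t n := pos_of_mul_pos_right (hw0.trans_le h3) (by linarith)
  exact h1.trans (h3.trans (mul_le_mul_of_nonneg_right h2 hl.le))

/-- Rescaling by the last step h leaves functions of the ratio y alone. The z-dependent part of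
`ratioDefect` is added back on the left, so that it can be matched with the trapezoid bound for the
preceding weight. -/
theorem le_last_weights (hα : 0 ≤ α) (hα1 : α < 1) (hm : ∀ j, j < n + 2 → t j < t (j + 1))
    (hτn : t (n + 1) - t n ≤ t (n + 2) - t (n + 1)) {h y : ℝ} (z : ℝ)
    (hh : h = t (n + 2) - t (n + 1)) (hy : y * h = t (n + 1) - t n) :
    h ^ (-α) * (ratioDefect α y z + (1 - α) / 2 * ((1 + y) ^ (-α) + (1 + y + z) ^ (-α)))
      ≤ (1 - α) * (2 ^ (-α) * (penultWeight α t n + (1 - 2 ^ (-α)) * lastWeight α t n)) := by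
  have e1 := hm n (by omega)
  have e2 : t (n + 1) < t (n + 2) := hm (n + 1) (by omega)
  have hh0 : 0 < h := by linarith
  have hyh : 0 < y * h := by linarith
  have hy0 : 0 < y := pos_of_mul_pos_left hyh hh0.le
  have h1α : 0 < 1 - α := by linarith
  have hkl_eq := lastWeight_eq (t := t) (n := n) hα1 hh hh0
  have hcl := corrLast_le hα hα1 hm hh hy
  have hGp0 : 0 ≤ corrPrev α t (t (n + 2)) n := corrPrev_nonneg hα hm (Nat.le_succ n)
  set S := corrLast α t n with hS
  set kn := penultWeight α t n with hkn
  set kl := lastWeight α t n with hkl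
  set e := (2 : ℝ) ^ (-α) with he
  have he0 : 0 < e := Real.rpow_pos_of_pos (by norm_num) _
  set w := h ^ (-α) with hw
  have hw0 : 0 < w := Real.rpow_pos_of_pos hh0 _
  have hwh : h ^ (1 - α) = w * h := by
    rw [hw, ← Real.rpow_add_one hh0.ne']; congr 1; ring
  have hS' : (1 - α) * S / h ≤ w * corrBound α y := by
    rw [div_le_iff₀ hh0]
    rw [hwh] at hcl
    linarith
  have h1 : (1 - α) * (cellMass α (t (n + 2)) (t n) (t (n + 1)))
      = w * h * ((1 + y) ^ (1 - α) - 1) := by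
    unfold cellMass
    rw [integral_ker hα1, mul_div_cancel₀ _ h1α.ne', show t (n + 2) - t n = h * (1 + y) by linarith,
      Real.mul_rpow hh0.le (by linarith), ← hh, hwh]
    ring
  have h2 : w * ((1 + y) ^ (1 - α) - 1) / y - (1 - α) * S / h / y ≤ (1 - α) * kn := by
    have h3 : (w * ((1 + y) ^ (1 - α) - 1) / y - (1 - α) * S / h / y) =
        ((1 - α) * cellMass α (t (n + 2)) (t n) (t (n + 1)) - (1 - α) * S) / (y * h) := by
      rw [h1]; field_simp
    rw [h3, hkn, penultWeight, ← hy, ← mul_div_assoc, ← mul_sub]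
    refine div_le_div_of_nonneg_right (mul_le_mul_of_nonneg_left ?_ h1α.le) hyh.le
    linarith
  -- `corrLast` is subtracted in the second-to-last weight and added, with the smaller factor 1 - e,
  -- through the last one. Its net coefficient is nonpositive because y ≤ 1, so its upper bound may
  -- be inserted.
  have hcoef : 0 ≤ 1 / y - (1 - e) := by
    have hy1 : y ≤ 1 := by
      refine le_of_mul_le_mul_right ?_ hh0
      linarith
    have : 1 ≤ 1 / y := by rw [le_div_iff₀ hy0]; linarith
    linarith
  have h4 := mul_le_mul_of_nonneg_left hS' hcoef
  have h5 : w * ((1 + y) ^ (1 - α) - 1) / y - w * corrBound α y / y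
      + (1 - e) * (w + w * corrBound α y)
      ≤ (1 - α) * kn + (1 - e) * ((1 - α) * kl) := by
    rw [hkl_eq]
    have h6 : (1 / y - (1 - e)) * ((1 - α) * S / h)
      = (1 - α) * S / h / y - (1 - e) * ((1 - α) * S / h) := by ring
    have h7 : (1 / y - (1 - e)) * (w * corrBound α y)
      = w * corrBound α y / y - (1 - e) * (w * corrBound α y) := by ring
    rw [h6, h7] at h4
    linarith
  have h8 := mul_le_mul_of_nonneg_left h5 he0.le
  unfold ratioDefect
  rw [← he]
  calc _ = e * (w * ((1 + y) ^ (1 - α) - 1) / y - w * corrBound α y / y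
      + (1 - e) * (w + w * corrBound α y)) := by ring
    _ ≤ _ := h8
    _ = _ := by ring

/-- The contribution of all cells but the last two. -/
theorem le_sum_first_cells (hα : 0 ≤ α) (hα1 : α < 1) (hm : ∀ j, j < n + 2 → t j < t (j + 1))
    (hτ : ∀ i, i ≤ n → t (i + 1) - t i ≤ t (i + 2) - t (i + 1))
    (hρ : ∀ i, i + 1 ≤ n →
      (t (i + 3) - t (i + 2)) * (t (i + 1) - t i) ≤ (t (i + 2) - t (i + 1)) ^ 2)
    {h y z : ℝ} (hh : h = t (n + 2) - t (n + 1)) (hy : y * h = t (n + 1) - t n) (hz0 : 0 < z)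
    (hz : 1 ≤ n → z * h = t n - t (n - 1)) {U : ℕ → ℝ} (hU : ∀ i, i ≤ n + 1 → U i ≤ 0) :
    ∃ κ, (1 - α) * κ ≤ h ^ (-α) * ((1 - α) / 2 * ((1 + y) ^ (-α) + (1 + y + z) ^ (-α))) ∧
      κ * U n ≤ ∑ i ∈ Finset.range n, slope t U i * (cellMass α (t (n + 2)) (t i) (t (i + 1))
        - corr α t (t (n + 2)) i + corrPrev α t (t (n + 2)) i) := by
  have e1 := hm n (by omega)
  have e2 : t (n + 1) < t (n + 2) := hm (n + 1) (by omega)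
  have hh0 : 0 < h := by linarith
  have hy0 : 0 < y := pos_of_mul_pos_left (show 0 < y * h by linarith) hh0.le
  have h1α : 0 < 1 - α := by linarith
  -- κ is the largest weight before the last two, or zero if there is none.
  cases n with
  | zero =>
    refine ⟨0, ?_, by simp⟩
    rw [mul_zero]
    positivity
  | succ k =>
    refine ⟨weight α t (t (k + 3)) k, ?_, ?_⟩
    · have e0 := mesh_lt hm (show k < k + 1 by omega) (by omega)
      have hzk := hz (by omega)
      simp only [Nat.add_sub_cancel] at hzk
      have hG := corrPrev_le_corr hα hm hτ hρ (show k ≤ k + 1 by omega)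
      have htr := cellMass_le_trapezoid hα hα1 e0 (e1.trans e2)
      simp only [show k + 1 + 2 = k + 3 from rfl] at *
      have h1 : weight α t (t (k + 3)) k
          ≤ (ker α (t (k + 3)) (t k) + ker α (t (k + 3)) (t (k + 1))) / 2 := by
        unfold weight
        rw [div_le_iff₀ (by linarith)]
        linarith
      have h2 : ker α (t (k + 3)) (t (k + 1)) = h ^ (-α) * (1 + y) ^ (-α) := by
        unfold ker
        rw [show t (k + 3) - t (k + 1) = h * (1 + y) by linarith,
          Real.mul_rpow hh0.le (by linarith)]
      have h3 : ker α (t (k + 3)) (t k) = h ^ (-α) * (1 + y + z) ^ (-α) := by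
        unfold ker
        rw [show t (k + 3) - t k = h * (1 + y + z) by linarith,
          Real.mul_rpow hh0.le (by linarith)]
      rw [h2, h3] at h1
      refine (mul_le_mul_of_nonneg_left h1 h1α.le).trans (le_of_eq ?_)
      ring
    · have h1 := le_sum_weights_mul_sub (weight α t (t (k + 3))) U k (fun i hi => hU i (by omega))
        (weight_zero_nonneg hα hα1 hm (by omega) hτ)
        (fun i hi => weight_mono hα hα1 hm hτ (by omega))
      refine h1.trans (le_of_eq (Finset.sum_congr rfl fun i _ => ?_))
      unfold weight slope
      ring

/-- The key step of the inverse-monotonicity proof: `V^j = U^j - β U^{j-1}`, `β = 1 - 2^{-α}`,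
is nonpositive at the new level if it is so before. -/
theorem last_step (hα : 0 < α) (hα1 : α < 1) (hm : ∀ j, j < n + 2 → t j < t (j + 1))
    (hτ : ∀ i, i ≤ n → t (i + 1) - t i ≤ t (i + 2) - t (i + 1))
    (hρ : ∀ i, i + 1 ≤ n →
      (t (i + 3) - t (i + 2)) * (t (i + 1) - t i) ≤ (t (i + 2) - t (i + 1)) ^ 2)
    {y : ℝ} (hy : y * (t (n + 2) - t (n + 1)) = t (n + 1) - t n)
    (hdef : ∃ z, 0 < z ∧ (1 ≤ n → z * (t (n + 2) - t (n + 1)) = t n - t (n - 1)) ∧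
      0 < ratioDefect α y z)
    {U : ℕ → ℝ} (hU : ∀ i, i ≤ n + 1 → U i ≤ 0) (hV : U (n + 1) ≤ (1 - 2 ^ (-α)) * U n)
    (hL : opL α t U n ≤ 0) : U (n + 2) ≤ (1 - 2 ^ (-α)) * U (n + 1) := by
  obtain ⟨z, hz0, hz, hdef⟩ := hdef
  have e2 : t (n + 1) < t (n + 2) := hm (n + 1) (by omega)
  have hlow := le_last_weights hα.le hα1 hm (hτ n le_rfl) z rfl hy
  obtain ⟨κ, hκ, hsum⟩ := le_sum_first_cells hα.le hα1 hm hτ hρ rfl hy hz0 hz hU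
  have c2 := penultWeight_le hα.le hα1 hm
    ((corrPrev_le_corr hα.le hm hτ hρ le_rfl).trans (corr_le_corrLast hα.le hα1 hm))
  have hlast := le_lastWeight hα.le hα1 hm rfl
  rw [opL_eq_slopes hα1] at hL
  have hs1 : slope t U n * (cellMass α (t (n + 2)) (t n) (t (n + 1)) - corrLast α t n
      + corrPrev α t (t (n + 2)) n) = (U (n + 1) - U n) * penultWeight α t n := by
    unfold slope penultWeight; ring
  have hs2 : slope t U (n + 1) * (cellMass α (t (n + 2)) (t (n + 1)) (t (n + 2))
      + corrLast α t n) = (U (n + 2) - U (n + 1)) * lastWeight α t n := by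
    unfold slope lastWeight; ring
  rw [hs1, hs2] at hL
  set kn := penultWeight α t n
  set kl := lastWeight α t n
  set e := (2 : ℝ) ^ (-α)
  set w := (t (n + 2) - t (n + 1)) ^ (-α) with hw
  have hw0 : 0 < w := Real.rpow_pos_of_pos (by linarith) _
  have h1α : 0 < 1 - α := by linarith
  have hkl : 0 < kl := pos_of_mul_pos_right (hw0.trans_le hlast) h1α.le
  have hκ' : κ ≤ e * (kn + (1 - e) * kl) := by
    refine le_of_mul_le_mul_left (hκ.trans (le_trans ?_ hlow)) h1α
    rw [mul_add]
    linarith [mul_pos hw0 hdef]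
  -- The operator inequality gives kl(U_{n+2} - (1-e)U_{n+1}) ≤ (e·kl - kn)U_{n+1} + (kn - κ)U_n. As
  -- kn ≤ e·kl, the previous level allows U_{n+1} to be replaced by (1-e)U_n, and the coefficient of
  -- U_n ≤ 0 becomes e(kn + (1-e)kl) - κ ≥ 0.
  have a1 := mul_nonneg (sub_nonneg.2 c2) (sub_nonneg.2 hV)
  have a2 := mul_nonneg (sub_nonneg.2 hκ') (neg_nonneg.2 (hU n (by omega)))
  have a3 : kl * (U (n + 2) - (1 - e) * U (n + 1)) ≤ 0 := by linarith
  linarith [nonpos_of_mul_nonpos_right a3 hkl]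

end last

/-! ### Existence of an admissible step-ratio threshold. -/

theorem mesh_mono_steps {σ T : ℝ} {M : ℕ} {t : ℕ → ℝ} (hT : IsMesh T M t)
    (hA : MeshA2Star σ M t) {i : ℕ} (hi : i + 2 ≤ M) :
    t (i + 1) - t i ≤ t (i + 2) - t (i + 1) := by
  have h := (hA (i + 2) (by omega) hi).1
  have e := hT.2.2 i (by omega)
  simp only [rho, tau, show i + 2 - 1 = i + 1 from rfl, show i + 1 - 1 = i from rfl] at h
  rw [le_div_iff₀ (by linarith)] at h
  linarith

theorem exists_threshold {α : ℝ} (hα : 0 < α) (hα1 : α < 1) : ∃ σ, IsThreshold α σ := by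
  obtain ⟨η, hη, hη1, hdef⟩ := exists_ratioDefect_pos hα hα1
  -- The ratios are then at most (1+η/8)/(1-η/8), so each step is at least 1-η/4 times the next one;
  -- over two steps the factor (1-η/4)² still exceeds 1-η.
  refine ⟨η / 8, by positivity, by linarith, ?_⟩
  intro T M t hT hmesh hA U hU0 hUδ
  have hτ : ∀ i, i + 2 ≤ M → t (i + 1) - t i ≤ t (i + 2) - t (i + 1) :=
    fun i hi => mesh_mono_steps hmesh hA hi
  have hinc : ∀ i, i < M → 0 < t (i + 1) - t i := fun i hi => by linarith [hmesh.2.2 i hi]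
  have hρ : ∀ i, i + 3 ≤ M →
      (t (i + 3) - t (i + 2)) * (t (i + 1) - t i) ≤ (t (i + 2) - t (i + 1)) ^ 2 := by
    intro i hi
    have h := (hA (i + 2) (by omega) (by omega)).2.2 (by omega)
    simp only [rho, tau, show i + 2 - 1 = i + 1 from rfl, show i + 1 - 1 = i from rfl,
      show i + 2 + 1 = i + 3 from rfl, show i + 3 - 1 = i + 2 from rfl] at h
    have p1 := hinc i (by omega)
    have p2 := hinc (i + 1) (by omega)
    rw [div_le_div_iff₀ p2 p1] at h
    linarith
  have hratio : ∀ i, i + 2 ≤ M →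
      (1 - η / 4) * (t (i + 2) - t (i + 1)) ≤ t (i + 1) - t i := by
    intro i hi
    have h := (hA (i + 2) (by omega) hi).2.1
    have p1 := hinc i (by omega)
    have p2 : 0 < t (i + 2) - t (i + 1) := hinc (i + 1) (by omega)
    simp only [rho, tau, show i + 2 - 1 = i + 1 from rfl, show i + 1 - 1 = i from rfl] at h
    rw [div_le_iff₀ p1] at h
    have h2 : (1 - η / 4) * (2 / (1 - η / 8) - 1) ≤ 1 := by
      have : 0 < 1 - η / 8 := by linarith
      rw [div_sub' this.ne', mul_div_assoc', div_le_iff₀ this]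
      nlinarith
    have h3 := mul_le_mul_of_nonneg_left h (show 0 ≤ 1 - η / 4 by linarith)
    nlinarith
  set β := 1 - (2 : ℝ) ^ (-α) with hβ
  have hβ0 : 0 ≤ β := by
    have : (2 : ℝ) ^ (-α) ≤ 1 :=
      Real.rpow_le_one_of_one_le_of_nonpos (by norm_num) (by linarith)
    linarith
  have key : ∀ m, m ≤ M → (∀ i, i ≤ m → U i ≤ 0) ∧ (1 ≤ m → U m ≤ β * U (m - 1)) := by
    intro m
    induction m with
    | zero =>
      intro _
      refine ⟨fun i hi => ?_, by omega⟩
      obtain rfl : i = 0 := by omega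
      exact hU0
    | succ m ih =>
      intro hm
      obtain ⟨ih1, ih2⟩ := ih (by omega)
      have main : U (m + 1) ≤ β * U m := by
        have hd := hUδ (m + 1) (by omega) hm
        have hG : 0 < (Real.Gamma (1 - α))⁻¹ :=
          inv_pos.2 (Real.Gamma_pos_of_pos (by linarith))
        cases m with
        | zero =>
          rw [zero_add, delta_one hα1 hmesh.1 (hmesh.2.2 0 (by omega))] at hd
          have h1 : 0 < t 1 := by have := hmesh.2.2 0 (by omega); rw [hmesh.1] at this; exact this
          have h2 : 0 < t 1 ^ (1 - α) / (1 - α) :=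
            div_pos (Real.rpow_pos_of_pos h1 _) (by linarith)
          have h3 : slope t U 0 ≤ 0 := by
            by_contra hneg
            push Not at hneg
            have := mul_pos hG (mul_pos hneg h2)
            linarith
          unfold slope at h3
          rw [hmesh.1, zero_add, div_le_iff₀ (by linarith)] at h3
          simp only [zero_add]
          have he0 : 0 < (2 : ℝ) ^ (-α) := Real.rpow_pos_of_pos (by norm_num) _
          nlinarith
        | succ n =>
          have hm' : ∀ j, j < n + 2 → t j < t (j + 1) := fun j hj => hmesh.2.2 j (by omega)
          rw [show n + 1 + 1 = n + 2 from rfl, delta_add_two hα1 hmesh.1 hm'] at hd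
          have hL : opL α t U n ≤ 0 := by
            by_contra hneg
            push Not at hneg
            have := mul_pos hG hneg
            linarith
          have q1 : 0 < t (n + 1) - t n := hinc n (by omega)
          have q2 : 0 < t (n + 2) - t (n + 1) := hinc (n + 1) (by omega)
          refine last_step hα hα1 hm' (fun i hi => hτ i (by omega)) (fun i hi => hρ i (by omega))
            (y := (t (n + 1) - t n) / (t (n + 2) - t (n + 1))) (by field_simp) ?_
            (fun i hi => ih1 i hi) (ih2 (by omega)) hL
          have hy1 : 1 - η < (t (n + 1) - t n) / (t (n + 2) - t (n + 1)) := by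
            rw [lt_div_iff₀ q2]
            have := hratio n (by omega)
            nlinarith
          have hy2 : (t (n + 1) - t n) / (t (n + 2) - t (n + 1)) ≤ 1 := by
            rw [div_le_one q2]
            exact hτ n (by omega)
          cases n with
          | zero =>
            -- With two cells there is no third step, so z is a dummy.
            exact ⟨1, one_pos, by omega, hdef _ _ hy1 hy2 (by linarith) le_rfl⟩
          | succ k =>
            have q0 : 0 < t (k + 1) - t k := hinc k (by omega)
            refine ⟨(t (k + 1) - t k) / (t (k + 3) - t (k + 2)), div_pos q0 q2, ?_, ?_⟩
            · intro _
              simp only [Nat.add_sub_cancel, show k + 1 + 2 = k + 3 from rfl,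
                show k + 1 + 1 = k + 2 from rfl] at q2 ⊢
              field_simp
            · refine hdef _ _ hy1 hy2 ?_ ?_
              · rw [lt_div_iff₀ q2]
                have h1 := hratio k (by omega)
                have h2 := hratio (k + 1) (by omega)
                simp only [show k + 1 + 2 = k + 3 from rfl,
                  show k + 1 + 1 = k + 2 from rfl] at h2 q2
                have h3 := mul_le_mul_of_nonneg_left h2 (show 0 ≤ 1 - η / 4 by linarith)
                nlinarith [mul_pos hη q2, mul_pos (mul_pos hη hη) q2]
              · rw [div_le_one q2]
                exact (hτ k (by omega)).trans (hτ (k + 1) (by omega))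
      refine ⟨fun i hi => ?_, fun _ => by simpa using main⟩
      rcases Nat.lt_or_ge i (m + 1) with hlt | hge
      · exact ih1 i (by omega)
      · obtain rfl : i = m + 1 := by omega
        have := ih1 m le_rfl
        nlinarith
  exact fun m hm => (key m hm).1 m le_rfl

end

end L2Subdiffusion

namespace L2Subdiffusion

noncomputable section

open MeasureTheory intervalIntegral

/-! ### Comparison principle and barriers -/

theorem delta_congr {α : ℝ} {t U V : ℕ → ℝ} {m : ℕ} (h : ∀ i, i ≤ m → U i = V i)
    (ht : ∀ j, j < m → t j < t (j + 1)) : delta α t U m = delta α t V m := by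
  unfold delta
  congr 1
  funext s
  unfold interp
  refine Finset.sum_congr rfl fun j hj => ?_
  rw [Finset.mem_Icc] at hj
  have hsub : ∀ i ∈ nodes m j, i ≤ m := by
    intro i hi
    unfold nodes at hi
    split_ifs at hi with h1 h2 <;> simp only [Finset.mem_insert, Finset.mem_singleton] at hi <;>
      omega
  have hinj : Set.InjOn t (nodes m j) := by
    intro a ha b hb hab
    have ha' := hsub a ha
    have hb' := hsub b hb
    rcases lt_trichotomy a b with hlt | rfl | hlt
    · exact absurd hab (mesh_lt ht hlt hb').ne
    · rfl
    · exact absurd hab (mesh_lt ht hlt ha').ne'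
  rw [(Lagrange.interpolate_eq_iff_values_eq_on U V hinj).2 fun i hi => h i (hsub i hi)]

theorem opL_linear {α : ℝ} (hα1 : α < 1) (t U V : ℕ → ℝ) (a b : ℝ) (n : ℕ) :
    opL α t (fun i => a * U i + b * V i) n = a * opL α t U n + b * opL α t V n := by
  have hs : ∀ i, slope t (fun i => a * U i + b * V i) i = a * slope t U i + b * slope t V i := by
    intro i; unfold slope; ring
  rw [opL_eq_slopes hα1, opL_eq_slopes hα1, opL_eq_slopes hα1, hs, hs]
  simp_rw [hs, add_mul, Finset.sum_add_distrib, mul_assoc, ← Finset.mul_sum]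
  ring

theorem delta_linear {α : ℝ} (hα1 : α < 1) {t : ℕ → ℝ} {m : ℕ} (h0 : t 0 = 0)
    (h : ∀ j, j < m → t j < t (j + 1)) (hm : 1 ≤ m) (U V : ℕ → ℝ) (a b : ℝ) :
    delta α t (fun i => a * U i + b * V i) m = a * delta α t U m + b * delta α t V m := by
  obtain rfl | ⟨n, rfl⟩ : m = 1 ∨ ∃ n, m = n + 2 := by
    rcases Nat.lt_or_ge m 2 with h2 | h2
    · exact Or.inl (by omega)
    · exact Or.inr ⟨m - 2, by omega⟩
  · rw [delta_one hα1 h0 (h 0 one_pos), delta_one hα1 h0 (h 0 one_pos),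
      delta_one hα1 h0 (h 0 one_pos)]
    unfold slope; ring
  · rw [delta_add_two hα1 h0 h, delta_add_two hα1 h0 h, delta_add_two hα1 h0 h, opL_linear hα1]
    ring

theorem delta_sum {α : ℝ} (hα1 : α < 1) {t : ℕ → ℝ} {m : ℕ} (h0 : t 0 = 0)
    (h : ∀ j, j < m → t j < t (j + 1)) (hm : 1 ≤ m) (V : ℕ → ℕ → ℝ) (w : ℕ → ℝ) (N : ℕ) :
    delta α t (fun i => ∑ k ∈ Finset.range N, w k * V k i) m
      = ∑ k ∈ Finset.range N, w k * delta α t (V k) m := by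
  induction N with
  | zero =>
    have := delta_linear hα1 h0 h hm (fun _ => 0) (fun _ => 0) 0 0
    simpa using this
  | succ N ih =>
    rw [Finset.sum_range_succ, ← ih, ← one_mul (delta α t (fun i => ∑ k ∈ Finset.range N, _) m),
      ← delta_linear hα1 h0 h hm]
    simp only [Finset.sum_range_succ, one_mul]

theorem Gamma_two_sub {α : ℝ} (hα1 : α < 1) :
    Real.Gamma (2 - α) = (1 - α) * Real.Gamma (1 - α) := by
  rw [show 2 - α = (1 - α) + 1 by ring, Real.Gamma_add_one (by linarith)]

theorem Gamma_inv_pos {α : ℝ} (hα1 : α < 1) : 0 < (Real.Gamma (1 - α))⁻¹ :=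
  inv_pos.2 (Real.Gamma_pos_of_pos (by linarith))

/-- This is the diagonal entry of δ. The curvature correction only increases it beyond the value
τ^{-α}/Γ(2-α) of linear interpolation, against which λ is measured. -/
theorem le_delta_single {α : ℝ} (hα : 0 ≤ α) (hα1 : α < 1) {t : ℕ → ℝ} {m : ℕ} (h0 : t 0 = 0)
    (h : ∀ j, j < m → t j < t (j + 1)) (hm : 1 ≤ m) :
    (Real.Gamma (2 - α))⁻¹ * tau t m ^ (-α) ≤ delta α t (fun i => if i = m then 1 else 0) m := by
  have hG := Gamma_inv_pos hα1
  rw [Gamma_two_sub hα1, mul_inv, mul_comm (1 - α)⁻¹, mul_assoc]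
  have h1α : 0 < 1 - α := by linarith
  obtain rfl | ⟨n, rfl⟩ : m = 1 ∨ ∃ n, m = n + 2 := by
    rcases Nat.lt_or_ge m 2 with h2 | h2
    · exact Or.inl (by omega)
    · exact Or.inr ⟨m - 2, by omega⟩
  · have h1 := h 0 one_pos
    rw [delta_one hα1 h0 h1]
    refine mul_le_mul_of_nonneg_left (le_of_eq ?_) hG.le
    rw [h0, zero_add] at h1
    unfold slope tau
    simp only [zero_add, if_true, zero_ne_one, if_false, h0, sub_zero, Nat.sub_self]
    rw [show (1 : ℝ) - α = -α + 1 by ring, Real.rpow_add_one h1.ne']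
    have : -α + 1 ≠ 0 := by linarith
    field_simp
  · rw [delta_add_two hα1 h0 h]
    refine mul_le_mul_of_nonneg_left ?_ hG.le
    have hle := le_lastWeight hα hα1 h rfl
    rw [inv_mul_le_iff₀ h1α]
    have hL : opL α t (fun i => if i = n + 2 then 1 else 0) n = lastWeight α t n := by
      rw [opL_eq_slopes hα1]
      have hs : ∀ i, i ≤ n → slope t (fun i => if i = n + 2 then 1 else 0) i = 0 := by
        intro i hi
        unfold slope
        simp only
        rw [if_neg (by omega), if_neg (by omega)]
        simp
      rw [Finset.sum_eq_zero fun i hi => by rw [hs i (Finset.mem_range.1 hi).le, zero_mul],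
        hs n le_rfl]
      unfold slope lastWeight
      simp only [if_true, if_neg (show n + 1 ≠ n + 2 by omega)]
      simp [div_eq_inv_mul]
    rw [hL]
    exact hle

/-- At a first positive value W^m, lowering that single value by λW^m/κ, with κ the diagonal entry,
cancels λW^m in the operator. Inverse-monotonicity then forces W^m ≤ λW^m/κ, which contradicts λ <
κ. -/
theorem comparison {α σ lam T : ℝ} {M : ℕ} {t : ℕ → ℝ} (hα : 0 < α) (hα1 : α < 1)
    (hσ : IsThreshold α σ) (hmesh : IsMesh T M t) (hA : MeshA2Star σ M t)
    (hstep : ∀ j, 1 ≤ j → j ≤ M → lam * tau t j ^ α < (Real.Gamma (2 - α))⁻¹)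
    (hlam : 0 ≤ lam) {W : ℕ → ℝ} (hW0 : W 0 ≤ 0)
    (hW : ∀ j, 1 ≤ j → j ≤ M → delta α t W j - lam * W j ≤ 0) : ∀ j, j ≤ M → W j ≤ 0 := by
  intro m
  induction m using Nat.strong_induction_on with
  | _ m ih =>
    intro hm
    rcases Nat.eq_zero_or_pos m with rfl | hpos
    · exact hW0
    by_contra hneg
    push Not at hneg
    have hinc : ∀ j, j < m → t j < t (j + 1) := fun j hj => hmesh.2.2 j (by omega)
    have htm : 0 < t m := by
      have := mesh_lt hinc hpos le_rfl
      rwa [hmesh.1] at this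
    have hτ : 0 < tau t m := by
      have := mesh_lt hinc (show m - 1 < m by omega) le_rfl
      unfold tau; linarith
    set e : ℕ → ℝ := fun i => if i = m then 1 else 0 with he
    have hκ := le_delta_single hα.le hα1 hmesh.1 hinc hpos
    set κ := delta α t e m with hκdef
    have hlk : lam < κ := by
      refine lt_of_lt_of_le ?_ hκ
      rw [Real.rpow_neg hτ.le, ← div_eq_mul_inv, lt_div_iff₀ (Real.rpow_pos_of_pos hτ _)]
      exact hstep m hpos hm
    have hκ0 : 0 < κ := hlam.trans_lt hlk
    set x := lam * W m / κ with hx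
    have hxW : x < W m := by
      rw [hx, div_lt_iff₀ hκ0]
      nlinarith
    have hxκ : x * κ = lam * W m := by rw [hx]; field_simp
    -- Admissibility is applied to the mesh cut off at level m, on which the step-ratio condition
    -- still holds. Below m the operator is nonpositive because λW ≤ 0 there.
    have hIM := hσ.2.2 (t m) m t htm ⟨hmesh.1, rfl, hinc⟩
      (fun j hj hjm => by
        obtain ⟨a, b, c⟩ := hA j hj (by omega)
        exact ⟨a, b, fun h => c (by omega)⟩)
      (fun i => 1 * W i + (-x) * e i)
      (by simp only [he]; rw [if_neg (by omega)]; linarith)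
      (by
        intro j hj hjm
        have hincj : ∀ i, i < j → t i < t (i + 1) := fun i hi => hinc i (by omega)
        rw [delta_linear hα1 hmesh.1 hincj hj]
        have h1 := hW j hj (by omega)
        rcases hjm.lt_or_eq with hlt | rfl
        · have h2 : delta α t e j = 0 := by
            rw [delta_congr (V := fun _ => (0 : ℝ) * 0 + 0 * 0) (fun i hi => by
              simp only [he]; rw [if_neg (by omega)]; ring) hincj]
            rw [delta_linear hα1 hmesh.1 hincj hj (fun _ => 0) (fun _ => 0) 0 0]
            ring
          have h3 := mul_nonpos_of_nonneg_of_nonpos hlam (ih j hlt (by omega))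
          rw [h2]
          linarith
        · rw [← hκdef]
          linarith)
      m le_rfl
    simp only [he, if_true] at hIM
    linarith

/-- A discrete supersolution `B` for the data `f` which is bounded by `g`. -/
def HasBarrier (α lam : ℝ) (M : ℕ) (t f g : ℕ → ℝ) : Prop :=
  ∃ B : ℕ → ℝ, 0 ≤ B 0 ∧ ∀ j, 1 ≤ j → j ≤ M →
    f j + lam * B j ≤ delta α t B j ∧ 0 ≤ B j ∧ B j ≤ g j

/-! ### Operations on supersolutions. -/

namespace HasBarrier

variable {α lam : ℝ} {M : ℕ} {t f g : ℕ → ℝ}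

theorem mono {f' g' : ℕ → ℝ} (h : HasBarrier α lam M t f g)
    (hf : ∀ j, 1 ≤ j → j ≤ M → f' j ≤ f j) (hg : ∀ j, 1 ≤ j → j ≤ M → g j ≤ g' j) :
    HasBarrier α lam M t f' g' := by
  obtain ⟨B, h0, hB⟩ := h
  refine ⟨B, h0, fun j h1 h2 => ?_⟩
  obtain ⟨a, b, c⟩ := hB j h1 h2
  exact ⟨by linarith [hf j h1 h2], b, c.trans (hg j h1 h2)⟩

theorem smul (hα1 : α < 1) {T : ℝ} (hmesh : IsMesh T M t) (h : HasBarrier α lam M t f g) {c : ℝ}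
    (hc : 0 ≤ c) : HasBarrier α lam M t (fun j => c * f j) (fun j => c * g j) := by
  obtain ⟨B, h0, hB⟩ := h
  refine ⟨fun i => c * B i + 0 * B i, by simp only; nlinarith, fun j h1 h2 => ?_⟩
  obtain ⟨a, b, d⟩ := hB j h1 h2
  rw [delta_linear hα1 hmesh.1 (fun i hi => hmesh.2.2 i (by omega)) h1]
  simp only [zero_mul, add_zero]
  refine ⟨?_, mul_nonneg hc b, mul_le_mul_of_nonneg_left d hc⟩
  have := mul_le_mul_of_nonneg_left a hc
  linarith

/-- A supersolution for `δ - λ` from one for `δ` and one for `δ - λ` which absorbs the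
zeroth-order term of the first. -/
theorem absorb (hα1 : α < 1) {T : ℝ} (hmesh : IsMesh T M t) (hlam : 0 ≤ lam) {g₂ : ℕ → ℝ}
    (h : HasBarrier α 0 M t f g) (h₂ : HasBarrier α lam M t (fun j => lam * g j) g₂) :
    HasBarrier α lam M t f (fun j => g j + g₂ j) := by
  obtain ⟨B, h0, hB⟩ := h
  obtain ⟨V, v0, hV⟩ := h₂
  refine ⟨fun i => 1 * B i + 1 * V i, by simp only; linarith, fun j h1 h2 => ?_⟩
  obtain ⟨a, b, d⟩ := hB j h1 h2
  obtain ⟨a', b', d'⟩ := hV j h1 h2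
  rw [delta_linear hα1 hmesh.1 (fun i hi => hmesh.2.2 i (by omega)) h1]
  simp only [one_mul]
  have := mul_le_mul_of_nonneg_left d hlam
  exact ⟨by linarith, by linarith, by linarith⟩

theorem le {σ T C₀ : ℝ} (hα : 0 < α) (hα1 : α < 1)
    (hσ : IsThreshold α σ) (hmesh : IsMesh T M t) (hA : MeshA2Star σ M t)
    (hstep : ∀ j, 1 ≤ j → j ≤ M → lam * tau t j ^ α < (Real.Gamma (2 - α))⁻¹)
    (hlam : 0 ≤ lam) (h : HasBarrier α lam M t f g) (hf : ∀ j, 1 ≤ j → j ≤ M → 0 ≤ f j)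
    {U : ℕ → ℝ} (hU0 : U 0 = 0)
    (hU : ∀ j, 1 ≤ j → j ≤ M → delta α t U j - lam * U j ≤ C₀ * f j) :
    ∀ j, 1 ≤ j → j ≤ M → U j ≤ |C₀| * g j := by
  obtain ⟨B, h0, hB⟩ := h
  intro j h1 h2
  have := comparison hα hα1 hσ hmesh hA hstep hlam
    (W := fun i => 1 * U i + (-|C₀|) * B i)
    (by linarith [mul_nonneg (abs_nonneg C₀) h0])
    (fun i hi hiM => by
      rw [delta_linear hα1 hmesh.1 (fun k hk => hmesh.2.2 k (by omega)) hi]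
      obtain ⟨a, b, d⟩ := hB i hi hiM
      have e1 := hU i hi hiM
      have e2 := mul_le_mul_of_nonneg_left a (abs_nonneg C₀)
      have e3 := mul_le_mul_of_nonneg_right (le_abs_self C₀) (hf i hi hiM)
      linarith) j h2
  have e := mul_le_mul_of_nonneg_left (hB j h1 h2).2.2 (abs_nonneg C₀)
  linarith

end HasBarrier

/-! ### Step sizes of quasi-graded meshes -/

section steps

variable {α γ r c T : ℝ} {M : ℕ} {t : ℕ → ℝ}

theorem mesh_pos (hmesh : IsMesh T M t) {j : ℕ} (h1 : 1 ≤ j) (h2 : j ≤ M) : 0 < t j := by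
  have := mesh_lt hmesh.2.2 h1 h2
  rwa [hmesh.1] at this

theorem mesh_nonneg (hmesh : IsMesh T M t) {j : ℕ} (h2 : j ≤ M) : 0 ≤ t j := by
  have := mesh_le hmesh.2.2 (Nat.zero_le j) h2
  rwa [hmesh.1] at this

theorem mesh_le_end (hmesh : IsMesh T M t) {j : ℕ} (h2 : j ≤ M) : t j ≤ T := by
  have := mesh_le hmesh.2.2 h2 le_rfl
  rwa [hmesh.2.1] at this

theorem tau_one (hmesh : IsMesh T M t) : tau t 1 = t 1 := by
  simp [tau, hmesh.1]

theorem tau_one_pos (hmesh : IsMesh T M t) (hM : 1 ≤ M) : 0 < tau t 1 := by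
  rw [tau_one hmesh]; exact mesh_pos hmesh le_rfl hM

theorem tau_one_le (hmesh : IsMesh T M t) {j : ℕ} (h1 : 1 ≤ j) (h2 : j ≤ M) : tau t 1 ≤ t j := by
  rw [tau_one hmesh]; exact mesh_le hmesh.2.2 h1 h2

theorem const_pos (hmesh : IsMesh T M t) (hA : MeshA3 α γ r c M t) (hM : 1 ≤ M) : 0 < c := by
  have h := hA.2.2.1.1
  have h1 := tau_one_pos hmesh hM
  have h2 : (0 : ℝ) < (M : ℝ) ^ (-r) := Real.rpow_pos_of_pos (by exact_mod_cast hM) _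
  exact pos_of_mul_pos_left (h1.trans_le h) h2.le

/-- By τ_j ≤ c·t_j/j ≤ c²τ_1 j^{r-1}, τ_1 ≤ c·M^{-r} and j ≤ M. It makes all steps small against a
fixed length once M is large. -/
theorem tau_le_div (hmesh : IsMesh T M t) (hA : MeshA3 α γ r c M t) {j : ℕ} (h1 : 1 ≤ j)
    (h2 : j ≤ M) : tau t j ≤ c ^ 3 / M := by
  have hM : 1 ≤ M := h1.trans h2
  have hc := const_pos hmesh hA hM
  have hMr : (0 : ℝ) < M := by exact_mod_cast hM
  have hjr : (0 : ℝ) < j := by exact_mod_cast h1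
  have e1 := (hA.2.2.2 j h1 h2).1.1
  have e2 := (hA.2.2.2 j h1 h2).2.1
  have e3 := hA.2.2.1.1
  have hr := hA.1
  have p1 : (j : ℝ) ^ r = (j : ℝ) ^ (r - 1) * j := by
    rw [← Real.rpow_add_one hjr.ne']; ring_nf
  have p2 : (j : ℝ) ^ (r - 1) ≤ (M : ℝ) ^ (r - 1) :=
    Real.rpow_le_rpow hjr.le (by exact_mod_cast h2) (by linarith)
  have p3 : (M : ℝ) ^ (-r) * (M : ℝ) ^ (r - 1) = 1 / M := by
    rw [← Real.rpow_add hMr, show -r + (r - 1) = -1 by ring, Real.rpow_neg_one, one_div]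
  have q1 : t j / j ≤ c * tau t 1 * (j : ℝ) ^ (r - 1) := by
    rw [div_le_iff₀ hjr]
    calc t j ≤ _ := e2
      _ = _ := by rw [p1]; ring
  have hj0 : 0 ≤ (j : ℝ) ^ (r - 1) := Real.rpow_nonneg hjr.le _
  calc tau t j ≤ c * (t j / j) := e1
    _ ≤ c * (c * tau t 1 * (j : ℝ) ^ (r - 1)) := mul_le_mul_of_nonneg_left q1 hc.le
    _ ≤ c * (c * (c * (M : ℝ) ^ (-r)) * (M : ℝ) ^ (r - 1)) := by
        refine mul_le_mul_of_nonneg_left ?_ hc.le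
        refine mul_le_mul (mul_le_mul_of_nonneg_left e3 hc.le) p2 hj0 ?_
        have : (0 : ℝ) ≤ (M : ℝ) ^ (-r) := Real.rpow_nonneg hMr.le _
        positivity
    _ = c ^ 3 * ((M : ℝ) ^ (-r) * (M : ℝ) ^ (r - 1)) := by ring
    _ = c ^ 3 / M := by rw [p3]; ring

/-- On a graded mesh j is at least of order (t_j/τ_1)^{1/r}, so τ_j is at most of order
t_j(τ_1/t_j)^{1/r}. Replacing τ_1 by a larger scale a makes the constant as small as desired; this
smallness controls all discretisation errors below. -/
theorem exists_step_le (r c : ℝ) {θ : ℝ} (hθ : 0 < θ) : ∃ κ : ℝ, 1 ≤ κ ∧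
    ∀ (α γ T : ℝ) (M : ℕ) (t : ℕ → ℝ), IsMesh T M t → MeshA3 α γ r c M t →
      ∀ j a, 1 ≤ j → j ≤ M → κ * tau t 1 ≤ a →
        tau t j ≤ θ * (t j + a) * (a / (t j + a)) ^ (1 / r) := by
  refine ⟨max 1 (c * (c / θ) ^ r), le_max_left _ _, ?_⟩
  intro α γ T M t hmesh hA j a h1 h2 ha
  have hM : 1 ≤ M := h1.trans h2
  have hc := const_pos hmesh hA hM
  have hr : 0 < r := by linarith [hA.1]
  have hτ1 := tau_one_pos hmesh hM
  have htj := mesh_pos hmesh h1 h2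
  have hjr : (0 : ℝ) < j := by exact_mod_cast h1
  have ha0 : 0 < a := lt_of_lt_of_le (mul_pos (by positivity) hτ1) ha
  have e1 := (hA.2.2.2 j h1 h2).1.1
  have e2 := (hA.2.2.2 j h1 h2).2.1
  have hcθ : 0 < c / θ := by positivity
  have hca : c * tau t 1 ≤ a / (c / θ) ^ r := by
    rw [le_div_iff₀ (Real.rpow_pos_of_pos hcθ _)]
    have := mul_le_mul_of_nonneg_right (le_max_right 1 (c * (c / θ) ^ r)) hτ1.le
    linarith
  -- the index is bounded below by a power of `t_j / a`
  have hj : t j / a ≤ (j * (θ / c)) ^ r := by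
    rw [Real.mul_rpow hjr.le (by positivity), show θ / c = (c / θ)⁻¹ by rw [inv_div],
      Real.inv_rpow hcθ.le, div_le_iff₀ ha0]
    calc t j ≤ c * tau t 1 * (j : ℝ) ^ r := by linarith
      _ ≤ a / (c / θ) ^ r * (j : ℝ) ^ r :=
        mul_le_mul_of_nonneg_right hca (Real.rpow_nonneg hjr.le _)
      _ = _ := by ring
  have hj' : (t j / a) ^ (1 / r) ≤ j * (θ / c) := by
    have := Real.rpow_le_rpow (by positivity) hj (show 0 ≤ 1 / r by positivity)
    rwa [← Real.rpow_mul (by positivity), mul_one_div_cancel hr.ne', Real.rpow_one] at this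
  have hpos : 0 < (t j / a) ^ (1 / r) := Real.rpow_pos_of_pos (by positivity) _
  have e3 : tau t j ≤ θ * (t j * (a / t j) ^ (1 / r)) := by
    rw [show a / t j = (t j / a)⁻¹ by rw [inv_div], Real.inv_rpow (by positivity)]
    calc tau t j ≤ c * (t j / j) := e1
      _ ≤ θ * (t j * ((t j / a) ^ (1 / r))⁻¹) := by
        rw [← mul_div_assoc, ← div_eq_mul_inv, ← mul_div_assoc, div_le_div_iff₀ hjr hpos]
        have := mul_le_mul_of_nonneg_left hj' (show 0 ≤ c * t j by positivity)
        calc c * t j * (t j / a) ^ (1 / r) ≤ _ := this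
          _ = _ := by field_simp
  refine e3.trans ?_
  rw [mul_assoc]
  refine mul_le_mul_of_nonneg_left ?_ hθ.le
  rw [Real.div_rpow ha0.le htj.le, Real.div_rpow ha0.le (by positivity)]
  have hq : 0 ≤ 1 - 1 / r := by
    have : 1 / r ≤ 1 := by rw [div_le_one hr]; exact hA.1
    linarith
  have f1 : ∀ x : ℝ, 0 < x → x * (a ^ (1 / r) / x ^ (1 / r)) = a ^ (1 / r) * x ^ (1 - 1 / r) := by
    intro x hx
    rw [Real.rpow_sub hx, Real.rpow_one]; ring
  rw [f1 _ htj, f1 _ (by positivity)]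
  exact mul_le_mul_of_nonneg_left (Real.rpow_le_rpow htj.le (by linarith) hq)
    (Real.rpow_nonneg ha0.le _)

end steps

end

end L2Subdiffusion

namespace L2Subdiffusion

noncomputable section

open MeasureTheory intervalIntegral

/-! ### Increasing barriers -/

theorem exists_slope_eq {W g : ℝ → ℝ} (hW : ∀ s, 0 ≤ s → HasDerivAt W (g s) s) {t : ℕ → ℝ} {i : ℕ}
    (h0 : 0 ≤ t i) (h1 : t i < t (i + 1)) :
    ∃ ξ ∈ Set.Ioo (t i) (t (i + 1)), slope t (fun j => W (t j)) i = g ξ := by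
  obtain ⟨ξ, hξ, he⟩ := exists_hasDerivAt_eq_slope W g h1
    (fun y hy => (hW y (h0.trans hy.1)).continuousAt.continuousWithinAt)
    (fun y hy => hW y (h0.trans hy.1.le))
  exact ⟨ξ, hξ, he.symm⟩

/-- The slopes are values of g by the mean value theorem, and the linear factor is at most the
stencil length, so the curvature term is at most a quarter of the slope. Thus (1 - 1/4)·(4/5) ≥ 1/2
of g survives. -/
theorem half_le_gradInterp {W g : ℝ → ℝ} (hW : ∀ s, 0 ≤ s → HasDerivAt W (g s) s)
    (hpos : ∀ s, 0 ≤ s → 0 < g s) {t : ℕ → ℝ} {n i : ℕ} (hm : ∀ j, j < n + 2 → t j < t (j + 1))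
    (h0 : t 0 = 0) (hi : i ≤ n + 1)
    (hslow : ∀ k, k ≤ n → ∀ ξ η, ξ ∈ Set.Icc (t k) (t (k + 2)) → η ∈ Set.Icc (t k) (t (k + 2)) →
      g ξ ≤ 5 / 4 * g η) {s : ℝ} (hs : s ∈ Set.Icc (t i) (t (i + 1))) :
    1 / 2 * g s ≤ gradInterp t (fun j => W (t j)) n i s := by
  obtain ⟨k, hk, hmin, hik⟩ : ∃ k, k ≤ n ∧ min i n = k ∧ (i = k ∨ i = k + 1) :=
    ⟨min i n, min_le_right _ _, rfl, by omega⟩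
  have e0 : 0 ≤ t k := by rw [← h0]; exact mesh_le hm (Nat.zero_le k) (by omega)
  have e1 := hm k (by omega)
  have e2 : t (k + 1) < t (k + 2) := hm (k + 1) (by omega)
  obtain ⟨ξ₁, hξ₁, s₁⟩ := exists_slope_eq hW e0 e1
  obtain ⟨ξ₂, hξ₂, s₂⟩ := exists_slope_eq hW (t := t) (i := k + 1) (by linarith) e2
  rw [show k + 1 + 1 = k + 2 from rfl] at hξ₂
  have m1 : ξ₁ ∈ Set.Icc (t k) (t (k + 2)) := ⟨hξ₁.1.le, by linarith [hξ₁.2]⟩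
  have m2 : ξ₂ ∈ Set.Icc (t k) (t (k + 2)) := ⟨by linarith [hξ₂.1], hξ₂.2.le⟩
  have ms : s ∈ Set.Icc (t k) (t (k + 2)) := by
    rcases hik with rfl | rfl
    · exact ⟨hs.1, by linarith [hs.2]⟩
    · exact ⟨by linarith [hs.1], hs.2⟩
  have a12 := hslow k hk _ _ m1 m2
  have a21 := hslow k hk _ _ m2 m1
  have as1 := hslow k hk _ _ ms m1
  have as2 := hslow k hk _ _ ms m2
  have p1 := hpos ξ₁ (by linarith [m1.1])
  have p2 := hpos ξ₂ (by linarith [m2.1])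
  unfold gradInterp
  rw [hmin]
  unfold curv
  rw [s₁, s₂, div_mul_eq_mul_div (g ξ₂ - g ξ₁)]
  have hden : 0 < t (k + 2) - t k := by linarith
  have habs : |2 * s - t i - t (i + 1)| ≤ t (k + 2) - t k := by
    rw [abs_le]
    rcases hik with rfl | rfl
    · exact ⟨by linarith [hs.1], by linarith [hs.2]⟩
    · rw [show k + 1 + 1 = k + 2 from rfl] at *
      exact ⟨by linarith [hs.1], by linarith [hs.2]⟩
  have hfrac : -|g ξ₂ - g ξ₁| ≤ (g ξ₂ - g ξ₁) * (2 * s - t i - t (i + 1)) / (t (k + 2) - t k) := by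
    rw [le_div_iff₀ hden]
    have h1 := neg_abs_le ((g ξ₂ - g ξ₁) * (2 * s - t i - t (i + 1)))
    rw [abs_mul] at h1
    have := mul_le_mul_of_nonneg_left habs (abs_nonneg (g ξ₂ - g ξ₁))
    linarith
  have hd1 : |g ξ₂ - g ξ₁| ≤ 1 / 4 * g ξ₁ := by
    rw [abs_le]; constructor <;> linarith
  have hd2 : |g ξ₂ - g ξ₁| ≤ 1 / 4 * g ξ₂ := by
    rw [abs_le]; constructor <;> linarith
  rcases hik with rfl | rfl
  · rw [s₁]; linarith
  · rw [s₂]; linarith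

theorem half_integral_le_delta {α : ℝ} (hα1 : α < 1) {W g : ℝ → ℝ}
    (hW : ∀ s, 0 ≤ s → HasDerivAt W (g s) s) (hpos : ∀ s, 0 ≤ s → 0 < g s)
    (hg : ContinuousOn g (Set.Ici 0)) {T : ℝ} {t : ℕ → ℝ} {M m : ℕ} (hmesh : IsMesh T M t)
    (hM : 2 ≤ M) (h1 : 1 ≤ m) (h2 : m ≤ M)
    (hslow : ∀ k, k + 2 ≤ M → ∀ ξ η, ξ ∈ Set.Icc (t k) (t (k + 2)) →
      η ∈ Set.Icc (t k) (t (k + 2)) → g ξ ≤ 5 / 4 * g η) :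
    1 / 2 * ∫ s in (0 : ℝ)..t m, ker α (t m) s * g s
      ≤ Real.Gamma (1 - α) * delta α t (fun j => W (t j)) m := by
  have hG : 0 < Real.Gamma (1 - α) := Real.Gamma_pos_of_pos (by linarith)
  have hm : ∀ j, j < m → t j < t (j + 1) := fun j hj => hmesh.2.2 j (by omega)
  have hgi : ∀ i, i < m → IntervalIntegrable (fun s => ker α (t m) s * g s) volume
      (t i) (t (i + 1)) := by
    intro i hi
    refine ker_mul_intervalIntegrable hα1 _ _ _ (hg.mono ?_)
    rw [Set.uIcc_of_le (hm i hi).le]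
    intro s hs
    have := mesh_nonneg hmesh (show i ≤ M by omega)
    exact this.trans hs.1
  obtain rfl | ⟨n, rfl⟩ : m = 1 ∨ ∃ n, m = n + 2 := by
    rcases Nat.lt_or_ge m 2 with h2 | h2
    · exact Or.inl (by omega)
    · exact Or.inr ⟨m - 2, by omega⟩
  · have h01 := hm 0 one_pos
    have h12 : t 1 < t 2 := hmesh.2.2 1 (by omega)
    rw [delta_one hα1 hmesh.1 h01, mul_inv_cancel_left₀ hG.ne']
    obtain ⟨ξ, hξ, hs⟩ := exists_slope_eq hW (t := t) (i := 0) (by rw [hmesh.1]) h01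
    rw [hs]
    have hc : ∫ s in (0 : ℝ)..t 1, ker α (t 1) s * (5 / 4 * g ξ)
        = 5 / 4 * g ξ * (t 1 ^ (1 - α) / (1 - α)) := by
      rw [intervalIntegral.integral_mul_const, integral_ker hα1, sub_self, sub_zero,
        Real.zero_rpow (by linarith), sub_zero, mul_comm]
    have h0 := hmesh.1
    have hi0 := hgi 0 one_pos
    rw [h0] at hi0 h01 hξ
    have hmono := integral_mono_on h01.le hi0
      ((ker_intervalIntegrable hα1 (t 1) 0 (t 1)).mul_const (5 / 4 * g ξ)) (fun s hs => by
        refine mul_le_mul_of_nonneg_left ?_ (ker_nonneg α hs.2)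
        refine hslow 0 (by omega) _ _ ?_ ?_
        · rw [h0]; exact ⟨hs.1, hs.2.trans h12.le⟩
        · rw [h0]; exact ⟨hξ.1.le, hξ.2.le.trans h12.le⟩)
    simp only [zero_add] at hmono hi0 h01
    rw [hc] at hmono
    have hp : 0 < g ξ := hpos ξ hξ.1.le
    have ht : 0 ≤ t 1 ^ (1 - α) / (1 - α) :=
      div_nonneg (Real.rpow_nonneg h01.le _) (by linarith)
    nlinarith [mul_nonneg hp.le ht]
  · rw [delta_add_two hα1 hmesh.1 hm, mul_inv_cancel_left₀ hG.ne']
    have hadj := sum_integral_adjacent_intervals hgi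
    rw [hmesh.1] at hadj
    rw [← hadj, Finset.mul_sum]
    unfold opL
    refine Finset.sum_le_sum fun i hi => ?_
    have hi' := Finset.mem_range.1 hi
    rw [← intervalIntegral.integral_const_mul]
    refine integral_mono_on (hm i hi').le ((hgi i hi').const_mul _)
      (ker_mul_intervalIntegrable hα1 _ _ _ (continuous_gradInterp t _ n i).continuousOn)
      fun s hs => ?_
    have hk : 0 ≤ ker α (t (n + 2)) s :=
      ker_nonneg α (hs.2.trans (mesh_le hm (show i + 1 ≤ n + 2 by omega) le_rfl))
    have := half_le_gradInterp hW hpos hm hmesh.1 (show i ≤ n + 1 by omega)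
      (fun k hk => hslow k (by omega)) hs
    have := mul_le_mul_of_nonneg_left this hk
    linarith

/-! ### The increasing profile and its fractional derivative. -/

/-- The function `(s+a)^β e^{Ks} - a^{β+1}/(s+a)`. -/
def incFun (a β K s : ℝ) : ℝ := (s + a) ^ β * Real.exp (K * s) - a ^ (β + 1) * (s + a) ^ (-1 : ℝ)

/-- The derivative of `incFun`. -/
def incGrad (a β K s : ℝ) : ℝ :=
  (β * (s + a) ^ (β - 1) + K * (s + a) ^ β) * Real.exp (K * s) + a ^ (β + 1) * (s + a) ^ (-2 : ℝ)

theorem hasDerivAt_shift_rpow {a s : ℝ} (p : ℝ) (h : 0 < s + a) :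
    HasDerivAt (fun s : ℝ => (s + a) ^ p) (p * (s + a) ^ (p - 1)) s := by
  have h1 : HasDerivAt (fun s : ℝ => s + a) 1 s := (hasDerivAt_id s).add_const a
  exact (h1.rpow_const (p := p) (Or.inl h.ne')).congr_deriv (by ring)

theorem hasDerivAt_incFun {a s : ℝ} (β K : ℝ) (h : 0 < s + a) :
    HasDerivAt (incFun a β K) (incGrad a β K s) s := by
  have h1 := hasDerivAt_shift_rpow β h
  have h2 := hasDerivAt_shift_rpow (-1) h
  have h3 : HasDerivAt (fun s : ℝ => Real.exp (K * s)) (Real.exp (K * s) * K) s := by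
    have := ((hasDerivAt_id s).const_mul K).exp
    simpa using this
  refine ((h1.mul h3).sub (h2.const_mul (a ^ (β + 1)))).congr_deriv ?_
  unfold incGrad
  rw [show (-1 : ℝ) - 1 = -2 by norm_num]
  ring

theorem continuousOn_incGrad {a : ℝ} (β K : ℝ) (ha : 0 < a) :
    ContinuousOn (incGrad a β K) (Set.Ici 0) := by
  have h : ∀ p : ℝ, ContinuousOn (fun s : ℝ => (s + a) ^ p) (Set.Ici 0) := fun p =>
    ContinuousOn.rpow_const (by fun_prop) fun s hs =>
      Or.inl (by have : (0 : ℝ) ≤ s := hs; positivity)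
  unfold incGrad
  exact (((continuousOn_const.mul (h _)).add (continuousOn_const.mul (h _))).mul
    (by fun_prop)).add (continuousOn_const.mul (h _))

theorem incGrad_pos {a β K s : ℝ} (ha : 0 < a) (hβ : 0 ≤ β) (hK : 0 < K) (hs : 0 ≤ s) :
    0 < incGrad a β K s := by
  unfold incGrad
  have : 0 < s + a := by linarith
  positivity

theorem le_incGrad {a β K s : ℝ} (ha : 0 < a) (hβ : 0 ≤ β) (hs : 0 ≤ s) :
    K * ((s + a) ^ β * Real.exp (K * s)) ≤ incGrad a β K s := by
  unfold incGrad
  have h0 : 0 < s + a := by linarith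
  have h1 : 0 ≤ β * (s + a) ^ (β - 1) * Real.exp (K * s) := by positivity
  have h2 : 0 ≤ a ^ (β + 1) * (s + a) ^ (-2 : ℝ) := by positivity
  linarith

theorem incFun_zero {a β K : ℝ} (ha : 0 < a) : incFun a β K 0 = 0 := by
  unfold incFun
  rw [zero_add, mul_zero, Real.exp_zero, ← Real.rpow_add ha]
  simp

theorem incFun_le {a β K s : ℝ} (ha : 0 < a) (hs : 0 ≤ s) :
    incFun a β K s ≤ (s + a) ^ β * Real.exp (K * s) := by
  unfold incFun
  have h0 : 0 < s + a := by linarith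
  have : 0 ≤ a ^ (β + 1) * (s + a) ^ (-1 : ℝ) := by positivity
  linarith

/-- Subtracting a^{β+1}/(s+a), rather than the constant a^β, also gives value zero at s = 0, but
lets the profile reach the size s^β already for s comparable to a; for β = 0 this is essential. -/
theorem le_incFun {a β K s : ℝ} (ha : 0 < a) (hβ : 0 ≤ β) (hK : 0 ≤ K) (hs : 0 < s) :
    s ^ β * (s / (s + a)) ≤ incFun a β K s := by
  unfold incFun
  have h0 : 0 < s + a := by linarith
  have h1 : (1 : ℝ) ≤ Real.exp (K * s) := Real.one_le_exp (by positivity)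
  have h2 : a ^ β ≤ (s + a) ^ β := Real.rpow_le_rpow ha.le (by linarith) hβ
  have h3 : s ^ β ≤ (s + a) ^ β := Real.rpow_le_rpow hs.le (by linarith) hβ
  have h4 : 0 < (s + a) ^ β := Real.rpow_pos_of_pos h0 _
  rw [Real.rpow_neg_one, Real.rpow_add_one ha.ne']
  have e1 : (s + a) ^ β ≤ (s + a) ^ β * Real.exp (K * s) := le_mul_of_one_le_right h4.le h1
  have e2 : a ^ β * a * (s + a)⁻¹ ≤ (s + a) ^ β * (a / (s + a)) := by
    rw [mul_assoc, ← div_eq_mul_inv]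
    exact mul_le_mul_of_nonneg_right h2 (by positivity)
  have e3 : s ^ β * (s / (s + a)) ≤ (s + a) ^ β * (s / (s + a)) :=
    mul_le_mul_of_nonneg_right h3 (by positivity)
  have e4 : (s + a) ^ β * (s / (s + a)) + (s + a) ^ β * (a / (s + a)) = (s + a) ^ β := by
    field_simp
  linarith

theorem rpow_le_rpow_mul {x y q p N : ℝ} (hx : 0 < x) (hy : 0 < y) (hq : 1 ≤ q) (hxy : x ≤ q * y)
    (hyx : y ≤ q * x) (hp : |p| ≤ N) : x ^ p ≤ q ^ N * y ^ p := by
  have hq0 : 0 < q := by linarith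
  rcases le_total 0 p with h | h
  · calc x ^ p ≤ (q * y) ^ p := Real.rpow_le_rpow hx.le hxy h
      _ = q ^ p * y ^ p := Real.mul_rpow hq0.le hy.le
      _ ≤ _ := mul_le_mul_of_nonneg_right
        (Real.rpow_le_rpow_of_exponent_le hq ((le_abs_self p).trans hp)) (Real.rpow_nonneg hy.le _)
  · have h1 : (q * x) ^ p ≤ y ^ p := Real.rpow_le_rpow_of_nonpos hy hyx h
    rw [Real.mul_rpow hq0.le hx.le] at h1
    calc x ^ p = q ^ (-p) * (q ^ p * x ^ p) := by
          rw [← mul_assoc, ← Real.rpow_add hq0]; simp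
      _ ≤ q ^ (-p) * y ^ p := mul_le_mul_of_nonneg_left h1 (Real.rpow_nonneg hq0.le _)
      _ ≤ _ := mul_le_mul_of_nonneg_right
        (Real.rpow_le_rpow_of_exponent_le hq ((neg_le_abs p).trans hp)) (Real.rpow_nonneg hy.le _)

theorem incGrad_slow {a β K q ξ η : ℝ} (ha : 0 < a) (hβ : 0 ≤ β) (hK : 0 ≤ K) (hq : 1 ≤ q)
    (hξ : 0 ≤ ξ) (hη : 0 ≤ η) (h1 : ξ + a ≤ q * (η + a)) (h2 : η + a ≤ q * (ξ + a))
    (h3 : Real.exp (K * ξ) ≤ q * Real.exp (K * η)) :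
    incGrad a β K ξ ≤ q ^ (β + 3) * incGrad a β K η := by
  have x0 : 0 < ξ + a := by linarith
  have y0 : 0 < η + a := by linarith
  have hq0 : 0 < q := by linarith
  have a1 := rpow_le_rpow_mul x0 y0 hq h1 h2 (p := β - 1) (N := β + 2)
    (by rw [abs_le]; constructor <;> linarith)
  have a2 := rpow_le_rpow_mul x0 y0 hq h1 h2 (p := β) (N := β + 2)
    (by rw [abs_le]; constructor <;> linarith)
  have a3 := rpow_le_rpow_mul x0 y0 hq h1 h2 (p := -2) (N := β + 3)
    (by rw [abs_le]; constructor <;> linarith)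
  have e : q ^ (β + 3) = q ^ (β + 2) * q := by
    rw [← Real.rpow_add_one hq0.ne']; congr 1; ring
  unfold incGrad
  have b1 : β * (ξ + a) ^ (β - 1) + K * (ξ + a) ^ β
      ≤ q ^ (β + 2) * (β * (η + a) ^ (β - 1) + K * (η + a) ^ β) := by
    have := mul_le_mul_of_nonneg_left a1 hβ
    have := mul_le_mul_of_nonneg_left a2 hK
    linarith
  have b2 := mul_le_mul b1 h3 (Real.exp_pos _).le (by positivity)
  have b3 := mul_le_mul_of_nonneg_left a3 (show 0 ≤ a ^ (β + 1) by positivity)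
  calc _ ≤ q ^ (β + 2) * (β * (η + a) ^ (β - 1) + K * (η + a) ^ β) * (q * Real.exp (K * η))
        + a ^ (β + 1) * (q ^ (β + 3) * (η + a) ^ (-2 : ℝ)) := add_le_add b2 b3
    _ = _ := by rw [e]; ring

/-- The kernel is bounded below by its value x^{-α} at s = 0; useful for small x. -/
theorem le_integral_incGrad {α a β K x : ℝ} (hα : 0 ≤ α) (hα1 : α < 1) (ha : 0 < a) (hβ : 0 ≤ β)
    (hK : 0 < K) (hx : 0 < x) :
    x ^ (-α) * incFun a β K x ≤ ∫ s in (0 : ℝ)..x, ker α x s * incGrad a β K s := by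
  have hc : ContinuousOn (incGrad a β K) (Set.uIcc 0 x) := by
    rw [Set.uIcc_of_le hx.le]
    exact (continuousOn_incGrad β K ha).mono fun s hs => hs.1
  have h1 : ∫ s in (0 : ℝ)..x, incGrad a β K s = incFun a β K x := by
    rw [integral_eq_sub_of_hasDerivAt (f := incFun a β K) (fun s hs => ?_) hc.intervalIntegrable,
      incFun_zero ha, sub_zero]
    rw [Set.uIcc_of_le hx.le] at hs
    exact hasDerivAt_incFun β K (by linarith [hs.1])
  rw [← h1, ← intervalIntegral.integral_const_mul]
  refine integral_mono_on_of_le_Ioo hx.le (hc.intervalIntegrable.const_mul _)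
    (ker_mul_intervalIntegrable hα1 _ _ _ hc) fun s hs => ?_
  refine mul_le_mul_of_nonneg_right ?_ (incGrad_pos ha hβ hK hs.1.le).le
  have := ker_mono hα hs.1.le hs.2
  simpa [ker] using this

/-- Only the final stretch of length 1/K is kept, where the exponential and the power lose bounded
factors. The kernel mass there is K^{α-1}/(1-α), and the factor K from the exponential turns it into
K^α. -/
theorem le_integral_incGrad_of_large {α a β K x : ℝ} (hα1 : α < 1) (ha : 0 < a)
    (hβ : 0 ≤ β) (hK : 0 < K) (hx : 2 ≤ K * x) :
    2 ^ (-β) * Real.exp (-1) / (1 - α) * K ^ α * incFun a β K x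
      ≤ ∫ s in (0 : ℝ)..x, ker α x s * incGrad a β K s := by
  have hx0 : 0 < x := pos_of_mul_pos_right (by linarith) hK.le
  have hKi : 0 < 1 / K := by positivity
  have hKx : 2 * (1 / K) ≤ x := by
    rw [mul_one_div, div_le_iff₀ hK]; linarith
  set y := x - 1 / K with hy
  have hy0 : 0 ≤ y := by linarith
  have hc : ∀ u v : ℝ, 0 ≤ u → u ≤ v → ContinuousOn (incGrad a β K) (Set.uIcc u v) := by
    intro u v hu huv
    rw [Set.uIcc_of_le huv]
    exact (continuousOn_incGrad β K ha).mono fun s hs => hu.trans hs.1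
  have i1 := ker_mul_intervalIntegrable hα1 x 0 y (hc 0 y le_rfl hy0)
  have i2 := ker_mul_intervalIntegrable hα1 x y x (hc y x hy0 (by linarith))
  rw [← intervalIntegral.integral_add_adjacent_intervals i1 i2]
  have n1 : 0 ≤ ∫ s in (0 : ℝ)..y, ker α x s * incGrad a β K s :=
    intervalIntegral.integral_nonneg hy0 fun s hs =>
      mul_nonneg (ker_nonneg α (by linarith [hs.2])) (incGrad_pos ha hβ hK hs.1).le
  set Q := K * (2 ^ (-β) * (x + a) ^ β * (Real.exp (-1) * Real.exp (K * x))) with hQ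
  have n2 : ∫ s in y..x, ker α x s * Q ≤ ∫ s in y..x, ker α x s * incGrad a β K s := by
    refine integral_mono_on (by linarith) ((ker_intervalIntegrable hα1 x y x).mul_const _) i2
      fun s hs => mul_le_mul_of_nonneg_left ?_ (ker_nonneg α hs.2)
    have hs0 : 0 ≤ s := hy0.trans hs.1
    refine le_trans ?_ (le_incGrad ha hβ hs0)
    refine mul_le_mul_of_nonneg_left ?_ hK.le
    refine mul_le_mul ?_ ?_ (by positivity) (by positivity)
    · rw [Real.rpow_neg (by norm_num), ← div_eq_inv_mul, ← Real.div_rpow (by linarith) (by norm_num)]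
      exact Real.rpow_le_rpow (by linarith) (by linarith [hs.1]) hβ
    · rw [← Real.exp_add]
      refine Real.exp_le_exp.2 ?_
      have := mul_le_mul_of_nonneg_left hs.1 hK.le
      rw [hy, mul_sub, mul_one_div_cancel hK.ne'] at this
      linarith
  rw [intervalIntegral.integral_mul_const, integral_ker hα1, sub_self,
    Real.zero_rpow (by linarith), sub_zero, show x - y = K⁻¹ by rw [hy]; simp,
    Real.inv_rpow hK.le] at n2
  have e : (K ^ (1 - α))⁻¹ / (1 - α) * Q
      = 2 ^ (-β) * Real.exp (-1) / (1 - α) * K ^ α * ((x + a) ^ β * Real.exp (K * x)) := by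
    rw [hQ, Real.rpow_sub hK, Real.rpow_one]
    have : 0 < K ^ α := Real.rpow_pos_of_pos hK _
    field_simp
  rw [e] at n2
  have : 2 ^ (-β) * Real.exp (-1) / (1 - α) * K ^ α * incFun a β K x
      ≤ 2 ^ (-β) * Real.exp (-1) / (1 - α) * K ^ α * ((x + a) ^ β * Real.exp (K * x)) := by
    refine mul_le_mul_of_nonneg_left (incFun_le ha hx0.le) ?_
    have : 0 < 1 - α := by linarith
    positivity
  linarith

/-- Near zero the factor t^{-α} dominates λ, away from zero K^α does. A quarter of t^{-α}W is kept
in both cases and produces the data t^{β-α}. -/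
theorem increasing_barrier {α : ℝ} (hα : 0 < α) (hα1 : α < 1) {β lam : ℝ} (hβ : 0 ≤ β)
    (hlam : 0 ≤ lam) (T r c : ℝ) : ∃ C : ℝ, 0 ≤ C ∧ ∃ M₀ : ℕ, ∀ (γ : ℝ) (M : ℕ) (t : ℕ → ℝ),
      M₀ ≤ M → IsMesh T M t → MeshA3 α γ r c M t →
      HasBarrier α lam M t (fun j => t j ^ (β - α)) (fun j => C * t j ^ β) := by
  have hG : 0 < Real.Gamma (1 - α) := Real.Gamma_pos_of_pos (by linarith)
  set G := Real.Gamma (1 - α) with hGdef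
  set Λ := G * lam + 1 with hΛ
  have hΛ0 : 0 < Λ := by positivity
  -- The point where t^{-α} = 4Λ, which separates the two regimes.
  set x₀ := (4 * Λ) ^ (-(1 / α)) with hx₀
  have hx₀0 : 0 < x₀ := Real.rpow_pos_of_pos (by positivity) _
  have hx₀α : x₀ ^ (-α) = 4 * Λ := by
    rw [hx₀, ← Real.rpow_mul (by positivity)]
    rw [show -(1 / α) * -α = 1 by field_simp, Real.rpow_one]
  set c' := 2 ^ (-β) * Real.exp (-1) / (1 - α) with hc'
  have h1α : 0 < 1 - α := by linarith
  have hc'0 : 0 < c' := by positivity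
  obtain ⟨K, hK, hK1, hK2⟩ : ∃ K : ℝ, 0 < K ∧ 2 ≤ K * x₀ ∧ 4 * Λ ≤ c' * K ^ α := by
    refine ⟨max (2 / x₀) ((4 * Λ / c') ^ (1 / α)), by positivity, ?_, ?_⟩
    · rw [← div_le_iff₀ hx₀0]; exact le_max_left _ _
    · rw [← div_le_iff₀' hc'0]
      have := Real.rpow_le_rpow (by positivity) (le_max_right (2 / x₀) ((4 * Λ / c') ^ (1 / α)))
        hα.le
      rwa [← Real.rpow_mul (by positivity), one_div_mul_cancel hα.ne', Real.rpow_one] at this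
  -- `incGrad_slow` loses q^{β+3}, which must equal 5/4. With 2θ = 1 - 1/q two consecutive steps
  -- change s + a by at most the factor q.
  set q := (5 / 4 : ℝ) ^ (1 / (β + 3)) with hq
  have hq1 : 1 < q := Real.one_lt_rpow (by norm_num) (by positivity)
  have hqβ : q ^ (β + 3) = 5 / 4 := by
    rw [hq, ← Real.rpow_mul (by norm_num), one_div_mul_cancel (by positivity), Real.rpow_one]
  set θ := (1 - 1 / q) / 2 with hθ
  have hqi : 1 / q < 1 := by rw [div_lt_one (by linarith)]; exact hq1
  have hqi0 : 0 < 1 / q := by positivity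
  have hθ0 : 0 < θ := by rw [hθ]; linarith
  obtain ⟨κ, hκ1, hκ⟩ := exists_step_le r c hθ0
  -- For M ≥ M₁ two steps change e^{Ks} by at most the factor q.
  obtain ⟨M₁, hM₁⟩ := exists_nat_gt (2 * K * c ^ 3 / Real.log q)
  have hlogq : 0 < Real.log q := Real.log_pos hq1
  refine ⟨4 * G * (1 + κ) * (Real.exp (K * T) * (1 + κ) ^ β), by positivity, max 2 M₁, ?_⟩
  intro γ M t hMM hmesh hA
  have hM2 : 2 ≤ M := (le_max_left _ _).trans hMM
  have hM1 : 1 ≤ M := by omega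
  have hMM1 : (M₁ : ℝ) ≤ M := by exact_mod_cast (le_max_right 2 M₁).trans hMM
  have hMr : (0 : ℝ) < M := by exact_mod_cast hM1
  have hτ1 := tau_one_pos hmesh hM1
  set a := κ * tau t 1 with ha
  have ha0 : 0 < a := by positivity
  have hstep : ∀ i, i < M → t (i + 1) - t i ≤ θ * (t (i + 1) + a) := by
    intro i hi
    have h1 := hκ α γ T M t hmesh hA (i + 1) a (by omega) (by omega) le_rfl
    have hp := mesh_pos hmesh (show 1 ≤ i + 1 by omega) (by omega)
    refine h1.trans ?_
    have h2 : (a / (t (i + 1) + a)) ^ (1 / r) ≤ 1 := by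
      refine Real.rpow_le_one (by positivity) ?_ (by have := hA.1; positivity)
      rw [div_le_one (by positivity)]; linarith
    exact mul_le_of_le_one_right (by positivity) h2
  have hslow : ∀ k, k + 2 ≤ M → ∀ ξ η, ξ ∈ Set.Icc (t k) (t (k + 2)) →
      η ∈ Set.Icc (t k) (t (k + 2)) → incGrad a β K ξ ≤ 5 / 4 * incGrad a β K η := by
    intro k hk ξ η hξ hη
    have h0 := mesh_nonneg hmesh (show k ≤ M by omega)
    have s1 := hstep k (by omega)
    have s2 := hstep (k + 1) (by omega)
    rw [show k + 1 + 1 = k + 2 from rfl] at s2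
    have hlen : t (k + 2) + a ≤ q * (t k + a) := by
      have h1 : (1 - θ) * (t (k + 2) + a) ≤ t (k + 1) + a := by linarith
      have h2 : (1 - θ) * (t (k + 1) + a) ≤ t k + a := by linarith
      have hθ1 : 0 ≤ 1 - θ := by rw [hθ]; linarith
      have h3 := mul_le_mul_of_nonneg_left h1 hθ1
      have hp : 0 ≤ t (k + 2) + a := by linarith [hξ.1, hξ.2]
      have h4 : (1 / q) * (t (k + 2) + a) ≤ t k + a := by
        have : 1 / q = 1 - 2 * θ := by rw [hθ]; ring
        rw [this]
        nlinarith [mul_nonneg (sq_nonneg θ) hp]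
      calc t (k + 2) + a = q * (1 / q * (t (k + 2) + a)) := by field_simp
        _ ≤ _ := mul_le_mul_of_nonneg_left h4 (by linarith)
    have hexp : K * (t (k + 2) - t k) ≤ Real.log q := by
      have d1 : t (k + 1) - t k ≤ c ^ 3 / M :=
        tau_le_div hmesh hA (show 1 ≤ k + 1 by omega) (by omega)
      have d2 : t (k + 2) - t (k + 1) ≤ c ^ 3 / M :=
        tau_le_div hmesh hA (show 1 ≤ k + 2 by omega) hk
      have d3 : K * (2 * (c ^ 3 / M)) ≤ Real.log q := by
        rw [div_lt_iff₀ hlogq] at hM₁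
        rw [show K * (2 * (c ^ 3 / M)) = 2 * K * c ^ 3 / M by ring, div_le_iff₀ hMr]
        nlinarith
      have d4 := mul_le_mul_of_nonneg_left (show t (k + 2) - t k ≤ 2 * (c ^ 3 / M) by linarith) hK.le
      linarith
    rw [← hqβ]
    refine incGrad_slow ha0 hβ hK.le hq1.le (h0.trans hξ.1) (h0.trans hη.1) ?_ ?_ ?_
    · have := mul_le_mul_of_nonneg_left hη.1 (show 0 ≤ q by linarith)
      linarith [hξ.2]
    · have := mul_le_mul_of_nonneg_left hξ.1 (show 0 ≤ q by linarith)
      linarith [hη.2]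
    · rw [← Real.exp_log (show 0 < q by linarith), ← Real.exp_add]
      refine Real.exp_le_exp.2 ?_
      have : K * (ξ - η) ≤ K * (t (k + 2) - t k) :=
        mul_le_mul_of_nonneg_left (by linarith [hξ.2, hη.1]) hK.le
      linarith
  have hbase : HasBarrier α lam M t (fun j => 1 / (4 * G * (1 + κ)) * t j ^ (β - α))
      (fun j => Real.exp (K * T) * (1 + κ) ^ β * t j ^ β) := by
    refine ⟨fun j => incFun a β K (t j), ?_, ?_⟩
    · simp only [hmesh.1, incFun_zero ha0, le_refl]
    intro j h1 h2
    have hx := mesh_pos hmesh h1 h2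
    have hxT := mesh_le_end hmesh h2
    have hax : a ≤ κ * t j := mul_le_mul_of_nonneg_left (tau_one_le hmesh h1 h2) (by linarith)
    have hW : 1 / (1 + κ) * t j ^ β ≤ incFun a β K (t j) := by
      refine le_trans ?_ (le_incFun ha0 hβ hK.le hx)
      rw [mul_comm]
      refine mul_le_mul_of_nonneg_left ?_ (by positivity)
      rw [div_le_div_iff₀ (by positivity) (by positivity)]
      linarith
    have hW0 : 0 ≤ incFun a β K (t j) := le_trans (by positivity) hW
    refine ⟨?_, hW0, ?_⟩
    · have hd := half_integral_le_delta hα1 (W := incFun a β K) (g := incGrad a β K)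
        (fun s hs => hasDerivAt_incFun β K (by linarith))
        (fun s hs => incGrad_pos ha0 hβ hK hs) (continuousOn_incGrad β K ha0) hmesh hM2 h1 h2 hslow
      have hmain : (t j ^ (-α) / 4 + G * lam) * incFun a β K (t j)
          ≤ G * delta α t (fun j => incFun a β K (t j)) j := by
        refine le_trans ?_ hd
        have hGl : G * lam ≤ Λ := by rw [hΛ]; linarith
        rcases le_total (t j) x₀ with hle | hge
        · have e1 := le_integral_incGrad hα.le hα1 ha0 hβ hK hx
          have e2 : 4 * Λ ≤ t j ^ (-α) := by
            rw [← hx₀α]; exact Real.rpow_le_rpow_of_nonpos hx hle (by linarith)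
          have e3 : (t j ^ (-α) / 4 + G * lam) * incFun a β K (t j)
              ≤ 1 / 2 * (t j ^ (-α) * incFun a β K (t j)) := by
            rw [← mul_assoc]
            exact mul_le_mul_of_nonneg_right (by linarith) hW0
          linarith
        · have e1 := le_integral_incGrad_of_large hα1 ha0 hβ hK (x := t j)
            (hK1.trans (mul_le_mul_of_nonneg_left hge hK.le))
          have e2 : t j ^ (-α) ≤ 4 * Λ := by
            rw [← hx₀α]; exact Real.rpow_le_rpow_of_nonpos hx₀0 hge (by linarith)
          have e3 : (t j ^ (-α) / 4 + G * lam) * incFun a β K (t j)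
              ≤ 1 / 2 * (c' * K ^ α * incFun a β K (t j)) := by
            rw [← mul_assoc]
            exact mul_le_mul_of_nonneg_right (by linarith) hW0
          linarith
      have e4 : 1 / (4 * G * (1 + κ)) * t j ^ (β - α)
          ≤ t j ^ (-α) / 4 * incFun a β K (t j) / G := by
        have := mul_le_mul_of_nonneg_left hW (show 0 ≤ t j ^ (-α) / 4 by positivity)
        rw [le_div_iff₀ hG]
        refine le_trans (le_of_eq ?_) this
        rw [show β - α = -α + β by ring, Real.rpow_add hx]
        field_simp
      have e5 : t j ^ (-α) / 4 * incFun a β K (t j) / G + lam * incFun a β K (t j)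
          ≤ delta α t (fun j => incFun a β K (t j)) j := by
        refine le_of_mul_le_mul_left (le_trans (le_of_eq ?_) hmain) hG
        field_simp
      linarith
    · refine (incFun_le ha0 hx.le).trans ?_
      have f1 : Real.exp (K * t j) ≤ Real.exp (K * T) :=
        Real.exp_le_exp.2 (mul_le_mul_of_nonneg_left hxT hK.le)
      have f2 : (t j + a) ^ β ≤ (1 + κ) ^ β * t j ^ β := by
        rw [← Real.mul_rpow (by positivity) hx.le]
        exact Real.rpow_le_rpow (by positivity) (by linarith) hβ
      calc (t j + a) ^ β * Real.exp (K * t j)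
          ≤ (1 + κ) ^ β * t j ^ β * Real.exp (K * T) :=
            mul_le_mul f2 f1 (Real.exp_pos _).le (by positivity)
        _ = _ := by ring
  refine (hbase.smul hα1 hmesh (c := 4 * G * (1 + κ)) (by positivity)).mono ?_ ?_
  · intro j h1 h2
    refine le_of_eq ?_
    field_simp
  · intro j h1 h2
    refine le_of_eq ?_
    ring

end

end L2Subdiffusion

namespace L2Subdiffusion

noncomputable section

open MeasureTheory intervalIntegral

/-! ### Truncation error of the discrete operator -/

theorem abs_le_of_hasDerivAt_of_zero {v v' : ℝ → ℝ} {x y N η s : ℝ}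
    (hv : ∀ z ∈ Set.Icc x y, HasDerivAt v (v' z) z) (hN : ∀ z ∈ Set.Icc x y, |v' z| ≤ N)
    (hη : η ∈ Set.Icc x y) (h0 : v η = 0) (hs : s ∈ Set.Icc x y) : |v s| ≤ N * (y - x) := by
  have h := (convex_Icc x y).norm_image_sub_le_of_norm_hasDerivWithin_le (f := v) (f' := v')
    (fun z hz => (hv z hz).hasDerivWithinAt) (fun z hz => hN z hz) hη hs
  rw [h0, sub_zero, Real.norm_eq_abs, Real.norm_eq_abs] at h
  have hN0 : 0 ≤ N := (abs_nonneg _).trans (hN s hs)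
  refine h.trans (mul_le_mul_of_nonneg_left ?_ hN0)
  rw [abs_le]
  constructor <;> linarith [hs.1, hs.2, hη.1, hη.2]

/-- A function with three zeros has a small derivative. -/
theorem abs_deriv_le_of_three_zeros {v v₁ v₂ v₃ : ℝ → ℝ} {x₀ x₁ x₂ N s : ℝ} (h01 : x₀ < x₁)
    (h12 : x₁ < x₂) (d₁ : ∀ z ∈ Set.Icc x₀ x₂, HasDerivAt v (v₁ z) z)
    (d₂ : ∀ z ∈ Set.Icc x₀ x₂, HasDerivAt v₁ (v₂ z) z)
    (d₃ : ∀ z ∈ Set.Icc x₀ x₂, HasDerivAt v₂ (v₃ z) z) (hN : ∀ z ∈ Set.Icc x₀ x₂, |v₃ z| ≤ N)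
    (z₀ : v x₀ = 0) (z₁ : v x₁ = 0) (z₂ : v x₂ = 0) (hs : s ∈ Set.Icc x₀ x₂) :
    |v₁ s| ≤ N * (x₂ - x₀) ^ 2 := by
  obtain ⟨ξ₁, hξ₁, e₁⟩ := exists_hasDerivAt_eq_zero (f' := v₁) h01
    (fun z hz => (d₁ z ⟨hz.1, hz.2.trans h12.le⟩).continuousAt.continuousWithinAt)
    (z₀.trans z₁.symm) (fun z hz => d₁ z ⟨hz.1.le, hz.2.le.trans h12.le⟩)
  obtain ⟨ξ₂, hξ₂, e₂⟩ := exists_hasDerivAt_eq_zero (f' := v₁) h12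
    (fun z hz => (d₁ z ⟨h01.le.trans hz.1, hz.2⟩).continuousAt.continuousWithinAt)
    (z₁.trans z₂.symm) (fun z hz => d₁ z ⟨h01.le.trans hz.1.le, hz.2.le⟩)
  have m₁ : ξ₁ ∈ Set.Icc x₀ x₂ := ⟨hξ₁.1.le, hξ₁.2.le.trans h12.le⟩
  have m₂ : ξ₂ ∈ Set.Icc x₀ x₂ := ⟨h01.le.trans hξ₂.1.le, hξ₂.2.le⟩
  obtain ⟨η, hη, e₃⟩ := exists_hasDerivAt_eq_zero (f' := v₂) (hξ₁.2.trans hξ₂.1)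
    (fun z hz => (d₂ z ⟨m₁.1.trans hz.1, hz.2.trans m₂.2⟩).continuousAt.continuousWithinAt)
    (e₁.trans e₂.symm) (fun z hz => d₂ z ⟨m₁.1.trans hz.1.le, hz.2.le.trans m₂.2⟩)
  have mη : η ∈ Set.Icc x₀ x₂ := ⟨m₁.1.trans hη.1.le, hη.2.le.trans m₂.2⟩
  have b₂ : ∀ z ∈ Set.Icc x₀ x₂, |v₂ z| ≤ N * (x₂ - x₀) :=
    fun z hz => abs_le_of_hasDerivAt_of_zero d₃ hN mη e₃ hz
  have := abs_le_of_hasDerivAt_of_zero d₂ b₂ m₁ e₁ hs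
  rw [sq, ← mul_assoc]
  exact this

/-- On each cell, including the last, the error is the derivative of u minus a parabola that agrees
with u at three consecutive nodes. -/
theorem abs_gradInterp_sub_le {u u₁ u₂ u₃ : ℝ → ℝ} {t : ℕ → ℝ} {n i : ℕ}
    (hm : ∀ j, j < n + 2 → t j < t (j + 1)) (h0 : t 0 = 0) (hi : i ≤ n + 1)
    (d₁ : ∀ z, 0 ≤ z → HasDerivAt u (u₁ z) z) (d₂ : ∀ z, 0 ≤ z → HasDerivAt u₁ (u₂ z) z)
    (d₃ : ∀ z, 0 ≤ z → HasDerivAt u₂ (u₃ z) z) {N : ℝ}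
    (hN : ∀ z, t (min i n) ≤ z → |u₃ z| ≤ N) {s : ℝ} (hs : s ∈ Set.Icc (t i) (t (i + 1))) :
    |gradInterp t (fun j => u (t j)) n i s - u₁ s|
      ≤ N * (t (min i n + 2) - t (min i n)) ^ 2 := by
  obtain ⟨k, hk, hmin, hik⟩ : ∃ k, k ≤ n ∧ min i n = k ∧ (i = k ∨ i = k + 1) :=
    ⟨min i n, min_le_right _ _, rfl, by omega⟩
  rw [hmin] at hN ⊢
  have e0 : 0 ≤ t k := by rw [← h0]; exact mesh_le hm (Nat.zero_le k) (by omega)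
  have e1 := hm k (by omega)
  have e2 : t (k + 1) < t (k + 2) := hm (k + 1) (by omega)
  have ms : s ∈ Set.Icc (t k) (t (k + 2)) := by
    rcases hik with rfl | rfl
    · exact ⟨hs.1, by linarith [hs.2]⟩
    · exact ⟨by linarith [hs.1], hs.2⟩
  set S := slope t (fun j => u (t j)) k with hS
  set Q := curv t (fun j => u (t j)) k with hQ
  have hg : gradInterp t (fun j => u (t j)) n i s = S + Q * (2 * s - t k - t (k + 1)) := by
    unfold gradInterp
    rw [hmin]
    rcases hik with rfl | rfl
    · rfl
    · have : slope t (fun j => u (t j)) (k + 1) = S + Q * (t (k + 2) - t k) := by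
        rw [hQ]; unfold curv
        have : t (k + 2) - t k ≠ 0 := by linarith
        field_simp
        ring
      rw [this, ← hQ]
      ring
  rw [hg, abs_sub_comm]
  have p1 : ∀ z : ℝ, HasDerivAt
      (fun z : ℝ => u (t k) + S * (z - t k) + Q * ((z - t k) * (z - t (k + 1))))
      (S + Q * (2 * z - t k - t (k + 1))) z := by
    intro z
    have a1 : HasDerivAt (fun z : ℝ => z - t k) 1 z := (hasDerivAt_id z).sub_const _
    have a2 : HasDerivAt (fun z : ℝ => z - t (k + 1)) 1 z := (hasDerivAt_id z).sub_const _
    exact (((a1.const_mul S).const_add (u (t k))).add ((a1.mul a2).const_mul Q)).congr_deriv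
      (by ring)
  have p2 : ∀ z : ℝ, HasDerivAt (fun z : ℝ => S + Q * (2 * z - t k - t (k + 1))) (2 * Q) z := by
    intro z
    have a1 : HasDerivAt (fun z : ℝ => 2 * z - t k - t (k + 1)) 2 z := by
      simpa using (((hasDerivAt_id z).const_mul 2).sub_const (t k)).sub_const (t (k + 1))
    exact ((a1.const_mul Q).const_add S).congr_deriv (by ring)
  have hne1 : t (k + 1) - t k ≠ 0 := by linarith
  have hne2 : t (k + 2) - t k ≠ 0 := by linarith
  have hne3 : t (k + 2) - t (k + 1) ≠ 0 := by linarith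
  refine abs_deriv_le_of_three_zeros
    (v := fun z => u z - (u (t k) + S * (z - t k) + Q * ((z - t k) * (z - t (k + 1)))))
    (v₁ := fun z => u₁ z - (S + Q * (2 * z - t k - t (k + 1))))
    (v₂ := fun z => u₂ z - 2 * Q) (v₃ := u₃) e1 e2 (fun z hz => ?_) (fun z hz => ?_)
    (fun z hz => ?_) (fun z hz => hN z hz.1) ?_ ?_ ?_ ms
  · exact (d₁ z (e0.trans hz.1)).sub (p1 z)
  · exact (d₂ z (e0.trans hz.1)).sub (p2 z)
  · exact (d₃ z (e0.trans hz.1)).sub_const _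
  · simp
  · simp only [hS, slope]
    field_simp
    ring
  · simp only [hQ, hS, curv, slope]
    rw [show k + 1 + 1 = k + 2 from rfl]
    field_simp
    ring

theorem integral_gradInterp (t U : ℕ → ℝ) (n : ℕ) {i : ℕ} (h : t i ≠ t (i + 1)) :
    ∫ s in t i..t (i + 1), gradInterp t U n i s = U (i + 1) - U i := by
  have hd : ∀ s ∈ Set.uIcc (t i) (t (i + 1)), HasDerivAt
      (fun s : ℝ => slope t U i * (s - t i)
        + curv t U (min i n) * ((s - t i) * (s - t (i + 1)))) (gradInterp t U n i s) s := by
    intro s _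
    have a1 : HasDerivAt (fun z : ℝ => z - t i) 1 s := (hasDerivAt_id s).sub_const _
    have a2 : HasDerivAt (fun z : ℝ => z - t (i + 1)) 1 s := (hasDerivAt_id s).sub_const _
    exact ((a1.const_mul _).add ((a1.mul a2).const_mul _)).congr_deriv
      (by unfold gradInterp; ring)
  rw [integral_eq_sub_of_hasDerivAt hd ((continuous_gradInterp t U n i).intervalIntegrable _ _)]
  unfold slope
  have : t (i + 1) - t i ≠ 0 := sub_ne_zero.2 h.symm
  field_simp
  ring

/-- The truncation error, cell by cell; in all cells but the last one the kernel may be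
diminished by a constant since `Π U - u` vanishes at the mesh points. -/
theorem truncation_le {α : ℝ} (hα : 0 ≤ α) (hα1 : α < 1) {u u₁ : ℝ → ℝ} {t : ℕ → ℝ} {n : ℕ}
    (hm : ∀ j, j < n + 2 → t j < t (j + 1)) (h0 : t 0 = 0)
    (d₁ : ∀ z, 0 ≤ z → HasDerivAt u (u₁ z) z) (hc : ContinuousOn u₁ (Set.Ici 0)) {E : ℕ → ℝ}
    (hE : ∀ i, i ≤ n + 1 → ∀ s ∈ Set.Icc (t i) (t (i + 1)),
      |gradInterp t (fun j => u (t j)) n i s - u₁ s| ≤ E i) :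
    ∫ s in (0 : ℝ)..t (n + 2), ker α (t (n + 2)) s * u₁ s
      ≤ opL α t (fun j => u (t j)) n
        + ∑ i ∈ Finset.range (n + 1), E i * ((t (i + 1) - t i) *
          (ker α (t (n + 2)) (t (i + 1)) - ker α (t (n + 2)) (t i)))
        + E (n + 1) * cellMass α (t (n + 2)) (t (n + 1)) (t (n + 2)) := by
  set x := t (n + 2) with hx
  set U : ℕ → ℝ := fun j => u (t j) with hU
  have hpos : ∀ i, i ≤ n + 2 → 0 ≤ t i := fun i hi => by
    rw [← h0]; exact mesh_le hm (Nat.zero_le i) hi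
  have hcc : ∀ i, i < n + 2 → ContinuousOn u₁ (Set.uIcc (t i) (t (i + 1))) := by
    intro i hi
    rw [Set.uIcc_of_le (hm i hi).le]
    exact hc.mono fun s hs => (hpos i hi.le).trans hs.1
  have hi1 : ∀ i, i < n + 2 → IntervalIntegrable (fun s => ker α x s * u₁ s) volume (t i)
      (t (i + 1)) := fun i hi => ker_mul_intervalIntegrable hα1 _ _ _ (hcc i hi)
  have hi2 : ∀ i, IntervalIntegrable (fun s => ker α x s * gradInterp t U n i s) volume (t i)
      (t (i + 1)) := fun i =>
    ker_mul_intervalIntegrable hα1 _ _ _ (continuous_gradInterp t U n i).continuousOn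
  have hadj := sum_integral_adjacent_intervals hi1
  rw [h0, ← hx] at hadj
  rw [← hadj]
  -- a single cell
  have hcell : ∀ i, i < n + 2 → ∀ c : ℝ, (∀ s ∈ Set.Icc (t i) (t (i + 1)), c ≤ ker α x s ∨ s = x) →
      ∫ s in t i..t (i + 1), ker α x s * u₁ s ≤
        (∫ s in t i..t (i + 1), ker α x s * gradInterp t U n i s)
          + E i * ((∫ s in t i..t (i + 1), ker α x s) - c * (t (i + 1) - t i)) := by
    intro i hi c hck
    have e1 := hm i hi
    have hmean : ∫ s in t i..t (i + 1), (gradInterp t U n i s - u₁ s) = 0 := by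
      rw [intervalIntegral.integral_sub ((continuous_gradInterp t U n i).intervalIntegrable _ _)
        (hcc i hi).intervalIntegrable, integral_gradInterp t U n e1.ne,
        integral_eq_sub_of_hasDerivAt (f := u) (fun s hs => d₁ s ?_) (hcc i hi).intervalIntegrable]
      · simp [hU]
      · rw [Set.uIcc_of_le e1.le] at hs
        exact (hpos i hi.le).trans hs.1
    have hdi : IntervalIntegrable (fun s => gradInterp t U n i s - u₁ s) volume (t i)
        (t (i + 1)) :=
      ((continuous_gradInterp t U n i).continuousOn.sub (hcc i hi)).intervalIntegrable
    have hki := ker_intervalIntegrable hα1 x (t i) (t (i + 1))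
    have hki' : IntervalIntegrable (fun s => (ker α x s - c) * E i) volume (t i) (t (i + 1)) :=
      (hki.sub _root_.intervalIntegrable_const).mul_const _
    have hkd : IntervalIntegrable (fun s => (ker α x s - c) * (u₁ s - gradInterp t U n i s))
        volume (t i) (t (i + 1)) :=
      (hki.sub _root_.intervalIntegrable_const).mul_continuousOn
        ((hcc i hi).sub (continuous_gradInterp t U n i).continuousOn)
    have hmono := integral_mono_on_of_le_Ioo e1.le hkd hki' (fun s hs => by
      have hsI := Set.Ioo_subset_Icc_self hs
      have hsx : s < x := hs.2.trans_le (mesh_le hm (show i + 1 ≤ n + 2 by omega) le_rfl)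
      have h1 : 0 ≤ ker α x s - c := by
        rcases hck s hsI with h | h
        · linarith
        · exact absurd h hsx.ne
      have h2 := (abs_le.1 (hE i (by omega) s hsI)).1
      exact mul_le_mul_of_nonneg_left (by linarith) h1)
    have l1 : ∫ s in t i..t (i + 1), (ker α x s - c) * (u₁ s - gradInterp t U n i s)
        = (∫ s in t i..t (i + 1), ker α x s * u₁ s)
          - (∫ s in t i..t (i + 1), ker α x s * gradInterp t U n i s) := by
      have : ∀ s, (ker α x s - c) * (u₁ s - gradInterp t U n i s)
          = (ker α x s * u₁ s - ker α x s * gradInterp t U n i s)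
            + c * (gradInterp t U n i s - u₁ s) := by intro s; ring
      simp_rw [this]
      rw [intervalIntegral.integral_add ((hi1 i hi).sub (hi2 i)) (hdi.const_mul c),
        intervalIntegral.integral_const_mul, hmean, mul_zero, add_zero,
        intervalIntegral.integral_sub (hi1 i hi) (hi2 i)]
    have l2 : ∫ s in t i..t (i + 1), (ker α x s - c) * E i
        = E i * ((∫ s in t i..t (i + 1), ker α x s) - c * (t (i + 1) - t i)) := by
      rw [intervalIntegral.integral_mul_const,
        intervalIntegral.integral_sub hki _root_.intervalIntegrable_const]
      simp
      ring
    rw [l1, l2] at hmono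
    linarith
  have hE0 : ∀ i, i ≤ n + 1 → 0 ≤ E i := fun i hi =>
    (abs_nonneg _).trans (hE i hi (t i) ⟨le_rfl, (hm i (by omega)).le⟩)
  rw [Finset.sum_range_succ]
  unfold opL
  rw [Finset.sum_range_succ (fun i => ∫ s in t i..t (i + 1), ker α (t (n + 2)) s *
    gradInterp t U n i s) (n + 1)]
  have hlast := hcell (n + 1) (by omega) 0 (fun s hs => Or.inl (ker_nonneg α hs.2))
  rw [zero_mul, sub_zero, show n + 1 + 1 = n + 2 from rfl] at hlast
  have hfirst : ∑ i ∈ Finset.range (n + 1), ∫ s in t i..t (i + 1), ker α x s * u₁ s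
      ≤ (∑ i ∈ Finset.range (n + 1), ∫ s in t i..t (i + 1), ker α x s * gradInterp t U n i s)
        + ∑ i ∈ Finset.range (n + 1), E i * ((t (i + 1) - t i) *
          (ker α x (t (i + 1)) - ker α x (t i))) := by
    rw [← Finset.sum_add_distrib]
    refine Finset.sum_le_sum fun i hi => ?_
    have hi' := Finset.mem_range.1 hi
    have e1 := hm i (by omega)
    have e2 := mesh_lt hm (show i + 1 < n + 2 by omega) le_rfl
    refine (hcell i (by omega) (ker α x (t i)) fun s hs => ?_).trans ?_
    · exact Or.inl (ker_mono hα hs.1 (hs.2.trans_lt e2))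
    · have := cellMass_le hα hα1 e1.le e2
      unfold cellMass at this
      have h3 := mul_le_mul_of_nonneg_left (show (∫ s in t i..t (i + 1), ker α x s)
        - ker α x (t i) * (t (i + 1) - t i) ≤ (t (i + 1) - t i) *
          (ker α x (t (i + 1)) - ker α x (t i)) by linarith) (hE0 i (by omega))
      linarith
  unfold cellMass
  rw [show n + 1 + 1 = n + 2 from rfl, ← hx] at *
  linarith

/-! ### The decaying barrier `s (s + a)^{α - 2}` -/

/-- The function `s (s+a)^{α-2}`. -/
def decFun (α a s : ℝ) : ℝ := (s + a) ^ (α - 1) - a * (s + a) ^ (α - 2)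

/-- The first derivative of `decFun`. -/
def decGrad (α a s : ℝ) : ℝ :=
  (α - 1) * (s + a) ^ (α - 2) - a * ((α - 2) * (s + a) ^ (α - 3))

theorem decFun_eq {α a s : ℝ} (h : 0 < s + a) : decFun α a s = s * (s + a) ^ (α - 2) := by
  unfold decFun
  rw [show α - 1 = (α - 2) + 1 by ring, Real.rpow_add_one h.ne']
  ring

theorem hasDerivAt_decFun {α a s : ℝ} (h : 0 < s + a) :
    HasDerivAt (decFun α a) (decGrad α a s) s := by
  refine ((hasDerivAt_shift_rpow (α - 1) h).sub
    ((hasDerivAt_shift_rpow (α - 2) h).const_mul a)).congr_deriv ?_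
  unfold decGrad
  rw [show α - 1 - 1 = α - 2 by ring, show α - 2 - 1 = α - 3 by ring]

theorem hasDerivAt_decGrad {α a s : ℝ} (h : 0 < s + a) :
    HasDerivAt (decGrad α a) ((α - 1) * ((α - 2) * (s + a) ^ (α - 3))
      - a * ((α - 2) * ((α - 3) * (s + a) ^ (α - 4)))) s := by
  refine (((hasDerivAt_shift_rpow (α - 2) h).const_mul (α - 1)).sub
    (((hasDerivAt_shift_rpow (α - 3) h).const_mul (α - 2)).const_mul a)).congr_deriv ?_
  rw [show α - 2 - 1 = α - 3 by ring, show α - 3 - 1 = α - 4 by ring]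

theorem hasDerivAt_decGrad_deriv {α a s : ℝ} (h : 0 < s + a) :
    HasDerivAt (fun s => (α - 1) * ((α - 2) * (s + a) ^ (α - 3))
      - a * ((α - 2) * ((α - 3) * (s + a) ^ (α - 4))))
      ((α - 1) * ((α - 2) * ((α - 3) * (s + a) ^ (α - 4)))
      - a * ((α - 2) * ((α - 3) * ((α - 4) * (s + a) ^ (α - 5))))) s := by
  refine ((((hasDerivAt_shift_rpow (α - 3) h).const_mul (α - 2)).const_mul (α - 1)).sub
    ((((hasDerivAt_shift_rpow (α - 4) h).const_mul (α - 3)).const_mul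
      (α - 2)).const_mul a)).congr_deriv ?_
  rw [show α - 3 - 1 = α - 4 by ring, show α - 4 - 1 = α - 5 by ring]

/-- With ω = a/(s+a) in [0,1] the bracket is (2-α)(3-α)((4-α)ω - (1-α)), of modulus at most 6·5. -/
theorem abs_decFun_third_le {α a s : ℝ} (hα : 0 ≤ α) (hα1 : α ≤ 1) (ha : 0 < a) (hs : 0 ≤ s) :
    |(α - 1) * ((α - 2) * ((α - 3) * (s + a) ^ (α - 4)))
      - a * ((α - 2) * ((α - 3) * ((α - 4) * (s + a) ^ (α - 5))))| ≤ 30 * (s + a) ^ (α - 4) := by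
  have h : 0 < s + a := by linarith
  set P := (s + a) ^ (α - 4) with hP
  have hP0 : 0 < P := Real.rpow_pos_of_pos h _
  have e : (s + a) ^ (α - 5) = P / (s + a) := by
    rw [hP, show α - 5 = (α - 4) - 1 by ring, Real.rpow_sub_one h.ne']
  rw [e]
  set ω := a / (s + a) with hω
  have hω0 : 0 ≤ ω := by positivity
  have hω1 : ω ≤ 1 := by rw [hω, div_le_one h]; linarith
  have e2 : (α - 1) * ((α - 2) * ((α - 3) * P))
      - a * ((α - 2) * ((α - 3) * ((α - 4) * (P / (s + a)))))
      = ((2 - α) * (3 - α) * ((4 - α) * ω - (1 - α))) * P := by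
    rw [hω]; field_simp; ring
  rw [e2, abs_mul, abs_of_pos hP0]
  refine mul_le_mul_of_nonneg_right ?_ hP0.le
  have b1 : 0 ≤ (2 - α) * (3 - α) := mul_nonneg (by linarith) (by linarith)
  have b2 : (2 - α) * (3 - α) ≤ 6 := by nlinarith
  rw [abs_mul, abs_of_nonneg b1]
  have b3 : |(4 - α) * ω - (1 - α)| ≤ 5 := by
    rw [abs_le]; constructor <;> nlinarith
  calc _ ≤ 6 * 5 := mul_le_mul b2 b3 (abs_nonneg _) (by norm_num)
    _ = 30 := by norm_num

theorem continuousOn_decGrad {α a : ℝ} (ha : 0 < a) : ContinuousOn (decGrad α a) (Set.Ici 0) :=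
  fun s hs => (hasDerivAt_decGrad (by
    have : (0 : ℝ) ≤ s := hs
    linarith)).continuousAt.continuousWithinAt

/-- The fractional derivative of s(s+a)^{α-2} is explicit, and positive even where the function
itself decreases. This is the reason for the choice of this profile. -/
theorem integral_ker_decGrad {α a x : ℝ} (hα1 : α < 1) (ha : 0 < a) (hx : 0 < x) :
    ∫ s in (0 : ℝ)..x, ker α x s * decGrad α a s
      = a ^ α * x ^ (1 - α) * (x + a) ^ (-2 : ℝ) / (1 - α) := by
  have h1α : 0 < 1 - α := by linarith
  have h2α : 0 < 2 - α := by linarith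
  have hxa : 0 < x + a := by linarith
  set w : ℝ → ℝ := fun s => (x - s) / (s + a) with hw
  -- An antiderivative found by substituting w = (x-s)/(s+a), which turns the integrand into powers
  -- of w.
  set P : ℝ → ℝ := fun s => (w s) ^ (1 - α) / (x + a)
    - a * (2 - α) / (x + a) ^ 2 * ((w s) ^ (1 - α) / (1 - α) + (w s) ^ (2 - α) / (2 - α)) with hP
  have hwc : ContinuousOn w (Set.Icc 0 x) := by
    refine ContinuousOn.div (by fun_prop) (by fun_prop) fun s hs => ?_
    have := hs.1
    positivity
  have hPc : ContinuousOn P (Set.Icc 0 x) := by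
    have c1 : ContinuousOn (fun s => (w s) ^ (1 - α)) (Set.Icc 0 x) :=
      hwc.rpow_const fun s _ => Or.inr h1α.le
    have c2 : ContinuousOn (fun s => (w s) ^ (2 - α)) (Set.Icc 0 x) :=
      hwc.rpow_const fun s _ => Or.inr h2α.le
    exact (c1.div_const _).sub (((c1.div_const _).add (c2.div_const _)).const_mul _)
  have hPd : ∀ s ∈ Set.Ioo 0 x, HasDerivAt P (ker α x s * decGrad α a s) s := by
    intro s hs
    have hsa : 0 < s + a := by linarith [hs.1]
    have hxs : 0 < x - s := by linarith [hs.2]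
    have hws : 0 < w s := div_pos hxs hsa
    have dw : HasDerivAt w (-(x + a) / (s + a) ^ 2) s := by
      have a1 : HasDerivAt (fun s : ℝ => x - s) (-1) s := by
        simpa using (hasDerivAt_id s).const_sub x
      have a2 : HasDerivAt (fun s : ℝ => s + a) 1 s := (hasDerivAt_id s).add_const a
      refine (a1.div a2 hsa.ne').congr_deriv ?_
      ring
    have d1 := dw.rpow_const (p := 1 - α) (Or.inl hws.ne')
    have d2 := dw.rpow_const (p := 2 - α) (Or.inl hws.ne')
    refine ((d1.div_const (x + a)).sub (((d1.div_const (1 - α)).add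
      (d2.div_const (2 - α))).const_mul (a * (2 - α) / (x + a) ^ 2))).congr_deriv ?_
    have e1 : w s ^ (1 - α - 1) = (x - s) ^ (-α) * (s + a) ^ α := by
      rw [show 1 - α - 1 = -α by ring, hw]
      simp only
      rw [Real.div_rpow hxs.le hsa.le, Real.rpow_neg hsa.le]
      field_simp
    have e2 : w s ^ (2 - α - 1) = (x - s) ^ (-α) * (s + a) ^ α * ((x - s) / (s + a)) := by
      rw [show 2 - α - 1 = (1 - α - 1) + 1 by ring, Real.rpow_add_one hws.ne', e1]
    rw [e1, e2]
    unfold ker decGrad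
    have e3 : (s + a) ^ (α - 2) = (s + a) ^ α / (s + a) ^ 2 := by
      rw [Real.rpow_sub hsa, Real.rpow_two]
    have e4 : (s + a) ^ (α - 3) = (s + a) ^ α / (s + a) ^ 3 := by
      rw [Real.rpow_sub hsa]; norm_cast
    rw [e3, e4]
    field_simp
    ring
  rw [integral_eq_sub_of_hasDerivAt_of_le hx.le hPc hPd
    (ker_mul_intervalIntegrable hα1 _ _ _ (by
      rw [Set.uIcc_of_le hx.le]
      exact (continuousOn_decGrad ha).mono fun s hs => hs.1))]
  simp only [hP, hw, sub_self, zero_div, sub_zero, zero_add]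
  rw [Real.zero_rpow h1α.ne', Real.zero_rpow h2α.ne', show (2 : ℝ) - α = (1 - α) + 1 by ring,
    Real.rpow_add_one (by positivity), Real.div_rpow hx.le ha.le, Real.rpow_neg hxa.le,
    Real.rpow_two, Real.rpow_sub ha, Real.rpow_one]
  have : 0 < a ^ α := Real.rpow_pos_of_pos ha _
  have : 1 - α + 1 ≠ 0 := by linarith
  field_simp
  ring

end

end L2Subdiffusion

namespace L2Subdiffusion

noncomputable section

open MeasureTheory intervalIntegral

/-! ### Lower bound for the discrete operator on the decaying barrier -/

section decay

variable {α a θ : ℝ} {t : ℕ → ℝ} {n : ℕ}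

/-- The bound for `(Π u - u)'` on cell `i`, `u = decFun α a`. -/
def decError (α a : ℝ) (t : ℕ → ℝ) (k : ℕ) : ℝ :=
  30 * (t k + a) ^ (α - 4) * (t (k + 2) - t k) ^ 2

/-- The last step is the longest, so the sum is at most that step times a telescoping sum of kernel
values. -/
theorem sum_ker_increments_le (hα : 0 ≤ α) (hα1 : α < 1) (hm : ∀ j, j < n + 2 → t j < t (j + 1))
    (hτ : ∀ i, i ≤ n + 1 → t (i + 1) - t i ≤ t (n + 2) - t (n + 1)) :
    ∑ i ∈ Finset.range (n + 1), (t (i + 1) - t i) *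
          (ker α (t (n + 2)) (t (i + 1)) - ker α (t (n + 2)) (t i))
        + cellMass α (t (n + 2)) (t (n + 1)) (t (n + 2))
      ≤ 2 * ((t (n + 2) - t (n + 1)) ^ (1 - α) / (1 - α)) := by
  have e2 : t (n + 1) < t (n + 2) := hm (n + 1) (by omega)
  set h := t (n + 2) - t (n + 1) with hh
  have hh0 : 0 < h := by linarith
  rw [cellMass_last hα1, ← hh]
  have h1 : ∑ i ∈ Finset.range (n + 1), (t (i + 1) - t i) *
          (ker α (t (n + 2)) (t (i + 1)) - ker α (t (n + 2)) (t i))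
      ≤ ∑ i ∈ Finset.range (n + 1), h *
          (ker α (t (n + 2)) (t (i + 1)) - ker α (t (n + 2)) (t i)) := by
    refine Finset.sum_le_sum fun i hi => ?_
    have hi' := Finset.mem_range.1 hi
    refine mul_le_mul_of_nonneg_right (hτ i (by omega)) (sub_nonneg.2 ?_)
    exact ker_mono hα (hm i (by omega)).le (mesh_lt hm (by omega) le_rfl)
  rw [← Finset.mul_sum, Finset.sum_range_sub (fun i => ker α (t (n + 2)) (t i))] at h1
  have h2 : 0 ≤ ker α (t (n + 2)) (t 0) :=
    ker_nonneg α (mesh_le hm (Nat.zero_le _) le_rfl)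
  have h3 : h * ker α (t (n + 2)) (t (n + 1)) = h ^ (1 - α) := by
    unfold ker
    rw [← hh, sub_eq_neg_add, Real.rpow_add_one hh0.ne', mul_comm]
  have h4 : h ^ (1 - α) ≤ h ^ (1 - α) / (1 - α) := by
    rw [le_div_iff₀ (by linarith)]
    have : 0 ≤ h ^ (1 - α) := Real.rpow_nonneg hh0.le _
    nlinarith
  have := mul_nonneg hh0.le h2
  linarith

theorem decFun_truncation (hα : 0 ≤ α) (hα1 : α < 1) (hm : ∀ j, j < n + 2 → t j < t (j + 1))
    (h0 : t 0 = 0) (ha : 0 < a) :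
    a ^ α * t (n + 2) ^ (1 - α) * (t (n + 2) + a) ^ (-2 : ℝ) / (1 - α)
      ≤ opL α t (fun j => decFun α a (t j)) n
        + ∑ i ∈ Finset.range (n + 1), decError α a t i * ((t (i + 1) - t i) *
          (ker α (t (n + 2)) (t (i + 1)) - ker α (t (n + 2)) (t i)))
        + decError α a t n * cellMass α (t (n + 2)) (t (n + 1)) (t (n + 2)) := by
  have hx : 0 < t (n + 2) := by
    have := mesh_lt hm (show 0 < n + 2 by omega) le_rfl; rwa [h0] at this
  rw [← integral_ker_decGrad hα1 ha hx]
  have hpos : ∀ z : ℝ, 0 ≤ z → 0 < z + a := fun z hz => by linarith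
  have htr := truncation_le hα hα1 hm h0 (u := decFun α a) (u₁ := decGrad α a)
    (E := fun i => decError α a t (min i n)) (fun z hz => hasDerivAt_decFun (hpos z hz))
    (continuousOn_decGrad ha) (fun i hi s hs => by
      refine abs_gradInterp_sub_le hm h0 hi (fun z hz => hasDerivAt_decFun (hpos z hz))
        (fun z hz => hasDerivAt_decGrad (hpos z hz))
        (fun z hz => hasDerivAt_decGrad_deriv (hpos z hz)) (fun z hz => ?_) hs
      have hk : 0 ≤ t (min i n) := by
        rw [← h0]; exact mesh_le hm (Nat.zero_le _) (by omega)
      refine (abs_decFun_third_le hα hα1.le ha (hk.trans hz)).trans ?_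
      refine mul_le_mul_of_nonneg_left ?_ (by norm_num)
      exact Real.rpow_le_rpow_of_nonpos (by linarith) (by linarith) (by linarith))
  rw [min_eq_right (Nat.le_succ n)] at htr
  have hs : ∑ i ∈ Finset.range (n + 1), decError α a t (min i n) * ((t (i + 1) - t i) *
          (ker α (t (n + 2)) (t (i + 1)) - ker α (t (n + 2)) (t i)))
      = ∑ i ∈ Finset.range (n + 1), decError α a t i * ((t (i + 1) - t i) *
          (ker α (t (n + 2)) (t (i + 1)) - ker α (t (n + 2)) (t i))) := by
    refine Finset.sum_congr rfl fun i hi => ?_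
    rw [min_eq_left (Nat.lt_succ_iff.1 (Finset.mem_range.1 hi))]
  rw [hs] at htr
  exact htr

/-- Up to time a everything lives on the scale a: the error is of relative size θ², and θ ≤ 1/8000
makes it at most half of the exact derivative. -/
theorem decay_of_le (hα : 0 ≤ α) (hα1 : α < 1) (hm : ∀ j, j < n + 2 → t j < t (j + 1))
    (h0 : t 0 = 0) (ha : 0 < a) (hτ : ∀ i, i ≤ n → t (i + 1) - t i ≤ t (i + 2) - t (i + 1))
    (hτ' : ∀ i, i ≤ n + 1 → t (i + 1) - t i ≤ t (n + 2) - t (n + 1))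
    (hθ : 0 ≤ θ) (hθ1 : θ ≤ 1 / 8000)
    (hstep : ∀ i, i ≤ n + 1 → t (i + 1) - t i ≤ θ * (t (i + 1) + a)) (hxa : t (n + 2) ≤ a) :
    1 / 2 * (a ^ α * t (n + 2) ^ (1 - α) * (t (n + 2) + a) ^ (-2 : ℝ) / (1 - α))
      ≤ opL α t (fun j => decFun α a (t j)) n := by
  have htr := decFun_truncation hα hα1 hm h0 ha
  have hsum := sum_ker_increments_le hα hα1 hm hτ'
  have hx : 0 < t (n + 2) := by
    have := mesh_lt hm (show 0 < n + 2 by omega) le_rfl; rwa [h0] at this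
  set x := t (n + 2) with hxdef
  have e2 : t (n + 1) < x := hm (n + 1) (by omega)
  have h1α : 0 < 1 - α := by linarith
  have hE : ∀ k, k ≤ n → decError α a t k ≤ 480 * θ ^ 2 * a ^ (α - 2) := by
    intro k hk
    have hk0 : 0 ≤ t k := by rw [← h0]; exact mesh_le hm (Nat.zero_le _) (by omega)
    have hkx : t (k + 2) ≤ x := mesh_le hm (by omega) le_rfl
    have s1 : t (k + 2) - t (k + 1) ≤ θ * (t (k + 2) + a) := hstep (k + 1) (by omega)
    have s2 := hτ k hk
    have s3 : θ * (t (k + 2) + a) ≤ θ * (2 * a) := mul_le_mul_of_nonneg_left (by linarith) hθ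
    have hL : t (k + 2) - t k ≤ 4 * θ * a := by linarith
    have hL0 : 0 ≤ t (k + 2) - t k := by
      have := mesh_le hm (show k ≤ k + 2 by omega) (by omega); linarith
    have p1 : (t k + a) ^ (α - 4) ≤ a ^ (α - 4) :=
      Real.rpow_le_rpow_of_nonpos ha (by linarith) (by linarith)
    have p2 := pow_le_pow_left₀ hL0 hL 2
    have p3 : a ^ (α - 4) * a ^ 2 = a ^ (α - 2) := by
      rw [← Real.rpow_natCast a 2, ← Real.rpow_add ha]; congr 1; push_cast; ring
    unfold decError
    calc _ ≤ 30 * a ^ (α - 4) * (4 * θ * a) ^ 2 :=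
          mul_le_mul (mul_le_mul_of_nonneg_left p1 (by norm_num)) p2 (sq_nonneg _) (by positivity)
      _ = _ := by rw [← p3]; ring
  set E := 480 * θ ^ 2 * a ^ (α - 2) with hEdef
  have hE0 : 0 ≤ E := by positivity
  have hsum' : ∑ i ∈ Finset.range (n + 1), decError α a t i * ((t (i + 1) - t i) *
          (ker α x (t (i + 1)) - ker α x (t i)))
      ≤ E * ∑ i ∈ Finset.range (n + 1), (t (i + 1) - t i) *
          (ker α x (t (i + 1)) - ker α x (t i)) := by
    rw [Finset.mul_sum]
    refine Finset.sum_le_sum fun i hi => ?_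
    have hi' := Finset.mem_range.1 hi
    have e := hm i (by omega)
    refine mul_le_mul_of_nonneg_right (hE i (by omega))
      (mul_nonneg (by linarith) (sub_nonneg.2 ?_))
    exact ker_mono hα e.le (mesh_lt hm (by omega) le_rfl)
  have hcm : 0 ≤ cellMass α x (t (n + 1)) x := by
    rw [cellMass_last hα1]
    exact div_nonneg (Real.rpow_nonneg (by linarith) _) h1α.le
  have hlast := mul_le_mul_of_nonneg_right (hE n le_rfl) hcm
  have htot := mul_le_mul_of_nonneg_left hsum hE0
  have hx1 : (x - t (n + 1)) ^ (1 - α) ≤ x ^ (1 - α) := by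
    have : 0 ≤ t (n + 1) := by rw [← h0]; exact mesh_le hm (Nat.zero_le _) (by omega)
    exact Real.rpow_le_rpow (by linarith) (by linarith) h1α.le
  have hx2 := div_le_div_of_nonneg_right hx1 h1α.le
  have hmain : 1 / 4 * (a ^ (α - 2) * x ^ (1 - α) / (1 - α))
      ≤ a ^ α * x ^ (1 - α) * (x + a) ^ (-2 : ℝ) / (1 - α) := by
    have q1 : (2 * a) ^ (-2 : ℝ) ≤ (x + a) ^ (-2 : ℝ) :=
      Real.rpow_le_rpow_of_nonpos (by linarith) (by linarith) (by norm_num)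
    have q2 : a ^ (α - 2) = a ^ α * a ^ (-2 : ℝ) := by
      rw [← Real.rpow_add ha]; rfl
    rw [Real.mul_rpow (by norm_num) ha.le] at q1
    have q3 : (2 : ℝ) ^ (-2 : ℝ) = 1 / 4 := by
      rw [Real.rpow_neg (by norm_num)]; norm_num
    rw [q3] at q1
    have q4 := mul_le_mul_of_nonneg_left q1 (show 0 ≤ a ^ α * x ^ (1 - α) / (1 - α) by positivity)
    rw [q2]
    refine le_trans (le_of_eq ?_) (q4.trans (le_of_eq ?_)) <;> ring
  have hX : 0 ≤ a ^ (α - 2) * x ^ (1 - α) / (1 - α) := by positivity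
  have hθ2 : θ ^ 2 ≤ 1 / 64000000 := by nlinarith
  have hEX : E * (2 * (x ^ (1 - α) / (1 - α)))
      ≤ 1 / 8 * (a ^ (α - 2) * x ^ (1 - α) / (1 - α)) := by
    have : E * (2 * (x ^ (1 - α) / (1 - α)))
        = 960 * θ ^ 2 * (a ^ (α - 2) * x ^ (1 - α) / (1 - α)) := by rw [hEdef]; ring
    rw [this]
    exact mul_le_mul_of_nonneg_right (by linarith) hX
  have hEx := mul_le_mul_of_nonneg_left hx2 (show 0 ≤ E * 2 by positivity)
  linarith

theorem rpow_sub_rpow_ge {p u v : ℝ} (hp : 0 ≤ p) (hu : 0 < u) (huv : u ≤ v) :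
    p * v ^ (-p - 1) * (v - u) ≤ u ^ (-p) - v ^ (-p) := by
  have := ker_tangent_le (α := p) (x := v) (b := 0) (s := v - u) hp (by linarith) (by linarith)
  simp only [ker, kerDeriv, sub_zero, sub_sub_cancel] at this
  linarith

/-- Here t k + a is comparable with x + a; the factors are 256 = 4⁴ and 30720 = 30·256·2². -/
theorem decError_le_near (hα : 0 ≤ α) (hα1 : α < 1) {h x : ℝ} {k : ℕ}
    (hL : t (k + 2) - t k ≤ 2 * h) (hL0 : 0 ≤ t (k + 2) - t k) (hx : 0 < x + a)
    (hnear : x + a ≤ 4 * (t k + a)) :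
    decError α a t k ≤ 30720 * h ^ 2 * (x + a) ^ (α - 4) := by
  have p1 : (t k + a) ^ (α - 4) ≤ 256 * (x + a) ^ (α - 4) := by
    have h1 : (t k + a) ^ (α - 4) ≤ (1 / 4 * (x + a)) ^ (α - 4) :=
      Real.rpow_le_rpow_of_nonpos (by positivity) (by linarith) (by linarith)
    rw [Real.mul_rpow (by norm_num) hx.le] at h1
    refine h1.trans (mul_le_mul_of_nonneg_right ?_ (Real.rpow_nonneg hx.le _))
    rw [one_div, Real.inv_rpow (by norm_num), ← Real.rpow_neg (by norm_num)]
    calc (4 : ℝ) ^ (-(α - 4)) ≤ 4 ^ (4 : ℝ) :=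
          Real.rpow_le_rpow_of_exponent_le (by norm_num) (by linarith)
      _ = 256 := by norm_num
  have p2 := pow_le_pow_left₀ hL0 hL 2
  unfold decError
  calc _ ≤ 30 * (256 * (x + a) ^ (α - 4)) * (2 * h) ^ 2 :=
        mul_le_mul (mul_le_mul_of_nonneg_left p1 (by norm_num)) p2 (sq_nonneg _) (by positivity)
    _ = _ := by ring

/-- Away from the singularity a kernel increment costs only h(x+a)^{-α-1}. With y = t k + a and 3q =
α+p, three step factors turn y^{α-4} into a^{α+p}y^{-p-1}, and the remaining factor h makes this an
increment of y^{-p}. Since p > 0, the sum over cells telescopes to order a^α. -/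
theorem decError_mul_le_far (hα : 0 < α) (hα1 : α < 1) (ha : 0 < a) {p q x h H : ℝ} {k : ℕ}
    (hq : 3 * q = α + p) (hp : 0 < p) (hp1 : p ≤ 1) (hθ : 0 ≤ θ)
    (hk : 0 ≤ t k) (hh : h = t (k + 1) - t k) (hh0 : 0 < h) (hL : t (k + 2) - t k ≤ 2 * H)
    (hL0 : 0 ≤ t (k + 2) - t k) (hhH : h ≤ H)
    (hH : H ≤ 4 * θ * (t k + a) * (a / (t k + a)) ^ q) (hax : a ≤ x) (hfar : t (k + 1) ≤ x / 2)
    (hcmp : t (k + 1) + a ≤ 2 * (t k + a)) :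
    decError α a t k * (h * (ker α x (t (k + 1)) - ker α x (t k)))
      ≤ 491520 / p * θ ^ 3 * (x + a) ^ (-α - 1) * a ^ (α + p) *
        ((t k + a) ^ (-p) - (t (k + 1) + a) ^ (-p)) := by
  have hx : 0 < x := ha.trans_le hax
  have hy : 0 < t k + a := by linarith
  set y := t k + a with hydef
  have hz : 0 < t (k + 1) + a := by linarith
  have hH0 : 0 < H := hh0.trans_le hhH
  have k1 : ker α x (t (k + 1)) - ker α x (t k) ≤ 16 * (x + a) ^ (-α - 1) * h := by
    have h1 := ker_sub_le (x := x) hα.le (show t k ≤ t (k + 1) by linarith) (by linarith)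
    refine h1.trans ?_
    rw [← hh]
    refine mul_le_mul_of_nonneg_right ?_ hh0.le
    unfold kerDeriv
    have h2 : (x - t (k + 1)) ^ (-α - 1) ≤ (1 / 4 * (x + a)) ^ (-α - 1) :=
      Real.rpow_le_rpow_of_nonpos (by linarith) (by linarith) (by linarith)
    rw [Real.mul_rpow (by norm_num) (by linarith)] at h2
    have h3 : (1 / 4 : ℝ) ^ (-α - 1) ≤ 16 := by
      rw [one_div, Real.inv_rpow (by norm_num), ← Real.rpow_neg (by norm_num)]
      calc (4 : ℝ) ^ (-(-α - 1)) ≤ 4 ^ (2 : ℝ) :=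
            Real.rpow_le_rpow_of_exponent_le (by norm_num) (by linarith)
        _ = 16 := by norm_num
    have h4 : 0 ≤ (x + a) ^ (-α - 1) := Real.rpow_nonneg (by linarith) _
    have h5 : 0 ≤ (x - t (k + 1)) ^ (-α - 1) := Real.rpow_nonneg (by linarith) _
    calc α * (x - t (k + 1)) ^ (-α - 1) ≤ 1 * (x - t (k + 1)) ^ (-α - 1) :=
          mul_le_mul_of_nonneg_right hα1.le h5
      _ ≤ (1 / 4 : ℝ) ^ (-α - 1) * (x + a) ^ (-α - 1) := by rw [one_mul]; exact h2
      _ ≤ 16 * (x + a) ^ (-α - 1) := mul_le_mul_of_nonneg_right h3 h4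
  have hX : 0 ≤ (x + a) ^ (-α - 1) := Real.rpow_nonneg (by linarith) _
  set X := (x + a) ^ (-α - 1) with hXdef
  have hY : 0 < y ^ (α - 4) := Real.rpow_pos_of_pos hy _
  have k2 : decError α a t k ≤ 120 * y ^ (α - 4) * H ^ 2 := by
    have p2 := pow_le_pow_left₀ hL0 hL 2
    unfold decError
    calc _ ≤ 30 * y ^ (α - 4) * (2 * H) ^ 2 := mul_le_mul_of_nonneg_left p2 (by positivity)
      _ = _ := by ring
  have k3 : H ^ 3 ≤ 64 * θ ^ 3 * (y ^ 3 * (a ^ (α + p) * y ^ (-(α + p)))) := by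
    have h1 := pow_le_pow_left₀ hH0.le hH 3
    refine h1.trans (le_of_eq ?_)
    have h2 : ((a / y) ^ q) ^ 3 = a ^ (α + p) * y ^ (-(α + p)) := by
      rw [← Real.rpow_natCast, ← Real.rpow_mul (by positivity), Real.div_rpow ha.le hy.le,
        show q * ((3 : ℕ) : ℝ) = α + p by push_cast; linarith, Real.rpow_neg hy.le]
      rfl
    rw [mul_pow, h2]; ring
  have k4 : y ^ (α - 4) * (y ^ 3 * (a ^ (α + p) * y ^ (-(α + p))))
      = a ^ (α + p) * y ^ (-p - 1) := by
    rw [← Real.rpow_natCast y 3]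
    have : y ^ (α - 4) * (y ^ ((3 : ℕ) : ℝ) * (a ^ (α + p) * y ^ (-(α + p))))
        = a ^ (α + p) * (y ^ (α - 4) * y ^ ((3 : ℕ) : ℝ) * y ^ (-(α + p))) := by ring
    rw [this, ← Real.rpow_add hy, ← Real.rpow_add hy]
    congr 2; push_cast; ring
  have k5 : y ^ (-p - 1) * h ≤ 4 / p * (y ^ (-p) - (t (k + 1) + a) ^ (-p)) := by
    have h1 := rpow_sub_rpow_ge hp.le hy (show y ≤ t (k + 1) + a by linarith)
    have h2 : y ^ (-p - 1) ≤ 4 * (t (k + 1) + a) ^ (-p - 1) := by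
      have h3 : (2 * y) ^ (-p - 1) ≤ (t (k + 1) + a) ^ (-p - 1) :=
        Real.rpow_le_rpow_of_nonpos hz hcmp (by linarith)
      rw [Real.mul_rpow (by norm_num) hy.le] at h3
      have h4 : (1 / 4 : ℝ) ≤ 2 ^ (-p - 1) := by
        calc (1 / 4 : ℝ) = 2 ^ (-2 : ℝ) := by rw [Real.rpow_neg (by norm_num)]; norm_num
          _ ≤ _ := Real.rpow_le_rpow_of_exponent_le (by norm_num) (by linarith)
      have h5 := mul_le_mul_of_nonneg_right h4 (show 0 ≤ y ^ (-p - 1) by positivity)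
      linarith
    have h6 : t (k + 1) + a - y = h := by rw [hh, hydef]; ring
    rw [h6] at h1
    have h7 := mul_le_mul_of_nonneg_right h2 hh0.le
    calc _ ≤ 4 * (t (k + 1) + a) ^ (-p - 1) * h := h7
      _ = 4 / p * (p * (t (k + 1) + a) ^ (-p - 1) * h) := by field_simp
      _ ≤ _ := mul_le_mul_of_nonneg_left h1 (by positivity)
  have hA : 0 < a ^ (α + p) := Real.rpow_pos_of_pos ha _
  have c1 : decError α a t k * (h * (ker α x (t (k + 1)) - ker α x (t k)))
      ≤ 120 * y ^ (α - 4) * H ^ 2 * (h * (16 * X * h)) := by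
    refine mul_le_mul k2 (mul_le_mul_of_nonneg_left k1 hh0.le)
      (mul_nonneg hh0.le (sub_nonneg.2 ?_)) (by positivity)
    exact ker_mono hα.le (by linarith) (by linarith)
  calc _ ≤ 120 * y ^ (α - 4) * H ^ 2 * (h * (16 * X * h)) := c1
    _ = 1920 * X * h * y ^ (α - 4) * (H ^ 2 * h) := by ring
    _ ≤ 1920 * X * h * y ^ (α - 4) * (H ^ 2 * H) :=
        mul_le_mul_of_nonneg_left (mul_le_mul_of_nonneg_left hhH (sq_nonneg H)) (by positivity)
    _ = 1920 * X * h * y ^ (α - 4) * H ^ 3 := by ring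
    _ ≤ 1920 * X * h * y ^ (α - 4) * (64 * θ ^ 3 * (y ^ 3 * (a ^ (α + p) * y ^ (-(α + p))))) :=
        mul_le_mul_of_nonneg_left k3 (by positivity)
    _ = 122880 * θ ^ 3 * X * h * (y ^ (α - 4) * (y ^ 3 * (a ^ (α + p) * y ^ (-(α + p))))) := by
        ring
    _ = 122880 * θ ^ 3 * X * a ^ (α + p) * (y ^ (-p - 1) * h) := by rw [k4]; ring
    _ ≤ 122880 * θ ^ 3 * X * a ^ (α + p) * (4 / p * (y ^ (-p) - (t (k + 1) + a) ^ (-p))) :=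
        mul_le_mul_of_nonneg_left k5 (by positivity)
    _ = _ := by ring

-- Both the near and the far cells must be beaten by a multiple of a^α(x+a)^{-α-1}, the size of the
-- exact derivative for x ≥ a. The near cells contribute h^{3-α}(x+a)^{α-4}, the far ones a
-- telescoping sum.
set_option maxHeartbeats 1000000 in
theorem decay_of_ge (hα : 0 < α) (hα1 : α < 1) (hm : ∀ j, j < n + 2 → t j < t (j + 1))
    (h0 : t 0 = 0) (ha : 0 < a) (hτ : ∀ i, i ≤ n → t (i + 1) - t i ≤ t (i + 2) - t (i + 1))
    (hτ' : ∀ i, i ≤ n + 1 → t (i + 1) - t i ≤ t (n + 2) - t (n + 1))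
    (hθ : θ = α ^ 2 / (3 - α) / 4000)
    (hstep : ∀ i, i ≤ n + 1 → t (i + 1) - t i
      ≤ θ * (t (i + 1) + a) * (a / (t (i + 1) + a)) ^ (α / (3 - α))) (hxa : a ≤ t (n + 2)) :
    1 / 2 * (a ^ α * t (n + 2) ^ (1 - α) * (t (n + 2) + a) ^ (-2 : ℝ) / (1 - α))
      ≤ opL α t (fun j => decFun α a (t j)) n := by
  have htr := decFun_truncation hα.le hα1 hm h0 ha
  have hsum := sum_ker_increments_le hα.le hα1 hm hτ'
  have hnn : ∀ i, i ≤ n + 2 → 0 ≤ t i := fun i hi => by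
    rw [← h0]; exact mesh_le hm (Nat.zero_le i) hi
  have hx : 0 < t (n + 2) := ha.trans_le hxa
  have h1α : 0 < 1 - α := by linarith
  have h3α : 0 < 3 - α := by linarith
  -- The surplus 3q - α for q = α/(3-α); θ = p/4000 later cancels the factor 1/p of the far cells.
  set p := α ^ 2 / (3 - α) with hp
  have hp0 : 0 < p := by positivity
  have hp1 : p ≤ 1 / 2 := by
    rw [hp, div_le_iff₀ h3α]; nlinarith
  set q := α / (3 - α) with hq
  have hq0 : 0 < q := by positivity
  have hqα : q * (3 - α) = α := by rw [hq]; field_simp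
  have hq3 : 3 * q = α + p := by rw [hq, hp]; field_simp; ring
  have hθ0 : 0 < θ := by rw [hθ]; positivity
  have hθ1 : θ ≤ 1 / 8000 := by rw [hθ]; linarith
  have hfrac : ∀ i, i ≤ n + 2 → 0 ≤ a / (t i + a) ∧ a / (t i + a) ≤ 1 := fun i hi => by
    have := hnn i hi
    exact ⟨by positivity, by rw [div_le_one (by positivity)]; linarith⟩
  have hstep' : ∀ i, i ≤ n + 1 → t (i + 1) - t i ≤ θ * (t (i + 1) + a) := fun i hi => by
    have h1 := hfrac (i + 1) (by omega)
    have h2 := hnn (i + 1) (by omega)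
    exact (hstep i hi).trans (mul_le_of_le_one_right (by positivity)
      (Real.rpow_le_one h1.1 h1.2 hq0.le))
  have hcmp : ∀ i, i ≤ n + 1 → t (i + 1) + a ≤ 2 * (t i + a) := fun i hi => by
    have h1 := hstep' i hi
    have h2 := hnn (i + 1) (by omega)
    have h3 : θ * (t (i + 1) + a) ≤ 1 / 8000 * (t (i + 1) + a) :=
      mul_le_mul_of_nonneg_right hθ1 (by linarith)
    linarith
  set x := t (n + 2) with hxdef
  have e2 : t (n + 1) < x := hm (n + 1) (by omega)
  set h := x - t (n + 1) with hh
  have hh0 : 0 < h := by linarith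
  set E := 30720 * h ^ 2 * (x + a) ^ (α - 4) with hE
  have hE0 : 0 ≤ E := by positivity
  have hLen : ∀ k, k ≤ n → t (k + 2) - t k ≤ 2 * (t (k + 2) - t (k + 1)) := fun k hk => by
    linarith [hτ k hk]
  have hLen0 : ∀ k, k ≤ n → 0 ≤ t (k + 2) - t k := fun k hk => by
    have := mesh_le hm (show k ≤ k + 2 by omega) (by omega); linarith
  have hLenh : ∀ k, k ≤ n → t (k + 2) - t k ≤ 2 * h := fun k hk => by
    have h1 : t (k + 2) - t (k + 1) ≤ h := hτ' (k + 1) (by omega)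
    linarith [hLen k hk]
  have hElast : decError α a t n ≤ E := by
    refine decError_le_near hα.le hα1 (hLenh n le_rfl) (hLen0 n le_rfl)
      (by linarith) ?_
    have h1 := hcmp n (by omega)
    have h2 : x + a ≤ 2 * (t (n + 1) + a) := hcmp (n + 1) le_rfl
    linarith
  set F := 491520 / p * θ ^ 3 * (x + a) ^ (-α - 1) * a ^ (α + p) with hF
  have hF0 : 0 ≤ F := by positivity
  have hcell : ∀ k, k ≤ n → decError α a t k * ((t (k + 1) - t k) *
      (ker α x (t (k + 1)) - ker α x (t k)))
      ≤ E * ((t (k + 1) - t k) * (ker α x (t (k + 1)) - ker α x (t k)))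
        + F * ((t k + a) ^ (-p) - (t (k + 1) + a) ^ (-p)) := by
    intro k hk
    have e := hm k (by omega)
    have hk0 := hnn k (by omega)
    have n1 : 0 ≤ (t (k + 1) - t k) * (ker α x (t (k + 1)) - ker α x (t k)) :=
      mul_nonneg (by linarith) (sub_nonneg.2
        (ker_mono hα.le e.le (mesh_lt hm (by omega) le_rfl)))
    have n2 : 0 ≤ (t k + a) ^ (-p) - (t (k + 1) + a) ^ (-p) :=
      sub_nonneg.2 (Real.rpow_le_rpow_of_nonpos (by linarith) (by linarith) (by linarith))
    rcases le_total (t (k + 1)) (x / 2) with hfar | hnear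
    · have hHk : t (k + 2) - t (k + 1) ≤ 4 * θ * (t k + a) * (a / (t k + a)) ^ q := by
        have s1 : t (k + 2) - t (k + 1) ≤ θ * (t (k + 2) + a) * (a / (t (k + 2) + a)) ^ q :=
          hstep (k + 1) (by omega)
        have c1 := hcmp k (by omega)
        have c2 : t (k + 2) + a ≤ 2 * (t (k + 1) + a) := hcmp (k + 1) (by omega)
        have hk2 := hnn (k + 2) (by omega)
        have f1 := hfrac (k + 2) (by omega)
        refine s1.trans (mul_le_mul ?_ ?_ (Real.rpow_nonneg f1.1 _) (by positivity))
        · have := mul_le_mul_of_nonneg_left (show t (k + 2) + a ≤ 4 * (t k + a) by linarith) hθ0.le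
          linarith
        · refine Real.rpow_le_rpow f1.1 ?_ hq0.le
          refine div_le_div_of_nonneg_left ha.le (by linarith) ?_
          have := hLen0 k hk
          linarith
      have := decError_mul_le_far hα hα1 ha hq3 hp0 (by linarith) hθ0.le hk0 rfl (by linarith)
        (hLen k hk) (hLen0 k hk) (hτ k hk) hHk hxa hfar (hcmp k (by omega))
      linarith [mul_nonneg hE0 n1]
    · have h1 := hcmp k (by omega)
      have := mul_le_mul_of_nonneg_right (decError_le_near hα.le hα1 (hLenh k hk)
        (hLen0 k hk) (show 0 < x + a by linarith) (by linarith)) n1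
      linarith [mul_nonneg hF0 n2]
  have hS : ∑ k ∈ Finset.range (n + 1), decError α a t k * ((t (k + 1) - t k) *
      (ker α x (t (k + 1)) - ker α x (t k)))
      ≤ E * ∑ k ∈ Finset.range (n + 1), (t (k + 1) - t k) *
          (ker α x (t (k + 1)) - ker α x (t k)) + F * a ^ (-p) := by
    have h1 := Finset.sum_le_sum fun k (hk : k ∈ Finset.range (n + 1)) =>
      hcell k (Nat.lt_succ_iff.1 (Finset.mem_range.1 hk))
    rw [Finset.sum_add_distrib, ← Finset.mul_sum, ← Finset.mul_sum,
      Finset.sum_range_sub' (fun k => (t k + a) ^ (-p)), h0, zero_add] at h1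
    have h2 : 0 ≤ (t (n + 1) + a) ^ (-p) :=
      Real.rpow_nonneg (by have := hnn (n + 1) (by omega); linarith) _
    have := mul_nonneg hF0 h2
    linarith
  have hcm : 0 ≤ cellMass α x (t (n + 1)) x := by
    rw [cellMass_last hα1]
    exact div_nonneg (Real.rpow_nonneg hh0.le _) h1α.le
  have hlast := mul_le_mul_of_nonneg_right hElast hcm
  have htot := mul_le_mul_of_nonneg_left hsum hE0
  -- comparison of the error with the main term
  set Z := a ^ α * (x + a) ^ (-α - 1) / (1 - α) with hZ
  have hZ0 : 0 ≤ Z := by positivity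
  have hxa0 : 0 < x + a := by linarith
  have hmain : 1 / 2 * Z ≤ a ^ α * x ^ (1 - α) * (x + a) ^ (-2 : ℝ) / (1 - α) := by
    have g1 : (1 / 2 * (x + a)) ^ (1 - α) ≤ x ^ (1 - α) :=
      Real.rpow_le_rpow (by positivity) (by linarith) h1α.le
    rw [Real.mul_rpow (by norm_num) hxa0.le] at g1
    have g2 : (1 / 2 : ℝ) ≤ (1 / 2) ^ (1 - α) := by
      have := Real.rpow_le_rpow_of_exponent_ge (x := (1 / 2 : ℝ)) (by norm_num) (by norm_num)
        (show 1 - α ≤ 1 by linarith)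
      rwa [Real.rpow_one] at this
    have g3 : (x + a) ^ (-α - 1) = (x + a) ^ (1 - α) * (x + a) ^ (-2 : ℝ) := by
      rw [← Real.rpow_add hxa0]; congr 1; ring
    have g4 : 1 / 2 * (x + a) ^ (1 - α) ≤ x ^ (1 - α) :=
      (mul_le_mul_of_nonneg_right g2 (Real.rpow_nonneg hxa0.le _)).trans g1
    have g5 := mul_le_mul_of_nonneg_left g4
      (show 0 ≤ a ^ α * (x + a) ^ (-2 : ℝ) / (1 - α) by positivity)
    rw [hZ, g3]
    refine le_trans (le_of_eq ?_) (g5.trans (le_of_eq ?_)) <;> ring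
  have hθ2 : θ ^ 2 ≤ 1 / 64000000 := by nlinarith
  -- The exponent q is exactly what is needed here: q(3-α) = α, so the factor (a/(x+a))^q in the
  -- step bound yields the missing a^α(x+a)^{-α}.
  have hh3 : h ^ 2 * h ^ (1 - α) ≤ θ ^ 2 * ((x + a) ^ (3 - α) * (a ^ α * (x + a) ^ (-α))) := by
    have s1 : h ≤ θ * (x + a) * (a / (x + a)) ^ q := hstep (n + 1) le_rfl
    have s2 := Real.rpow_le_rpow hh0.le s1 h3α.le
    have s3 : h ^ (3 - α) = h ^ 2 * h ^ (1 - α) := by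
      rw [← Real.rpow_natCast h 2, ← Real.rpow_add hh0]; congr 1; push_cast; ring
    rw [← s3]
    refine s2.trans ?_
    rw [Real.mul_rpow (by positivity) (by positivity), Real.mul_rpow hθ0.le hxa0.le,
      ← Real.rpow_mul (by positivity), hqα, Real.div_rpow ha.le hxa0.le, Real.rpow_neg hxa0.le,
      mul_assoc, div_eq_mul_inv]
    refine mul_le_mul_of_nonneg_right ?_ (by positivity)
    rw [← Real.rpow_natCast θ 2]
    exact Real.rpow_le_rpow_of_exponent_ge hθ0 (by linarith) (by push_cast; linarith)
  have herr1 : E * (2 * (h ^ (1 - α) / (1 - α))) ≤ 1 / 8 * Z := by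
    have g1 : (x + a) ^ (α - 4) * ((x + a) ^ (3 - α) * (a ^ α * (x + a) ^ (-α)))
        = a ^ α * (x + a) ^ (-α - 1) := by
      have : (x + a) ^ (α - 4) * ((x + a) ^ (3 - α) * (a ^ α * (x + a) ^ (-α)))
        = a ^ α * ((x + a) ^ (α - 4) * (x + a) ^ (3 - α) * (x + a) ^ (-α)) := by ring
      rw [this, ← Real.rpow_add hxa0, ← Real.rpow_add hxa0]
      congr 2; ring
    have g2 := mul_le_mul_of_nonneg_left hh3
      (show 0 ≤ 61440 * (x + a) ^ (α - 4) / (1 - α) by positivity)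
    have g3 : E * (2 * (h ^ (1 - α) / (1 - α)))
        = 61440 * (x + a) ^ (α - 4) / (1 - α) * (h ^ 2 * h ^ (1 - α)) := by rw [hE]; ring
    have g4 : 61440 * (x + a) ^ (α - 4) / (1 - α) *
        (θ ^ 2 * ((x + a) ^ (3 - α) * (a ^ α * (x + a) ^ (-α)))) = 61440 * θ ^ 2 * Z := by
      rw [hZ, ← g1]; ring
    rw [g3]
    rw [g4] at g2
    refine g2.trans (mul_le_mul_of_nonneg_right (by linarith) hZ0)
  have herr2 : F * a ^ (-p) ≤ 1 / 8 * Z := by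
    have g1 : a ^ (α + p) * a ^ (-p) = a ^ α := by
      rw [← Real.rpow_add ha]; congr 1; ring
    have g2 : F * a ^ (-p) = 491520 / p * θ ^ 3 * (a ^ α * (x + a) ^ (-α - 1)) := by
      rw [hF, ← g1]; ring
    have g3 : 491520 / p * θ ^ 3 ≤ 1 / 8 := by
      have : 491520 / p * θ ^ 3 = 491520 / 4000 * θ ^ 2 := by
        have : θ ^ 3 = θ ^ 2 * (p / 4000) := by rw [pow_succ, ← hθ]
        rw [this]; field_simp
      rw [this]; linarith
    have g4 : a ^ α * (x + a) ^ (-α - 1) ≤ Z := by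
      rw [hZ, le_div_iff₀ h1α]
      have : 0 ≤ a ^ α * (x + a) ^ (-α - 1) := by positivity
      nlinarith
    rw [g2]
    exact mul_le_mul g3 g4 (by positivity) (by norm_num)
  linarith

end decay

/-- The discrete operator on `decFun α a` is bounded below on all scales `a ≥ κ τ_1`. -/
theorem exists_decay_bound {α : ℝ} (hα : 0 < α) (hα1 : α < 1) (r c : ℝ) (hr : r ≤ (3 - α) / α) :
    ∃ κ : ℝ, 1 ≤ κ ∧ ∀ (σ γ T : ℝ) (M : ℕ) (t : ℕ → ℝ), IsMesh T M t → MeshA2Star σ M t →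
      MeshA3 α γ r c M t → ∀ j a, 1 ≤ j → j ≤ M → κ * tau t 1 ≤ a →
        1 / 2 * (a ^ α * t j ^ (1 - α) * (t j + a) ^ (-2 : ℝ) / (1 - α))
          ≤ Real.Gamma (1 - α) * delta α t (fun i => decFun α a (t i)) j := by
  have h1α : 0 < 1 - α := by linarith
  have h3α : 0 < 3 - α := by linarith
  have hG : 0 < Real.Gamma (1 - α) := Real.Gamma_pos_of_pos (by linarith)
  set θ := α ^ 2 / (3 - α) / 4000 with hθ
  have hθ0 : 0 < θ := by positivity
  obtain ⟨κ, hκ1, hκ⟩ := exists_step_le r c hθ0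
  refine ⟨κ, hκ1, ?_⟩
  intro σ γ T M t hmesh hA2 hA3 j a h1 h2 ha
  have hτ1 := tau_one_pos hmesh (h1.trans h2)
  have ha0 : 0 < a := lt_of_lt_of_le (by positivity) ha
  have hm : ∀ i, i < j → t i < t (i + 1) := fun i hi => hmesh.2.2 i (by omega)
  have hr0 : 0 < r := by linarith [hA3.1]
  obtain rfl | ⟨n, rfl⟩ : j = 1 ∨ ∃ n, j = n + 2 := by
    rcases Nat.lt_or_ge j 2 with h2 | h2
    · exact Or.inl (by omega)
    · exact Or.inr ⟨j - 2, by omega⟩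
  · have hx := mesh_pos hmesh le_rfl h2
    rw [delta_one hα1 hmesh.1 (hm 0 one_pos), mul_inv_cancel_left₀ hG.ne']
    have hsl : slope t (fun i => decFun α a (t i)) 0 = (t 1 + a) ^ (α - 2) := by
      unfold slope
      simp only [zero_add, hmesh.1]
      rw [decFun_eq (by linarith), decFun_eq (by linarith)]
      rw [zero_mul, sub_zero, sub_zero, mul_div_cancel_left₀ _ hx.ne']
    rw [hsl]
    have e1 : a ^ α * (t 1 + a) ^ (-2 : ℝ) ≤ (t 1 + a) ^ (α - 2) := by
      rw [sub_eq_add_neg, Real.rpow_add (by linarith)]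
      exact mul_le_mul_of_nonneg_right (Real.rpow_le_rpow ha0.le (by linarith) hα.le)
        (by positivity)
    have e2 := mul_le_mul_of_nonneg_right e1 (show 0 ≤ t 1 ^ (1 - α) / (1 - α) by positivity)
    have e3 : 0 ≤ (t 1 + a) ^ (α - 2) * (t 1 ^ (1 - α) / (1 - α)) := by positivity
    have e4 : a ^ α * t 1 ^ (1 - α) * (t 1 + a) ^ (-2 : ℝ) / (1 - α)
        = a ^ α * (t 1 + a) ^ (-2 : ℝ) * (t 1 ^ (1 - α) / (1 - α)) := by ring
    rw [e4]
    linarith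
  · rw [delta_add_two hα1 hmesh.1 hm, mul_inv_cancel_left₀ hG.ne']
    have hτ : ∀ i, i ≤ n → t (i + 1) - t i ≤ t (i + 2) - t (i + 1) :=
      fun i hi => mesh_mono_steps hmesh hA2 (by omega)
    have hτ' : ∀ i, i ≤ n + 1 → t (i + 1) - t i ≤ t (n + 2) - t (n + 1) := by
      intro i hi
      induction hi using Nat.decreasingInduction with
      | of_succ k hk ih => exact (hτ k (by omega)).trans ih
      | self => exact le_rfl
    have hfrac : ∀ i, i ≤ n + 1 → 0 < t (i + 1) + a ∧ 0 < a / (t (i + 1) + a) ∧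
        a / (t (i + 1) + a) ≤ 1 := by
      intro i hi
      have hp := mesh_pos hmesh (show 1 ≤ i + 1 by omega) (by omega)
      exact ⟨by positivity, by positivity, by rw [div_le_one (by positivity)]; linarith⟩
    have hstep : ∀ i, i ≤ n + 1 → t (i + 1) - t i
        ≤ θ * (t (i + 1) + a) * (a / (t (i + 1) + a)) ^ (α / (3 - α)) := by
      intro i hi
      obtain ⟨f1, f2, f3⟩ := hfrac i hi
      refine (hκ α γ T M t hmesh hA3 (i + 1) a (by omega) (by omega) ha).trans ?_
      refine mul_le_mul_of_nonneg_left ?_ (by positivity)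
      -- The grading restriction is used in the form 1/r ≥ α/(3-α).
      refine Real.rpow_le_rpow_of_exponent_ge f2 f3 ?_
      rw [div_le_div_iff₀ h3α hr0]
      rw [le_div_iff₀ hα] at hr
      linarith
    rcases le_total (t (n + 2)) a with hle | hge
    · refine decay_of_le hα.le hα1 hm hmesh.1 ha0 hτ hτ' hθ0.le ?_ (fun i hi => ?_) hle
      · have : α ^ 2 / (3 - α) ≤ 1 / 2 := by rw [div_le_iff₀ h3α]; nlinarith
        rw [hθ]; linarith
      · obtain ⟨f1, f2, f3⟩ := hfrac i hi
        exact (hstep i hi).trans (mul_le_of_le_one_right (by positivity)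
          (Real.rpow_le_one f2.le f3 (by positivity)))
    · exact decay_of_ge hα hα1 hm hmesh.1 ha0 hτ hτ' hθ hstep hge

end

end L2Subdiffusion

namespace L2Subdiffusion

noncomputable section

/-! ### Superposition of decaying barriers over dyadic scales -/

section superposition

variable {α γ : ℝ}

theorem one_add_mul_half_le_rpow {g z : ℝ} (hg : 0 ≤ g) (hz : 0 ≤ z) (hz1 : z ≤ 1) :
    1 + g * (z / 2) ≤ (1 + z) ^ g := by
  have h1 : 0 < 1 + z := by linarith
  have h2 := Real.one_sub_inv_le_log_of_pos h1
  have h3 : z / 2 ≤ 1 - (1 + z)⁻¹ := by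
    have : 1 - (1 + z)⁻¹ = z / (1 + z) := by field_simp; ring
    rw [this]
    exact div_le_div_of_nonneg_left hz h1 (by linarith)
  have h4 := mul_le_mul_of_nonneg_left (h3.trans h2) hg
  rw [Real.rpow_def_of_pos h1]
  have := Real.add_one_le_exp (Real.log (1 + z) * g)
  linarith

theorem decFun_nonneg {a s : ℝ} (ha : 0 < a) (hs : 0 ≤ s) : 0 ≤ decFun α a s := by
  rw [decFun_eq (by linarith)]
  positivity

theorem decFun_le {a s : ℝ} (hα1 : α < 1) (ha : 0 < a) (hs : 0 < s) :
    decFun α a s ≤ s ^ (α - 1) := by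
  rw [decFun_eq (by linarith), show α - 1 = (α - 2) + 1 by ring, Real.rpow_add_one hs.ne', mul_comm]
  exact mul_le_mul_of_nonneg_right
    (Real.rpow_le_rpow_of_nonpos hs (by linarith) (by linarith)) hs.le

/-- Bounds one scale by the increment of (a/(s+a))^g when a is doubled, so that the sum over dyadic
scales telescopes to a bounded quantity. -/
theorem rpow_mul_decFun_le {g a s : ℝ} (hg : 0 < g) (hgα : g < 1 - α) (ha : 0 < a) (hs : 0 < s) :
    a ^ g * decFun α a s
      ≤ s ^ (α - 1 + g) * (4 / g) * ((2 * a / (s + 2 * a)) ^ g - (a / (s + a)) ^ g) := by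
  have hsa : 0 < s + a := by linarith
  set z := s / (s + 2 * a) with hz
  have hz0 : 0 ≤ z := by positivity
  have hz1 : z ≤ 1 := by rw [hz, div_le_one (by positivity)]; linarith
  have h1 : 2 * a / (s + 2 * a) = a / (s + a) * (1 + z) := by rw [hz]; field_simp; ring
  have h2 := one_add_mul_half_le_rpow hg.le hz0 hz1
  have h3 : s / (2 * (s + a)) ≤ z :=
    div_le_div_of_nonneg_left hs.le (by positivity) (by linarith)
  have h4 : (a / (s + a)) ^ g = a ^ g * (s + a) ^ (-g) := by
    rw [Real.div_rpow ha.le hsa.le, Real.rpow_neg hsa.le, div_eq_mul_inv]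
  have h5 : a ^ g * (s + a) ^ (-g) * (g / 4 * (s / (s + a)))
      ≤ (2 * a / (s + 2 * a)) ^ g - (a / (s + a)) ^ g := by
    rw [h1, Real.mul_rpow (by positivity) (by linarith), h4]
    have h6 : g / 4 * (s / (s + a)) ≤ (1 + z) ^ g - 1 := by
      have e : s / (s + a) = 2 * (s / (2 * (s + a))) := by field_simp
      have := mul_le_mul_of_nonneg_left h3 hg.le
      rw [e]; linarith
    have := mul_le_mul_of_nonneg_left h6 (show 0 ≤ a ^ g * (s + a) ^ (-g) by positivity)
    linarith
  have h7 : (s + a) ^ (α - 1 + g) ≤ s ^ (α - 1 + g) :=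
    Real.rpow_le_rpow_of_nonpos hs (by linarith) (by linarith)
  have h8 : (s + a) ^ (α - 2) = (s + a) ^ (α - 1 + g) * ((s + a) ^ (-g) / (s + a)) := by
    rw [← Real.rpow_sub_one hsa.ne', ← Real.rpow_add hsa]; congr 1; ring
  rw [decFun_eq hsa, h8]
  calc a ^ g * (s * ((s + a) ^ (α - 1 + g) * ((s + a) ^ (-g) / (s + a))))
      = (s + a) ^ (α - 1 + g) * (a ^ g * s * ((s + a) ^ (-g) / (s + a))) := by ring
    _ ≤ s ^ (α - 1 + g) * (a ^ g * s * ((s + a) ^ (-g) / (s + a))) :=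
        mul_le_mul_of_nonneg_right h7 (by positivity)
    _ = s ^ (α - 1 + g) * (4 / g) * (a ^ g * (s + a) ^ (-g) * (g / 4 * (s / (s + a)))) := by
        field_simp
    _ ≤ _ := mul_le_mul_of_nonneg_left h5 (by positivity)

/-- The dyadic scales needed to reach `T` from `τ`. -/
def scaleCount (T τ : ℝ) : ℕ := ⌊Real.logb 2 (T / τ)⌋₊ + 1

theorem scaleCount_le {T τ : ℝ} (hτ : 0 < τ) (hT : τ ≤ T) :
    (scaleCount T τ : ℝ) ≤ 2 * (1 + Real.log (T / τ)) := by
  have h1 : 1 ≤ T / τ := by rwa [one_le_div hτ]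
  have h2 : 0 ≤ Real.log (T / τ) := Real.log_nonneg h1
  have h3 : 0 ≤ Real.logb 2 (T / τ) := Real.logb_nonneg (by norm_num) h1
  have h4 := Nat.floor_le h3
  have h5 : Real.logb 2 (T / τ) ≤ 2 * Real.log (T / τ) := by
    have h6 := Real.log_two_gt_d9
    rw [Real.logb, div_le_iff₀ (by linarith)]
    nlinarith
  unfold scaleCount
  push_cast
  linarith

/-- Take the largest dyadic multiple of κτ not exceeding s, or the first scale if s is smaller than
κτ. -/
theorem exists_scale {κ T τ s : ℝ} (hκ : 1 ≤ κ) (hτ : 0 < τ) (hs : τ ≤ s) (hT : s ≤ T) :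
    ∃ i, i < scaleCount T τ ∧ s / 2 ≤ 2 ^ i * (κ * τ) ∧ 2 ^ i * (κ * τ) ≤ κ * s := by
  have hs0 : 0 < s := hτ.trans_le hs
  have hκτ : 0 < κ * τ := by positivity
  rcases le_total (κ * τ) s with h | h
  · obtain ⟨i, h1, h2⟩ := exists_nat_pow_near (show 1 ≤ s / (κ * τ) by rwa [one_le_div hκτ])
      (show (1 : ℝ) < 2 by norm_num)
    rw [le_div_iff₀ hκτ] at h1
    rw [div_lt_iff₀ hκτ, pow_succ] at h2
    refine ⟨i, ?_, by linarith, h1.trans (le_mul_of_one_le_left hs0.le hκ)⟩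
    unfold scaleCount
    refine Nat.lt_succ_of_le (Nat.le_floor ?_)
    have h3 : (2 : ℝ) ^ i ≤ T / τ := by
      rw [le_div_iff₀ hτ]
      have := mul_le_mul_of_nonneg_left (le_mul_of_one_le_left hτ.le hκ)
        (show (0 : ℝ) ≤ 2 ^ i by positivity)
      linarith
    rw [Real.le_logb_iff_rpow_le (by norm_num) (by have := hs0.trans_le hT; positivity),
      Real.rpow_natCast]
    exact h3
  · refine ⟨0, Nat.succ_pos _, ?_, ?_⟩
    · rw [pow_zero, one_mul]; linarith
    · rw [pow_zero, one_mul]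
      exact mul_le_mul_of_nonneg_left hs (by linarith)

theorem sum_scales_le_of_pos {κ : ℝ} (hα1 : α < 1) (hγ : 0 < γ) (hκ : 1 ≤ κ) {τ s : ℝ} (hτ : 0 < τ)
    (hs : 0 < s) (N : ℕ) :
    ∑ i ∈ Finset.range N, (2 ^ i * (κ * τ)) ^ (-γ) * decFun α (2 ^ i * (κ * τ)) s
      ≤ (1 - (2 : ℝ) ^ (-γ))⁻¹ * (τ ^ (-γ) * s ^ (α - 1)) := by
  have hκτ : 0 < κ * τ := by positivity
  have hq0 : (0 : ℝ) ≤ 2 ^ (-γ) := by positivity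
  have hq1 : (2 : ℝ) ^ (-γ) < 1 :=
    Real.rpow_lt_one_of_one_lt_of_neg (by norm_num) (by linarith)
  have hsum : ∑ i ∈ Finset.range N, ((2 : ℝ) ^ (-γ)) ^ i ≤ (1 - (2 : ℝ) ^ (-γ))⁻¹ := by
    rw [← tsum_geometric_of_lt_one hq0 hq1]
    exact (summable_geometric_of_lt_one hq0 hq1).sum_le_tsum _ fun i _ => by positivity
  have h0 : 0 ≤ τ ^ (-γ) * s ^ (α - 1) := by positivity
  refine le_trans ?_ (mul_le_mul_of_nonneg_right hsum h0)
  rw [Finset.sum_mul]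
  refine Finset.sum_le_sum fun i _ => ?_
  have e1 : ((2 : ℝ) ^ i * (κ * τ)) ^ (-γ) ≤ ((2 : ℝ) ^ (-γ)) ^ i * τ ^ (-γ) := by
    rw [Real.mul_rpow (by positivity) hκτ.le, ← Real.rpow_natCast, ← Real.rpow_natCast,
      ← Real.rpow_mul (by norm_num), ← Real.rpow_mul (by norm_num), mul_comm (i : ℝ)]
    refine mul_le_mul_of_nonneg_left ?_ (by positivity)
    exact Real.rpow_le_rpow_of_nonpos hτ (le_mul_of_one_le_left hτ.le hκ) (by linarith)
  calc _ ≤ ((2 : ℝ) ^ (-γ)) ^ i * τ ^ (-γ) * s ^ (α - 1) :=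
        mul_le_mul e1 (decFun_le hα1 (by positivity) hs) (decFun_nonneg (by positivity) hs.le)
          (by positivity)
    _ = _ := by ring

theorem sum_scales_le_of_neg {κ : ℝ} (hγ : γ < 0) (hγα : α - 1 < γ) (hκ : 1 ≤ κ) {τ s : ℝ}
    (hτ : 0 < τ) (hs : 0 < s) (N : ℕ) :
    ∑ i ∈ Finset.range N, (2 ^ i * (κ * τ)) ^ (-γ) * decFun α (2 ^ i * (κ * τ)) s
      ≤ 4 / (-γ) * s ^ (α - 1 - γ) := by
  have hκτ : 0 < κ * τ := by positivity
  set φ : ℕ → ℝ := fun i => (2 ^ i * (κ * τ) / (s + 2 ^ i * (κ * τ))) ^ (-γ) with hφ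
  have h1 := Finset.sum_le_sum fun i (_ : i ∈ Finset.range N) =>
    rpow_mul_decFun_le (α := α) (show 0 < -γ by linarith) (by linarith)
      (show 0 < 2 ^ i * (κ * τ) by positivity) hs
  have h2 : ∀ i, (2 * (2 ^ i * (κ * τ)) / (s + 2 * (2 ^ i * (κ * τ)))) ^ (-γ) = φ (i + 1) := by
    intro i
    simp only [hφ, pow_succ]
    rw [show (2 : ℝ) * (2 ^ i * (κ * τ)) = 2 ^ i * 2 * (κ * τ) by ring]
  simp_rw [h2] at h1
  rw [← Finset.mul_sum, Finset.sum_range_sub φ] at h1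
  have h3 : φ N ≤ 1 := by
    refine Real.rpow_le_one (by positivity) ?_ (by linarith)
    rw [div_le_one (by positivity)]
    linarith
  have h4 : 0 ≤ φ 0 := Real.rpow_nonneg (by positivity) _
  have hγ' : 0 < -γ := by linarith
  have h5 : 0 ≤ s ^ (α - 1 - γ) * (4 / (-γ)) := by positivity
  refine h1.trans ?_
  rw [← sub_eq_add_neg]
  have := mul_le_mul_of_nonneg_left (show φ N - φ 0 ≤ 1 by linarith) h5
  linarith

/-- For γ > 0 the weights form a geometric series; for γ = 0 they are equal and the number of scales
gives the logarithm; for γ < 0 the sum telescopes. -/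
theorem exists_sum_scales_le (hα1 : α < 1) (hγα : α - 1 < γ) : ∃ C : ℝ, 0 ≤ C ∧
    ∀ κ τ s T : ℝ, 1 ≤ κ → 0 < τ → τ ≤ s → s ≤ T →
      τ ^ (γ + 1) * ∑ i ∈ Finset.range (scaleCount T τ),
          (2 ^ i * (κ * τ)) ^ (-γ) * decFun α (2 ^ i * (κ * τ)) s
        ≤ C * (ell γ T τ * τ * s ^ (α - 1) * (τ / s) ^ (min 0 γ)) := by
  rcases lt_trichotomy γ 0 with hγ | rfl | hγ
  · refine ⟨4 / (-γ), by have : 0 < -γ := by linarith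
                         positivity, ?_⟩
    intro κ τ s T hκ hτ hs hT
    have hs0 := hτ.trans_le hs
    have h := mul_le_mul_of_nonneg_left (sum_scales_le_of_neg hγ hγα hκ hτ hs0 (scaleCount T τ))
      (show 0 ≤ τ ^ (γ + 1) by positivity)
    refine h.trans (le_of_eq ?_)
    rw [ell, if_neg hγ.ne, min_eq_right hγ.le, Real.div_rpow hτ.le hs0.le,
      Real.rpow_add_one hτ.ne', Real.rpow_sub hs0]
    ring
  · refine ⟨2, by norm_num, ?_⟩
    intro κ τ s T hκ hτ hs hT
    have hs0 := hτ.trans_le hs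
    rw [ell, if_pos rfl, min_self, Real.rpow_zero, zero_add, Real.rpow_one]
    have h1 : ∑ i ∈ Finset.range (scaleCount T τ),
        (2 ^ i * (κ * τ)) ^ (-0 : ℝ) * decFun α (2 ^ i * (κ * τ)) s
        ≤ scaleCount T τ * s ^ (α - 1) := by
      rw [← nsmul_eq_mul, ← Finset.card_range (scaleCount T τ), ← Finset.sum_const]
      simp only [Finset.card_range]
      refine Finset.sum_le_sum fun i _ => ?_
      rw [neg_zero, Real.rpow_zero, one_mul]
      exact decFun_le hα1 (by positivity) hs0
    have h2 := mul_le_mul_of_nonneg_right (scaleCount_le hτ (hs.trans hT))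
      (show 0 ≤ s ^ (α - 1) by positivity)
    have h3 := mul_le_mul_of_nonneg_left (h1.trans h2) hτ.le
    linarith
  · have hq1 : (2 : ℝ) ^ (-γ) < 1 :=
      Real.rpow_lt_one_of_one_lt_of_neg (by norm_num) (by linarith)
    refine ⟨(1 - (2 : ℝ) ^ (-γ))⁻¹, inv_nonneg.2 (by linarith), ?_⟩
    intro κ τ s T hκ hτ hs hT
    have hs0 := hτ.trans_le hs
    have h := mul_le_mul_of_nonneg_left (sum_scales_le_of_pos hα1 hγ hκ hτ hs0 (scaleCount T τ))
      (show 0 ≤ τ ^ (γ + 1) by positivity)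
    refine h.trans (le_of_eq ?_)
    have e : τ ^ (γ + 1) * τ ^ (-γ) = τ := by
      rw [← Real.rpow_add hτ]
      simp
    rw [ell, if_neg hγ.ne', min_eq_left hγ.le, Real.rpow_zero]
    linear_combination (1 - (2 : ℝ) ^ (-γ))⁻¹ * s ^ (α - 1) * e

/-- The supersolution of the operator without zeroth-order term. -/
theorem exists_decaying_barrier (hα : 0 < α) (hα1 : α < 1) {r : ℝ} (c : ℝ)
    (hr : r ≤ (3 - α) / α) (hγ : α - 1 < γ) (hγα : γ < α) : ∃ C : ℝ, 0 ≤ C ∧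
    ∀ (σ γ' T : ℝ) (M : ℕ) (t : ℕ → ℝ), IsMesh T M t → MeshA2Star σ M t →
      MeshA3 α γ' r c M t → HasBarrier α 0 M t (fun j => (tau t 1 / t j) ^ (γ + 1))
        (fun j => C * stabBound α γ T t j) := by
  obtain ⟨κ, hκ, hdec⟩ := exists_decay_bound hα hα1 r c hr
  obtain ⟨C, hC, hub⟩ := exists_sum_scales_le hα1 hγ
  have h1α : 0 < 1 - α := by linarith
  have hG := Real.Gamma_pos_of_pos h1α
  set G := Real.Gamma (1 - α)
  -- The share of the normalised data that the scale comparable with t_j provides; dividing the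
  -- weights by it gives the data exactly.
  set c₁ := G⁻¹ * (1 / 2 * ((1 / 2) ^ (α - γ) * (1 + κ) ^ (-2 : ℝ) / (1 - α))) with hc₁
  have hc₁0 : 0 < c₁ := by positivity
  refine ⟨C / c₁, by positivity, ?_⟩
  intro σ γ' T M t hmesh hA2 hA3
  rcases Nat.eq_zero_or_pos M with rfl | hM
  · exact ⟨fun _ => 0, le_rfl, fun j h1 h2 => by omega⟩
  have hτ := tau_one_pos hmesh hM
  set τ := tau t 1 with hτdef
  set N := scaleCount T τ with hN
  set A : ℕ → ℝ := fun i => 2 ^ i * (κ * τ) with hA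
  have hA0 : ∀ i, 0 < A i := fun i => by positivity
  have hAκ : ∀ i, κ * τ ≤ A i := fun i =>
    le_mul_of_one_le_left (by positivity) (one_le_pow₀ (by norm_num))
  set w : ℕ → ℝ := fun i => τ ^ (γ + 1) / c₁ * A i ^ (-γ) with hw
  have hw0 : ∀ i, 0 ≤ w i := fun i => by have := hA0 i; positivity
  refine ⟨fun j => ∑ i ∈ Finset.range N, w i * decFun α (A i) (t j), ?_, fun j h1 h2 => ?_⟩
  · exact Finset.sum_nonneg fun i _ => mul_nonneg (hw0 i) (decFun_nonneg (hA0 i) hmesh.1.ge)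
  have htj := mesh_pos hmesh h1 h2
  have hτj := tau_one_le hmesh h1 h2
  have htT := mesh_le_end hmesh h2
  refine ⟨?_, ?_, ?_⟩
  · rw [zero_mul, add_zero, delta_sum hα1 hmesh.1 (fun i hi => hmesh.2.2 i (by omega)) h1
      (fun i j => decFun α (A i) (t j))]
    have hlow : ∀ i, G⁻¹ * (1 / 2 * (A i ^ α * t j ^ (1 - α) * (t j + A i) ^ (-2 : ℝ) / (1 - α)))
        ≤ delta α t (fun k => decFun α (A i) (t k)) j := fun i => by
      rw [inv_mul_le_iff₀ hG]
      exact hdec σ γ' T M t hmesh hA2 hA3 j (A i) h1 h2 (hAκ i)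
    -- Every scale contributes nonnegatively, so the one comparable with t_j is enough.
    obtain ⟨i, hi, ha1, ha2⟩ := exists_scale hκ hτ hτj htT
    have hnn : ∀ k ∈ Finset.range N, 0 ≤ w k * delta α t (fun l => decFun α (A k) (t l)) j :=
      fun k _ => mul_nonneg (hw0 k) (le_trans (by have := hA0 k; positivity) (hlow k))
    refine le_trans ?_ (Finset.single_le_sum hnn (Finset.mem_range.2 hi))
    refine le_trans ?_ (mul_le_mul_of_nonneg_left (hlow i) (hw0 i))
    change t j / 2 ≤ A i at ha1
    change A i ≤ κ * t j at ha2
    have hAi := hA0 i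
    -- The assumption γ < α is used here: the lower bound for the scale must be raised to a positive
    -- power.
    have p1 : (1 / 2 : ℝ) ^ (α - γ) * t j ^ (α - γ) ≤ A i ^ (α - γ) := by
      rw [← Real.mul_rpow (by norm_num) htj.le]
      exact Real.rpow_le_rpow (by positivity) (by linarith) (by linarith)
    have p2 : (1 + κ) ^ (-2 : ℝ) * t j ^ (-2 : ℝ) ≤ (t j + A i) ^ (-2 : ℝ) := by
      rw [← Real.mul_rpow (by positivity) htj.le]
      exact Real.rpow_le_rpow_of_nonpos (by positivity) (by linarith) (by norm_num)
    have p3 := mul_le_mul p1 p2 (by positivity) (by positivity)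
    have p4 : t j ^ (α - γ) * t j ^ (-2 : ℝ) * t j ^ (1 - α) = t j ^ (-(γ + 1)) := by
      rw [← Real.rpow_add htj, ← Real.rpow_add htj]; congr 1; ring
    have p5 : A i ^ (-γ) * A i ^ α = A i ^ (α - γ) := by
      rw [← Real.rpow_add hAi]; congr 1; ring
    have p6 := mul_le_mul_of_nonneg_left p3
      (show 0 ≤ τ ^ (γ + 1) / c₁ * (G⁻¹ * (1 / 2 * (t j ^ (1 - α) / (1 - α)))) by positivity)
    refine le_trans (le_of_eq ?_) (p6.trans (le_of_eq ?_))
    · beta_reduce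
      rw [Real.div_rpow hτ.le htj.le, div_eq_mul_inv, ← Real.rpow_neg htj.le, ← p4]
      have hq : c₁⁻¹ * c₁ = 1 := inv_mul_cancel₀ hc₁0.ne'
      calc τ ^ (γ + 1) * (t j ^ (α - γ) * t j ^ (-2 : ℝ) * t j ^ (1 - α))
          = τ ^ (γ + 1) * (t j ^ (α - γ) * t j ^ (-2 : ℝ) * t j ^ (1 - α)) * (c₁⁻¹ * c₁) := by
            rw [hq, mul_one]
        _ = τ ^ (γ + 1) * (t j ^ (α - γ) * t j ^ (-2 : ℝ) * t j ^ (1 - α)) * (c₁⁻¹ *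
            (G⁻¹ * (1 / 2 * ((1 / 2) ^ (α - γ) * (1 + κ) ^ (-2 : ℝ) / (1 - α))))) := by
            rw [← hc₁]
        _ = _ := by ring
    · rw [hw, ← p5]; ring
  · exact Finset.sum_nonneg fun i _ => mul_nonneg (hw0 i) (decFun_nonneg (hA0 i) htj.le)
  · have h := hub κ τ (t j) T hκ hτ hτj htT
    have h' := div_le_div_of_nonneg_right h hc₁0.le
    refine le_trans (le_of_eq ?_) (h'.trans (le_of_eq ?_))
    · rw [Finset.mul_sum, Finset.sum_div]
      refine Finset.sum_congr rfl fun i _ => ?_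
      rw [hw]; ring
    · unfold stabBound
      ring

end superposition

end

end L2Subdiffusion

namespace L2Subdiffusion

noncomputable section

/-! ### Supersolutions on meshes with a fixed number of cells -/

section fixed

variable {α lam T R σ : ℝ} {M : ℕ} {t : ℕ → ℝ}

theorem slope_geometric (R : ℝ) (t : ℕ → ℝ) (i : ℕ) :
    slope t (fun j => R ^ j) i = R ^ i * (R - 1) / (t (i + 1) - t i) := by
  unfold slope
  beta_reduce
  rw [pow_succ]; ring_nf

theorem midMoment_nonneg {x a b : ℝ} (hα : 0 ≤ α) (hab : a ≤ b) (hb : b < x) :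
    0 ≤ midMoment α x a b := by
  refine le_trans ?_ (midMoment_bounds hα hab hb).1
  have := kerDeriv_nonneg hα (hab.trans hb.le)
  have : 0 ≤ b - a := by linarith
  positivity

theorem cellMass_nonneg {x a b : ℝ} (hα : 0 ≤ α) (hα1 : α < 1) (hab : a ≤ b) (hb : b < x) :
    0 ≤ cellMass α x a b := by
  refine le_trans ?_ (le_cellMass hα hα1 hab hb)
  have := kerDeriv_nonneg hα (hab.trans hb.le)
  have h1 := ker_nonneg (x := x) (s := a) α (by linarith)
  have : 0 ≤ b - a := by linarith
  positivity

/-- For R ≥ 2ρ the slopes of R^j at least double from cell to cell, so all second differences are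
nonnegative and the last cell alone may be kept. Its curvature gives the gain α/(4(2-α)) over linear
interpolation. -/
theorem le_opL_geometric (hα : 0 < α) (hα1 : α < 1) {n : ℕ} {ρ : ℝ}
    (hm : ∀ j, j < n + 2 → t j < t (j + 1))
    (hτ : ∀ i, i ≤ n → t (i + 1) - t i ≤ t (i + 2) - t (i + 1))
    (hρ : ∀ i, i ≤ n → t (i + 2) - t (i + 1) ≤ ρ * (t (i + 1) - t i))
    (hR1 : 1 ≤ R) (hR : 2 * ρ ≤ R) :
    R ^ (n + 1) * (R - 1) * (1 + α / (4 * (2 - α)))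
        * ((t (n + 2) - t (n + 1)) ^ (-α) / (1 - α))
      ≤ opL α t (fun j => R ^ j) n := by
  have h1α : 0 < 1 - α := by linarith
  have h2α : 0 < 2 - α := by linarith
  have hd : ∀ i, i ≤ n + 1 → 0 < t (i + 1) - t i := fun i hi => by linarith [hm i (by omega)]
  have hS0 : ∀ i, i ≤ n + 1 → 0 ≤ slope t (fun j => R ^ j) i := fun i hi => by
    rw [slope_geometric]
    have := hd i hi
    have : 0 ≤ R - 1 := by linarith
    positivity
  have hS : ∀ i, i ≤ n → slope t (fun j => R ^ j) i ≤ 1 / 2 * slope t (fun j => R ^ j) (i + 1) := by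
    intro i hi
    have e1 := hd i (by omega)
    have e2 : 0 < t (i + 2) - t (i + 1) := hd (i + 1) (by omega)
    rw [slope_geometric, slope_geometric, ← mul_div_assoc, div_le_div_iff₀ e1 e2, pow_succ]
    have h1 : t (i + 2) - t (i + 1) ≤ 1 / 2 * R * (t (i + 1) - t i) :=
      (hρ i hi).trans (mul_le_mul_of_nonneg_right (by linarith) e1.le)
    have h2 : 0 ≤ R ^ i * (R - 1) := mul_nonneg (by positivity) (by linarith)
    have := mul_le_mul_of_nonneg_left h1 h2
    linarith
  have hcurv : ∀ i, i ≤ n → 0 ≤ curv t (fun j => R ^ j) i := fun i hi =>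
    div_nonneg (by linarith [hS i hi, hS0 (i + 1) (by omega)])
      (by linarith [mesh_lt hm (show i < i + 2 by omega) (by omega)])
  rw [opL_eq_sum hα1, Finset.sum_range_succ]
  have hfirst : 0 ≤ ∑ i ∈ Finset.range (n + 1),
      (slope t (fun j => R ^ j) i * cellMass α (t (n + 2)) (t i) (t (i + 1))
        + curv t (fun j => R ^ j) (min i n) * midMoment α (t (n + 2)) (t i) (t (i + 1))) := by
    refine Finset.sum_nonneg fun i hi => ?_
    have hi := Finset.mem_range.1 hi
    have e1 := hm i (by omega)
    have e2 := mesh_lt hm (show i + 1 < n + 2 by omega) le_rfl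
    exact add_nonneg (mul_nonneg (hS0 i (by omega)) (cellMass_nonneg hα.le hα1 e1.le e2))
      (mul_nonneg (hcurv _ (min_le_right _ _)) (midMoment_nonneg hα.le e1.le e2))
  have e3 : t (n + 1) < t (n + 2) := hm (n + 1) (by omega)
  rw [min_eq_right (by omega : n ≤ n + 1), cellMass_last hα1, midMoment_last hα1 e3]
  set h := t (n + 2) - t (n + 1) with hh
  have hh0 : 0 < h := by linarith
  set s := slope t (fun j => R ^ j) (n + 1) with hs
  have hs' : s = R ^ (n + 1) * (R - 1) / h := slope_geometric R t (n + 1)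
  have hs0 : 0 ≤ s := hS0 (n + 1) le_rfl
  have hc : s / (4 * h) ≤ curv t (fun j => R ^ j) n := by
    have h1 := hS n le_rfl
    have h2 := hτ n le_rfl
    have h3 := hd n (by omega)
    unfold curv
    rw [← hs, div_le_div_iff₀ (by positivity) (by linarith)]
    rw [← hs] at h1
    have h4 : t (n + 2) - t n ≤ 2 * h := by linarith
    have h5 := mul_le_mul_of_nonneg_left h4 hs0
    have h6 := mul_le_mul_of_nonneg_right (show s ≤ 2 * (s - slope t (fun j => R ^ j) n) by linarith)
      (show 0 ≤ 2 * h by positivity)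
    linarith
  have hc' := mul_le_mul_of_nonneg_right hc
    (show 0 ≤ h ^ (2 - α) * (α / ((1 - α) * (2 - α))) by positivity)
  have p1 : h ^ (1 - α) = h ^ (-α) * h := by
    rw [← Real.rpow_add_one hh0.ne']; congr 1; ring
  have p2 : h ^ (2 - α) = h ^ (-α) * h * h := by
    rw [← Real.rpow_add_one hh0.ne', ← Real.rpow_add_one hh0.ne']; congr 1; ring
  refine le_trans (le_of_eq ?_) (add_le_add hfirst (add_le_add le_rfl hc'))
  rw [hs', p1, p2]
  field_simp
  ring

/-- The steps are nondecreasing, so their mean lies between the first and the last. -/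
theorem end_div_le (hmesh : IsMesh T M t) (hA : MeshA2Star σ M t) (hM : 1 ≤ M) :
    tau t 1 ≤ T / M ∧ T / M ≤ tau t M := by
  obtain ⟨m, rfl⟩ : ∃ m, M = m + 1 := ⟨M - 1, by omega⟩
  have hτ : ∀ i, i + 2 ≤ m + 1 → t (i + 1) - t i ≤ t (i + 2) - t (i + 1) :=
    fun i hi => mesh_mono_steps hmesh hA hi
  have hlast : ∀ i, i ≤ m → t (i + 1) - t i ≤ t (m + 1) - t m := by
    intro i hi
    induction hi using Nat.decreasingInduction with
    | of_succ k hk ih => exact (hτ k (by omega)).trans ih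
    | self => exact le_rfl
  have hfirst : ∀ i, i ≤ m → t 1 - t 0 ≤ t (i + 1) - t i := by
    intro i
    induction i with
    | zero => intro _; exact le_rfl
    | succ i ih => intro hi; exact (ih (by omega)).trans (hτ i (by omega))
  have hsum : ∑ i ∈ Finset.range (m + 1), (t (i + 1) - t i) = T := by
    rw [Finset.sum_range_sub, hmesh.1, hmesh.2.1, sub_zero]
  have h1 := Finset.sum_le_sum fun i (hi : i ∈ Finset.range (m + 1)) =>
    hfirst i (Nat.lt_succ_iff.1 (Finset.mem_range.1 hi))
  have h2 := Finset.sum_le_sum fun i (hi : i ∈ Finset.range (m + 1)) =>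
    hlast i (Nat.lt_succ_iff.1 (Finset.mem_range.1 hi))
  rw [hsum, Finset.sum_const, Finset.card_range, nsmul_eq_mul] at h1 h2
  have hm0 : (0 : ℝ) < ((m + 1 : ℕ) : ℝ) := by positivity
  rw [le_div_iff₀ hm0, div_le_iff₀ hm0]
  refine ⟨?_, ?_⟩
  · simp only [tau, Nat.sub_self]; linarith
  · simp only [tau, Nat.add_sub_cancel]; linarith

/-- On meshes with `M` cells a geometric sequence is a supersolution for constant data. -/
theorem exists_geometric_barrier (hα : 0 < α) (hα1 : α < 1) (hT : 0 < T)
    (hlam : 0 ≤ lam) (M : ℕ) : ∃ C : ℝ, 0 ≤ C ∧ ∀ t : ℕ → ℝ, IsMesh T M t → MeshA2Star σ M t →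
      (∀ j, 1 ≤ j → j ≤ M → lam * tau t j ^ α < (Real.Gamma (2 - α))⁻¹) →
      HasBarrier α lam M t (fun _ => 1) (fun _ => C) := by
  rcases Nat.eq_zero_or_pos M with rfl | hM
  · exact ⟨0, le_rfl, fun t _ _ _ => ⟨fun _ => 0, le_rfl, fun j h1 h2 => by omega⟩⟩
  have hMr : (0 : ℝ) < M := by exact_mod_cast hM
  have hTM : 0 < T / M := by positivity
  have hG2 : 0 < Real.Gamma (2 - α) := Real.Gamma_pos_of_pos (by linarith)
  have hGe := Gamma_two_sub hα1
  have h1α : 0 < 1 - α := by linarith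
  have h2α : 0 < 2 - α := by linarith
  have hG := Real.Gamma_pos_of_pos h1α
  -- The last step is at least T/M, so if this fails, no mesh satisfies the step restriction.
  -- Otherwise the gap between λ and the diagonal entry at level one is bounded below independently
  -- of the mesh.
  by_cases hlt : lam * (T / M) ^ α < (Real.Gamma (2 - α))⁻¹
  swap
  · refine ⟨0, le_rfl, fun t hmesh hA hstep => absurd ?_ hlt⟩
    have h := (end_div_le hmesh hA hM).2
    exact (mul_le_mul_of_nonneg_left (Real.rpow_le_rpow hTM.le h hα.le) hlam).trans_lt
      (hstep M hM le_rfl)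
  set μ₀ := (Real.Gamma (2 - α))⁻¹ * (T / M) ^ (-α) with hμ₀
  have hμ : lam < μ₀ := by
    rw [hμ₀, Real.rpow_neg hTM.le, ← div_eq_mul_inv, lt_div_iff₀ (Real.rpow_pos_of_pos hTM _)]
    exact hlt
  set ε := α / (4 * (2 - α)) with hε
  have hε0 : 0 < ε := by positivity
  set ν := (Real.Gamma (2 - α))⁻¹ * T ^ (-α) with hν
  have hν0 : 0 < ν := by positivity
  set ρ := 2 / (1 - σ) - 1 with hρ
  -- In order: doubling slopes; level one, through the gap μ₀ - λ; keeping the gain 1 + ε/2 in spite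
  -- of the factor R - 1 in place of R; and a remainder of at least 1 from the other half of ε. From
  -- level two on this gain makes λ ≤ μ suffice, so no uniform strictness of the step restriction is
  -- needed.
  set R := 1 + |2 * ρ| + (lam + 1) / (μ₀ - lam) + 2 * (1 + ε) / ε + 2 / (ε * ν) with hR
  have hd : 0 < μ₀ - lam := by linarith
  have q1 : 0 ≤ (lam + 1) / (μ₀ - lam) := by positivity
  have q2 : 0 ≤ 2 * (1 + ε) / ε := by positivity
  have q3 : 0 ≤ 2 / (ε * ν) := by positivity
  have q4 := abs_nonneg (2 * ρ)
  have hR1 : 1 ≤ R := by linarith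
  have hRρ : 2 * ρ ≤ R := by linarith [le_abs_self (2 * ρ)]
  have hRμ : lam + 1 ≤ (R - 1) * (μ₀ - lam) := by
    rw [← div_le_iff₀ hd]; linarith
  have hRε : R * (1 + ε / 2) ≤ (R - 1) * (1 + ε) := by
    have : 2 * (1 + ε) / ε ≤ R := by linarith
    rw [div_le_iff₀ hε0] at this
    linarith
  have hRν : 1 ≤ R * (ν * (ε / 2)) := by
    have : 2 / (ε * ν) ≤ R := by linarith
    rw [div_le_iff₀ (by positivity)] at this
    linarith
  refine ⟨R ^ M, by positivity, fun t hmesh hA hstep => ⟨fun j => R ^ j, by positivity,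
    fun j h1 h2 => ⟨?_, by positivity, pow_le_pow_right₀ hR1 h2⟩⟩⟩
  have hm : ∀ i, i < j → t i < t (i + 1) := fun i hi => hmesh.2.2 i (by omega)
  obtain rfl | ⟨n, rfl⟩ : j = 1 ∨ ∃ n, j = n + 2 := by
    rcases Nat.lt_or_ge j 2 with h2 | h2
    · exact Or.inl (by omega)
    · exact Or.inr ⟨j - 2, by omega⟩
  · have hx := mesh_pos hmesh le_rfl h2
    rw [delta_one hα1 hmesh.1 (hm 0 one_pos), slope_geometric]
    have hle := (end_div_le hmesh hA hM).1
    rw [tau_one hmesh] at hle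
    have e1 := Real.rpow_le_rpow_of_nonpos hx hle (show -α ≤ 0 by linarith)
    have e2 : μ₀ ≤ (Real.Gamma (2 - α))⁻¹ * t 1 ^ (-α) :=
      mul_le_mul_of_nonneg_left e1 (inv_nonneg.2 hG2.le)
    have p1 : t 1 ^ (1 - α) = t 1 ^ (-α) * t 1 := by
      rw [← Real.rpow_add_one hx.ne']; congr 1; ring
    have e3 : (Real.Gamma (1 - α))⁻¹ * (R ^ 0 * (R - 1) / (t (0 + 1) - t 0)
        * (t 1 ^ (1 - α) / (1 - α))) = (R - 1) * ((Real.Gamma (2 - α))⁻¹ * t 1 ^ (-α)) := by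
      rw [zero_add, hmesh.1, sub_zero, p1, hGe]
      field_simp
    rw [e3]
    have := mul_le_mul_of_nonneg_left e2 (show 0 ≤ R - 1 by linarith)
    beta_reduce
    rw [pow_one]
    linarith
  · rw [delta_add_two hα1 hmesh.1 hm]
    have hτ : ∀ i, i ≤ n → t (i + 1) - t i ≤ t (i + 2) - t (i + 1) :=
      fun i hi => mesh_mono_steps hmesh hA (by omega)
    have hρ' : ∀ i, i ≤ n → t (i + 2) - t (i + 1) ≤ ρ * (t (i + 1) - t i) := by
      intro i hi
      have h := (hA (i + 2) (by omega) (by omega)).2.1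
      have e := hm i (by omega)
      simp only [rho, tau, show i + 2 - 1 = i + 1 from rfl, show i + 1 - 1 = i from rfl] at h
      rwa [div_le_iff₀ (by linarith)] at h
    have hop := mul_le_mul_of_nonneg_left (le_opL_geometric hα hα1 hm hτ hρ' hR1 hRρ)
      (inv_nonneg.2 hG.le)
    refine le_trans ?_ hop
    have hh0 : 0 < t (n + 2) - t (n + 1) := by
      have : t (n + 1) < t (n + 2) := hm (n + 1) (by omega)
      linarith
    have hhT : t (n + 2) - t (n + 1) ≤ T := by
      linarith [mesh_le_end hmesh h2, mesh_nonneg hmesh (show n + 1 ≤ M by omega)]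
    have hst : lam * (t (n + 2) - t (n + 1)) ^ α < (Real.Gamma (2 - α))⁻¹ := hstep (n + 2) h1 h2
    set h := t (n + 2) - t (n + 1)
    set μ := (Real.Gamma (2 - α))⁻¹ * h ^ (-α) with hμdef
    have m1 : lam ≤ μ := by
      rw [hμdef, Real.rpow_neg hh0.le, ← div_eq_mul_inv, le_div_iff₀ (Real.rpow_pos_of_pos hh0 _)]
      exact hst.le
    have m2 : ν ≤ μ := mul_le_mul_of_nonneg_left
      (Real.rpow_le_rpow_of_nonpos hh0 hhT (by linarith)) (inv_nonneg.2 hG2.le)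
    have e3 : (Real.Gamma (1 - α))⁻¹ * (R ^ (n + 1) * (R - 1) * (1 + ε) * (h ^ (-α) / (1 - α)))
        = R ^ (n + 1) * ((R - 1) * (1 + ε)) * μ := by
      rw [hμdef, hGe]; field_simp
    rw [e3]
    have hP : 1 ≤ R ^ (n + 1) := one_le_pow₀ hR1
    have hμ0 : 0 ≤ μ := hν0.le.trans m2
    have f1 := mul_le_mul_of_nonneg_right (mul_le_mul_of_nonneg_left hRε
      (zero_le_one.trans hP)) hμ0
    have f2 : 1 ≤ R * (μ * (ε / 2)) := hRν.trans (mul_le_mul_of_nonneg_left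
      (mul_le_mul_of_nonneg_right m2 (by positivity)) (by linarith))
    have f3 : R * (μ * (ε / 2)) ≤ R ^ (n + 1) * (R * (μ * (ε / 2))) :=
      le_mul_of_one_le_left (by linarith) hP
    have f4 := mul_le_mul_of_nonneg_left m1 (show 0 ≤ R ^ (n + 2) by positivity)
    have f5 : R ^ (n + 2) = R ^ (n + 1) * R := pow_succ _ _
    beta_reduce
    rw [f5] at f4 ⊢
    linarith

end fixed

end

end L2Subdiffusion

namespace L2Subdiffusion

noncomputable section

/-! ### Supersolutions with the zeroth-order term -/

section barriers

variable {α γ lam T : ℝ} {M : ℕ} {t : ℕ → ℝ}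

theorem stabBound_of_neg (hγ : γ < 0) (hmesh : IsMesh T M t) {j : ℕ} (h1 : 1 ≤ j) (h2 : j ≤ M) :
    stabBound α γ T t j = tau t 1 ^ (γ + 1) * t j ^ (α - 1 - γ) := by
  have hτ := tau_one_pos hmesh (h1.trans h2)
  have ht := mesh_pos hmesh h1 h2
  rw [stabBound, ell, if_neg hγ.ne, min_eq_right hγ.le, Real.div_rpow hτ.le ht.le,
    Real.rpow_add_one hτ.ne', Real.rpow_sub ht (α - 1)]
  ring

theorem stabBound_of_nonneg (hγ : 0 ≤ γ) (j : ℕ) :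
    stabBound α γ T t j = ell γ T (tau t 1) * (tau t 1 * t j ^ (α - 1)) := by
  rw [stabBound, min_eq_left hγ, Real.rpow_zero]
  ring

theorem one_le_ell {τ : ℝ} (hτ : 0 < τ) (hT : τ ≤ T) : 1 ≤ ell γ T τ := by
  unfold ell
  split_ifs
  · linarith [Real.log_nonneg ((one_le_div hτ).2 hT)]
  · exact le_rfl

theorem le_stabBound (hα1 : α < 1) (hmesh : IsMesh T M t) {j : ℕ} (h1 : 1 ≤ j) (h2 : j ≤ M) :
    tau t 1 * T ^ (α - 1) ≤ stabBound α γ T t j := by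
  have hτ := tau_one_pos hmesh (h1.trans h2)
  have ht := mesh_pos hmesh h1 h2
  have hle := tau_one_le hmesh h1 h2
  have hT := mesh_le_end hmesh h2
  have e1 : T ^ (α - 1) ≤ t j ^ (α - 1) := Real.rpow_le_rpow_of_nonpos ht hT (by linarith)
  have e2 : 1 ≤ (tau t 1 / t j) ^ (min 0 γ) :=
    Real.one_le_rpow_of_pos_of_le_one_of_nonpos (by positivity) (by rwa [div_le_one ht])
      (min_le_left _ _)
  have e3 : 1 ≤ ell γ T (tau t 1) := one_le_ell hτ (hle.trans hT)
  have e4 : 0 ≤ T ^ (α - 1) := Real.rpow_nonneg (ht.le.trans hT) _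
  unfold stabBound
  calc tau t 1 * T ^ (α - 1) = 1 * tau t 1 * T ^ (α - 1) * 1 := by ring
    _ ≤ ell γ T (tau t 1) * tau t 1 * t j ^ (α - 1) * (tau t 1 / t j) ^ (min 0 γ) := by gcongr

theorem stabBound_nonneg (hα1 : α < 1) (hmesh : IsMesh T M t) {j : ℕ} (h1 : 1 ≤ j) (h2 : j ≤ M) :
    0 ≤ stabBound α γ T t j :=
  le_trans (mul_nonneg (tau_one_pos hmesh (h1.trans h2)).le
    (Real.rpow_nonneg ((mesh_nonneg hmesh h2).trans (mesh_le_end hmesh h2)) _))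
    (le_stabBound hα1 hmesh h1 h2)

/-- The zeroth-order term of a power barrier is absorbed by the next barrier of the scale. -/
theorem HasBarrier.absorb_power (hα : 0 ≤ α) (hα1 : α < 1) (hmesh : IsMesh T M t) (hM : 1 ≤ M)
    (hlam : 0 ≤ lam) {f : ℕ → ℝ} {K C δ : ℝ} (hK : 0 ≤ K) (hC : 0 ≤ C) (hδ : δ < 0)
    (h : HasBarrier α 0 M t f (fun j => K * (tau t 1 ^ (δ + α + 1) * t j ^ (-1 - δ))))
    (h' : HasBarrier α lam M t (fun j => (tau t 1 / t j) ^ (δ + 1))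
      (fun j => C * stabBound α δ T t j)) :
    HasBarrier α lam M t f
      (fun j => (1 + lam * C * T ^ α) * (K * (tau t 1 ^ (δ + α + 1) * t j ^ (-1 - δ)))) := by
  have hτ := tau_one_pos hmesh hM
  have hs := h'.smul hα1 hmesh (show 0 ≤ lam * K * tau t 1 ^ α by positivity)
  refine (h.absorb hα1 hmesh hlam (hs.mono (g' := fun j => lam * K * tau t 1 ^ α *
    (C * stabBound α δ T t j)) (fun j h1 h2 => le_of_eq ?_) fun j _ _ => le_rfl)).mono
    (fun j _ _ => le_rfl) fun j h1 h2 => ?_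
  · have ht := mesh_pos hmesh h1 h2
    rw [Real.div_rpow hτ.le ht.le, show δ + α + 1 = α + (δ + 1) by ring, Real.rpow_add hτ,
      show -1 - δ = -(δ + 1) by ring, Real.rpow_neg ht.le]
    ring
  · have ht := mesh_pos hmesh h1 h2
    have e1 : t j ^ (α - 1 - δ) ≤ t j ^ (-1 - δ) * T ^ α := by
      rw [show α - 1 - δ = (-1 - δ) + α by ring, Real.rpow_add ht]
      exact mul_le_mul_of_nonneg_left (Real.rpow_le_rpow ht.le (mesh_le_end hmesh h2) hα)
        (by positivity)
    have e2 := mul_le_mul_of_nonneg_left e1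
      (show 0 ≤ lam * K * C * tau t 1 ^ (δ + α + 1) by positivity)
    have e3 : tau t 1 ^ α * tau t 1 ^ (δ + 1) = tau t 1 ^ (δ + α + 1) := by
      rw [← Real.rpow_add hτ]; congr 1; ring
    rw [stabBound_of_neg hδ hmesh h1 h2]
    have e4 : lam * K * tau t 1 ^ α * (C * (tau t 1 ^ (δ + 1) * t j ^ (α - 1 - δ)))
        = lam * K * C * tau t 1 ^ (δ + α + 1) * t j ^ (α - 1 - δ) := by rw [← e3]; ring
    rw [e4]
    linarith

/-- Induction on the number of shifts by α needed to bring γ down to α - 1. Below that value the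
increasing barrier includes λ; above it the decaying barrier leaves a term of exponent γ - α. -/
theorem exists_barrier_of_neg_of_le (hα : 0 < α) (hα1 : α < 1) (hlam : 0 ≤ lam)
    (hT : 0 < T) (r c : ℝ) (n : ℕ) : ∀ γ : ℝ, γ < 0 → γ ≤ α - 1 + n * α →
      (α - 1 < γ → r ≤ (3 - α) / α) → ∃ C : ℝ, 0 ≤ C ∧ ∃ M₀ : ℕ, 1 ≤ M₀ ∧
        ∀ (σ γ' : ℝ) (M : ℕ) (t : ℕ → ℝ), M₀ ≤ M → IsMesh T M t → MeshA2Star σ M t →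
          MeshA3 α γ' r c M t → HasBarrier α lam M t (fun j => (tau t 1 / t j) ^ (γ + 1))
            (fun j => C * stabBound α γ T t j) := by
  have hlow : ∀ γ : ℝ, γ < 0 → γ ≤ α - 1 → ∃ C : ℝ, 0 ≤ C ∧ ∃ M₀ : ℕ, 1 ≤ M₀ ∧
      ∀ (σ γ' : ℝ) (M : ℕ) (t : ℕ → ℝ), M₀ ≤ M → IsMesh T M t → MeshA2Star σ M t →
        MeshA3 α γ' r c M t → HasBarrier α lam M t (fun j => (tau t 1 / t j) ^ (γ + 1))
          (fun j => C * stabBound α γ T t j) := by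
    intro γ hγ hle
    obtain ⟨C, hC, M₀, h⟩ := increasing_barrier hα hα1 (β := α - 1 - γ) (by linarith) hlam T r c
    refine ⟨C, hC, max 1 M₀, le_max_left _ _, ?_⟩
    intro σ γ' M t hM hmesh _ hA3
    have hM1 : 1 ≤ M := (le_max_left _ _).trans hM
    have hτ := tau_one_pos hmesh hM1
    refine ((h γ' M t ((le_max_right _ _).trans hM) hmesh hA3).smul hα1 hmesh
      (show 0 ≤ tau t 1 ^ (γ + 1) by positivity)).mono (fun j h1 h2 => le_of_eq ?_)
      fun j h1 h2 => le_of_eq ?_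
    · have ht := mesh_pos hmesh h1 h2
      rw [Real.div_rpow hτ.le ht.le, show α - 1 - γ - α = -(γ + 1) by ring, Real.rpow_neg ht.le,
        div_eq_mul_inv]
    · rw [stabBound_of_neg hγ hmesh h1 h2]
      ring
  induction n with
  | zero =>
    intro γ hγ hle _
    exact hlow γ hγ (by simpa using hle)
  | succ n ih =>
    intro γ hγ hle hr
    rcases le_or_gt γ (α - 1) with hγ1 | hγ1
    · exact hlow γ hγ hγ1
    obtain ⟨C₁, hC₁, h⟩ := exists_decaying_barrier hα hα1 c (hr hγ1) hγ1 (by linarith)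
    obtain ⟨C₂, hC₂, M₀, hM₀, h'⟩ := ih (γ - α) (by linarith)
      (by push_cast at hle; linarith) (fun _ => hr hγ1)
    refine ⟨(1 + lam * C₂ * T ^ α) * C₁, by positivity, M₀, hM₀, ?_⟩
    intro σ γ' M t hM hmesh hA2 hA3
    have e : γ - α + α + 1 = γ + 1 := by ring
    have e' : -1 - (γ - α) = α - 1 - γ := by ring
    have hb := HasBarrier.absorb_power hα.le hα1 hmesh (hM₀.trans hM) hlam hC₁ hC₂
      (show γ - α < 0 by linarith) ((h σ γ' T M t hmesh hA2 hA3).mono (fun j _ _ => le_rfl)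
        fun j h1 h2 => by rw [e, e', stabBound_of_neg hγ hmesh h1 h2])
      (h' σ γ' M t hM hmesh hA2 hA3)
    refine hb.mono (fun j _ _ => le_rfl) fun j h1 h2 => le_of_eq ?_
    rw [e, e', stabBound_of_neg hγ hmesh h1 h2]
    ring

theorem exists_barrier_of_neg (hα : 0 < α) (hα1 : α < 1) (hlam : 0 ≤ lam) (hT : 0 < T)
    {r : ℝ} (c : ℝ) (hγ : γ < 0) (hr : α - 1 < γ → r ≤ (3 - α) / α) :
    ∃ C : ℝ, 0 ≤ C ∧ ∃ M₀ : ℕ, 1 ≤ M₀ ∧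
      ∀ (σ γ' : ℝ) (M : ℕ) (t : ℕ → ℝ), M₀ ≤ M → IsMesh T M t → MeshA2Star σ M t →
        MeshA3 α γ' r c M t → HasBarrier α lam M t (fun j => (tau t 1 / t j) ^ (γ + 1))
          (fun j => C * stabBound α γ T t j) := by
  obtain ⟨n, hn⟩ := exists_nat_ge (1 / α)
  rw [div_le_iff₀ hα] at hn
  exact exists_barrier_of_neg_of_le hα hα1 hlam hT r c n γ hγ (by linarith) hr

/-- The decaying barrier needs γ < α. Lowering γ to min{γ, α/2} only enlarges the data, as τ_1 ≤
t_j, and changes neither ℓ_γ nor the bound, which depends on γ ≥ 0 only through ℓ_γ. The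
zeroth-order term then has exponent -α. -/
theorem exists_barrier_of_nonneg (hα : 0 < α) (hα1 : α < 1) (hlam : 0 ≤ lam) (hT : 0 < T)
    {r : ℝ} (c : ℝ) (hγ : 0 ≤ γ) (hr : r ≤ (3 - α) / α) :
    ∃ C : ℝ, 0 ≤ C ∧ ∃ M₀ : ℕ, 1 ≤ M₀ ∧
      ∀ (σ γ' : ℝ) (M : ℕ) (t : ℕ → ℝ), M₀ ≤ M → IsMesh T M t → MeshA2Star σ M t →
        MeshA3 α γ' r c M t → HasBarrier α lam M t (fun j => (tau t 1 / t j) ^ (γ + 1))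
          (fun j => C * stabBound α γ T t j) := by
  have hγ0 : 0 ≤ min γ (α / 2) := le_min hγ (by linarith)
  obtain ⟨C₁, hC₁, h⟩ := exists_decaying_barrier (γ := min γ (α / 2)) hα hα1 c hr (by linarith)
    (by linarith [min_le_right γ (α / 2)])
  obtain ⟨C₂, hC₂, M₀, hM₀, h'⟩ := exists_barrier_of_neg (γ := -α) hα hα1 hlam hT c
    (by linarith) (fun _ => hr)
  refine ⟨(1 + lam * C₂ * T ^ α) * C₁, by positivity, M₀, hM₀, ?_⟩
  intro σ γ' M t hM hmesh hA2 hA3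
  have hM1 := hM₀.trans hM
  have hτ := tau_one_pos hmesh hM1
  have hell : ell (min γ (α / 2)) T (tau t 1) = ell γ T (tau t 1) := by
    rcases hγ.eq_or_lt with rfl | hpos
    · rw [min_eq_left (by linarith)]
    · have : 0 < min γ (α / 2) := lt_min hpos (by linarith)
      rw [ell, ell, if_neg this.ne', if_neg hpos.ne']
  have hell0 : 0 ≤ ell γ T (tau t 1) :=
    zero_le_one.trans (one_le_ell hτ ((tau_one_le hmesh le_rfl hM1).trans (mesh_le_end hmesh hM1)))
  have e : -α + α + 1 = 1 := by ring
  have e' : -1 - -α = α - 1 := by ring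
  have hb := HasBarrier.absorb_power hα.le hα1 hmesh hM1 hlam
    (f := fun j => (tau t 1 / t j) ^ (γ + 1)) (mul_nonneg hC₁ hell0) hC₂
    (show -α < 0 by linarith) ((h σ γ' T M t hmesh hA2 hA3).mono (fun j h1 h2 => ?_)
      fun j h1 h2 => by
        rw [e, e', Real.rpow_one, stabBound_of_nonneg hγ0, hell]
        linarith)
    (h' σ γ' M t hM hmesh hA2 hA3)
  · refine hb.mono (fun j _ _ => le_rfl) fun j h1 h2 => le_of_eq ?_
    rw [e, e', Real.rpow_one, stabBound_of_nonneg hγ]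
    ring
  · have ht := mesh_pos hmesh h1 h2
    exact Real.rpow_le_rpow_of_exponent_ge (by positivity)
      (by rw [div_le_one ht]; exact tau_one_le hmesh h1 h2) (by linarith [min_le_left γ (α / 2)])

/-- For fixed M, τ_1 is bounded below by M^{-r}/c, so data and stability bound are comparable with
constants. -/
theorem exists_barrier_of_cells (hα : 0 < α) (hα1 : α < 1) (σ : ℝ) (hT : 0 < T)
    (hlam : 0 ≤ lam) (γ r c : ℝ) (M : ℕ) : ∃ C : ℝ, 0 ≤ C ∧ ∀ t : ℕ → ℝ, IsMesh T M t →
      MeshA2Star σ M t → MeshA3 α γ r c M t →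
      (∀ j, 1 ≤ j → j ≤ M → lam * tau t j ^ α < (Real.Gamma (2 - α))⁻¹) →
      HasBarrier α lam M t (fun j => (tau t 1 / t j) ^ (γ + 1))
        (fun j => C * stabBound α γ T t j) := by
  obtain ⟨C, hC, h⟩ := exists_geometric_barrier (σ := σ) hα hα1 hT hlam M
  set D := |c| * (M : ℝ) ^ r with hD
  set K := (T * D) ^ |γ + 1| with hK
  have hK0 : 0 ≤ K := by positivity
  refine ⟨K * C * (D * T ^ (1 - α)), by positivity, ?_⟩
  intro t hmesh hA2 hA3 hstep
  refine ((h t hmesh hA2 hstep).smul hα1 hmesh hK0).mono (fun j h1 h2 => ?_) fun j h1 h2 => ?_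
  all_goals
    have hM := h1.trans h2
    have hMr : (0 : ℝ) < M := by exact_mod_cast hM
    have hτ := tau_one_pos hmesh hM
    have ht := mesh_pos hmesh h1 h2
    have hDτ : 1 ≤ D * tau t 1 := by
      have h3 := hA3.2.2.1.2
      rw [Real.rpow_neg hMr.le, inv_le_iff_one_le_mul₀ (by positivity)] at h3
      rw [hD, abs_of_pos (const_pos hmesh hA3 hM)]
      linarith
  · rw [mul_one, hK, show tau t 1 / t j = (t j / tau t 1)⁻¹ by rw [inv_div], Real.inv_rpow
      (by positivity), ← Real.rpow_neg (by positivity)]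
    have e1 : 1 ≤ t j / tau t 1 := by
      rw [one_le_div hτ]; exact tau_one_le hmesh h1 h2
    refine (Real.rpow_le_rpow_of_exponent_le e1 (neg_le_abs _)).trans
      (Real.rpow_le_rpow (by positivity) ?_ (abs_nonneg _))
    rw [div_le_iff₀ hτ]
    have := mul_le_mul_of_nonneg_left hDτ hT.le
    linarith [mesh_le_end hmesh h2]
  · have e1 := le_stabBound (γ := γ) hα1 hmesh h1 h2
    have e2 : T ^ (1 - α) * T ^ (α - 1) = 1 := by
      rw [← Real.rpow_add hT, show 1 - α + (α - 1) = 0 by ring, Real.rpow_zero]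
    have e3 := mul_le_mul_of_nonneg_left e1 (show 0 ≤ D * T ^ (1 - α) by positivity)
    have e4 : D * T ^ (1 - α) * (tau t 1 * T ^ (α - 1)) = D * tau t 1 := by
      linear_combination D * tau t 1 * e2
    have e5 := mul_le_mul_of_nonneg_left (show 1 ≤ D * T ^ (1 - α) * stabBound α γ T t j by
      linarith) (mul_nonneg hK0 hC)
    linarith

/-- A supersolution for the data `(τ_1 / t_j)^{γ+1}`, bounded by the stability bound uniformly in
the mesh. -/
theorem exists_barrier (hα : 0 < α) (hα1 : α < 1) (σ : ℝ) (hT : 0 < T)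
    (hlam : 0 ≤ lam) (γ r c : ℝ) : ∃ C : ℝ, ∀ (M : ℕ) (t : ℕ → ℝ), IsMesh T M t →
      MeshA2Star σ M t → MeshA3 α γ r c M t →
      (∀ j, 1 ≤ j → j ≤ M → lam * tau t j ^ α < (Real.Gamma (2 - α))⁻¹) →
      HasBarrier α lam M t (fun j => (tau t 1 / t j) ^ (γ + 1))
        (fun j => C * stabBound α γ T t j) := by
  -- If the grading restriction fails, no mesh satisfies A3.
  by_cases hr : α - 1 < γ → r ≤ (3 - α) / α
  swap
  · exact ⟨0, fun M t _ _ hA3 => absurd hA3.2.1 hr⟩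
  obtain ⟨C, hC, M₀, -, h⟩ : ∃ C : ℝ, 0 ≤ C ∧ ∃ M₀ : ℕ, 1 ≤ M₀ ∧
      ∀ (σ γ' : ℝ) (M : ℕ) (t : ℕ → ℝ), M₀ ≤ M → IsMesh T M t → MeshA2Star σ M t →
        MeshA3 α γ' r c M t → HasBarrier α lam M t (fun j => (tau t 1 / t j) ^ (γ + 1))
          (fun j => C * stabBound α γ T t j) := by
    rcases lt_or_ge γ 0 with hγ | hγ
    · exact exists_barrier_of_neg hα hα1 hlam hT c hγ hr
    · exact exists_barrier_of_nonneg hα hα1 hlam hT c hγ (hr (by linarith))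
  -- The finitely many M < M₀ are covered by summing their constants.
  choose D hD hcell using exists_barrier_of_cells hα hα1 σ hT hlam γ r c
  have hsum : 0 ≤ ∑ i ∈ Finset.range M₀, D i := Finset.sum_nonneg fun i _ => hD i
  refine ⟨C + ∑ i ∈ Finset.range M₀, D i, fun M t hmesh hA2 hA3 hstep => ?_⟩
  rcases le_or_gt M₀ M with hM | hM
  · exact (h σ γ M t hM hmesh hA2 hA3).mono (fun j _ _ => le_rfl) fun j h1 h2 =>
      mul_le_mul_of_nonneg_right (by linarith) (stabBound_nonneg hα1 hmesh h1 h2)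
  · have := Finset.single_le_sum (fun i _ => hD i) (Finset.mem_range.2 hM)
    exact (hcell M t hmesh hA2 hA3 hstep).mono (fun j _ _ => le_rfl) fun j h1 h2 =>
      mul_le_mul_of_nonneg_right (by linarith) (stabBound_nonneg hα1 hmesh h1 h2)

end barriers

end

end L2Subdiffusion

theorem mainTheorem4 (α : ℝ) (hα₀ : 0 < α) (hα₁ : α < 1) :
    (∃ σ : ℝ, L2Subdiffusion.IsThreshold α σ) ∧
    ∀ σ : ℝ, L2Subdiffusion.IsThreshold α σ →
      ∀ γ T lam r c C₀ : ℝ, 0 < T → 0 ≤ lam →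
        ∃ C : ℝ, ∀ (M : ℕ) (t : ℕ → ℝ),
          L2Subdiffusion.IsMesh T M t →
          L2Subdiffusion.MeshA2Star σ M t →
          L2Subdiffusion.MeshA3 α γ r c M t →
          (∀ j, 1 ≤ j → j ≤ M →
            lam * L2Subdiffusion.tau t j ^ α < (Real.Gamma (2 - α))⁻¹) →
          ∀ U : ℕ → ℝ, U 0 = 0 →
            (∀ j, 1 ≤ j → j ≤ M →
              L2Subdiffusion.delta α t U j - lam * U j
                ≤ C₀ * (L2Subdiffusion.tau t 1 / t j) ^ (γ + 1)) →
            ∀ j, 1 ≤ j → j ≤ M → U j ≤ C * L2Subdiffusion.stabBound α γ T t j := by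
  refine ⟨L2Subdiffusion.exists_threshold hα₀ hα₁, fun σ hσ γ T lam r c C₀ hT hlam => ?_⟩
  obtain ⟨C, hC⟩ := L2Subdiffusion.exists_barrier hα₀ hα₁ σ hT hlam γ r c
  refine ⟨|C₀| * C, fun M t hmesh hA2 hA3 hstep U hU0 hU j h1 h2 => ?_⟩
  rw [mul_assoc]
  exact (hC M t hmesh hA2 hA3 hstep).le hα₀ hα₁ hσ hmesh hA2 hstep hlam
    (fun i hi hiM => Real.rpow_nonneg (div_nonneg
      (L2Subdiffusion.tau_one_pos hmesh (hi.trans hiM)).le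
      (L2Subdiffusion.mesh_pos hmesh hi hiM).le) _) hU0 hU j h1 h2
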